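/- Let $\Phi$ be a field of characteristic different from $2$ and $3$. Write $(a,b,c)=(ab)c-a(bc)$ and $[a,b]=ab-ba$. A (nonassociative, not necessarily unital) $\Phi$-algebra is a $(-1,1)$-algebra if it satisfies $(a,b,b)=0$ and $(a,b,c)+(b,c,a)+(c,a,b)=0$, and a strongly $(-1,1)$-algebra if it satisfies in addition $[[a,b],c]=0$. Let $G=G_0\oplus G_1$ be the unital associative Grassmann algebra over $\Phi$ on generators $e_1,e_2,\dots$. A superalgebra $A=A_0\oplus A_1$ is a (strongly) $(-1,1)$-superalgebra if its Grassmann envelope $G(A)=A_0\otimes G_0+A_1\otimes G_1$ is a (strongly) $(-1,1)$-algebra. For a set $Z$, let $F[Z;x]$ be the quotient of the free strongly $(-1,1)$-superalgebra on the set $Z$ of even generators and one odd generator $x$ by the ideal generated by all $[z,f]$, where $z\in Z$ and $f$ is any element. For a commutative associative unital algebra $\Gamma$, a derivation $D$ of $\Gamma$ and $\gamma\in\Gamma$, let $B(\Gamma,D,\gamma)=\Gamma\oplus\bar\Gamma$ be the superalgebra with even part $\Gamma$, odd part a copy $\bar\Gamma$ of $\Gamma$, and product $$a\times b=ab,\qquad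 a\times\bar b=\bar a\times b=\overline{ab},\qquad \bar a\times\bar b=\gamma ab+2D(a)b+aD(b).$$ If $\Gamma=\Phi[T]$ is a polynomial algebra, $\Phi_0[T]$ is the set of polynomials without constant term, $\gamma\in\Phi_0[T]$ and $D(\Phi[T])\subseteq\Phi_0[T]$, let $B_0(\Phi[T],D,\gamma)=\Phi_0[T]\oplus\overline{\Phi[T]}\subseteq B(\Phi[T],D,\gamma)$. Let $R_{a,b}$ be the operator $u\mapsto uR_{a,b}=(u,a,b)$. If $(v_i)_{i\in S}$ is a family in an algebra $A$ and $x\in A$, we say that the words $v^mx^\varepsilon$ form a normal basis of $A$ if, for every nonzero finitely supported exponent function $m:S\to\mathbb Z_{\ge 0}$, all products in which each $v_i$ occurs exactly $m_i$ times as a factor (in any order, with any brackets) are equal to one element $v^m$, and the family consisting of the elements $v^m$ ($m\ne0$), $x$, and $v^mx$ ($m\neq 0$), indexed by all pairs $(m,\varepsilon)\neq(0,0)$ with $\varepsilon\in\{0,1\}$, is a basis of $A$. **1.** Let $T_Z=\{t_0,t_1,\dots\}\cup\{z_0,z_1,\ldots\mid z\in Z\}$, and let $D$ be the derivation of $\Phi[T_Z]$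 with $D(t_i)=t_{i+1}$ and $D(z_i)=z_{i+1}$. There is an isomorphism of superalgebras $F[Z;x]\cong B_0(\Phi[T_Z],D,t_0)$ with $x\mapsto\bar 1$ and $z\mapsto z_0$ for $z\in Z$. **2.** $F[Z;x]$ has as a normal basis the words in the family $x^2R_{x,x}^i$, $zR_{x,x}^j$ ($z\in Z$, $i,j\ge0$) and $x$. **3.** For $Z=\{z\}$, write $F[z;x]$ for $F[Z;x]$, and let $$F_t=F[z;x]/\big((x^2,x,x),((z,x,x),x,x)\big),\qquad F_0=F[z;x]/\big(x^2,((z,x,x),x,x)\big),\qquad F_1=F[z;x]^\sharp/\big(x^2-1,((z,x,x),x,x)\big),$$ where $F[z;x]^\sharp$ is the algebra obtained by adjoining an external unit. There are isomorphisms of superalgebras, with $x\mapsto\bar1$ and $z\mapsto z$, $$F_t\cong B_0(\Phi[t,z,s],s\tfrac{d}{dz},t),\qquad F_1\cong B(\Phi[z,s],s\tfrac{d}{dz},1),\qquad F_0\cong B_0(\Phi[z,s],s\tfrac{d}{dz},0).$$ **4.** Normal bases are given by the words in the following families and $x$: for $F[z;x]$, the family $x^2R_{x,x}^i,\ zR_{x,x}^j$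 ($i,j\ge0$); for $F_t$, the family $x^2,z,zR_{x,x}$; for $F_0$, the family $z,zR_{x,x}$. For $F_1$, the words in the family $z,zR_{x,x}$ and $x$, together with the unit $1$ for $(m,\varepsilon)=(0,0)$, form a basis in the same sense. Thus the bases consist, respectively, of the elements $(x^2)^Iz^Jx^\varepsilon$, $(x^2)^mz^n(zR_{x,x})^kx^\varepsilon$, $z^n(zR_{x,x})^kx^\varepsilon$ (for $F_0$ and $F_1$), where $a^I=a^{i_0}(aR_{x,x})^{i_1}\cdots(aR_{x,x}^k)^{i_k}$ for finitely supported $I$, and where the empty word is excluded except for $F_1$. **5.** Let $F_{(-1,1)}[\emptyset;x]$ be the free $(-1,1)$-superalgebra on one odd generator $x$, and let the Grassmann $(-1,1)$-algebra $G_{(-1,1)}$ be the subalgebra of its Grassmann envelope generated by the elements $x\otimes e_i$, $i\geq1$. All products of the elements $x^2R_{x,x}^i$ ($i\ge0$) with the same exponents, in any order and with any brackets, are equal, and the elements $$(x^2)^Ix^\varepsilon\otimes e_{j_1}e_{j_2}\cdots e_{j_n},\qquad \varepsilon\in\{0,1\},\ (I,\varepsilon)\ne(0,0),\ j_1<\dots<j_n,\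 n=\deg\big((x^2)^Ix^\varepsilon\big)=\varepsilon+\sum_k i_k(2k+2),$$ indexed by $I$, $\varepsilon$ and $\{j_1,\dots,j_n\}$, form a basis of $G_{(-1,1)}$. -/

import Mathlib

open scoped TensorProduct

noncomputable section

namespace MinusOneOne

/-! ## Ideals and quotients of nonassociative algebras -/

section Ideals

variable {Φ : Type*} [Field Φ] {A : Type*} [NonUnitalNonAssocRing A] [Module Φ A]

variable (Φ A) in
/-- A two-sided ideal of a (nonunital, nonassociative) `Φ`-algebra. -/
structure AlgIdeal extends Submodule Φ A where
  mul_left_mem : ∀ (a : A) {x : A}, x ∈ carrier → a * x ∈ carrier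
  mul_right_mem : ∀ (a : A) {x : A}, x ∈ carrier → x * a ∈ carrier

namespace AlgIdeal

/-- The intersection of a family of ideals. -/
def sInf (S : Set (AlgIdeal Φ A)) : AlgIdeal Φ A where
  toSubmodule := ⨅ J ∈ S, J.toSubmodule
  mul_left_mem a x hx := by
    simp only [AddSubsemigroup.mem_carrier, AddSubmonoid.mem_toSubsemigroup,
      Submodule.mem_toAddSubmonoid, Submodule.mem_iInf] at hx ⊢
    exact fun J hJ => J.mul_left_mem a (hx J hJ)
  mul_right_mem a x hx := by
    simp only [AddSubsemigroup.mem_carrier, AddSubmonoid.mem_toSubsemigroup,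
      Submodule.mem_toAddSubmonoid, Submodule.mem_iInf] at hx ⊢
    exact fun J hJ => J.mul_right_mem a (hx J hJ)

variable (Φ) in
/-- The ideal generated by a set. -/
def span (s : Set A) : AlgIdeal Φ A := sInf {J | ∀ a ∈ s, a ∈ J.toSubmodule}

/-- The quotient algebra. -/
def Quotient (I : AlgIdeal Φ A) : Type _ := A ⧸ I.toSubmodule

variable (I : AlgIdeal Φ A)

instance : AddCommGroup I.Quotient := inferInstanceAs (AddCommGroup (A ⧸ I.toSubmodule))

instance : Module Φ I.Quotient := inferInstanceAs (Module Φ (A ⧸ I.toSubmodule))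

/-- The canonical projection, as a linear map. -/
def mkₗ : A →ₗ[Φ] I.Quotient := I.toSubmodule.mkQ

theorem mkₗ_surjective : Function.Surjective I.mkₗ := I.toSubmodule.mkQ_surjective

theorem mkₗ_eq_iff {a b : A} : I.mkₗ a = I.mkₗ b ↔ a - b ∈ I.toSubmodule :=
  Submodule.Quotient.eq I.toSubmodule

instance : Mul I.Quotient where
  mul := Quotient.map₂ (fun a b : A => a * b) (by
    intro a a' ha b b' hb
    have ha' : a - a' ∈ I.toSubmodule := (Submodule.quotientRel_def _).1 ha
    have hb' : b - b' ∈ I.toSubmodule := (Submodule.quotientRel_def _).1 hb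
    refine (Submodule.quotientRel_def _).2 ?_
    have h : a * b - a' * b' = (a - a') * b + a' * (b - b') := by
      rw [sub_mul, mul_sub]; abel
    rw [h]
    exact I.toSubmodule.add_mem (I.mul_right_mem b ha') (I.mul_left_mem a' hb'))

theorem mkₗ_mul (a b : A) : I.mkₗ (a * b) = I.mkₗ a * I.mkₗ b := rfl

instance : NonUnitalNonAssocRing I.Quotient where
  left_distrib a b c := by
    obtain ⟨a, rfl⟩ := I.mkₗ_surjective a
    obtain ⟨b, rfl⟩ := I.mkₗ_surjective b
    obtain ⟨c, rfl⟩ := I.mkₗ_surjective c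
    rw [← map_add, ← mkₗ_mul, ← mkₗ_mul, ← mkₗ_mul, ← map_add, mul_add]
  right_distrib a b c := by
    obtain ⟨a, rfl⟩ := I.mkₗ_surjective a
    obtain ⟨b, rfl⟩ := I.mkₗ_surjective b
    obtain ⟨c, rfl⟩ := I.mkₗ_surjective c
    rw [← map_add, ← mkₗ_mul, ← mkₗ_mul, ← mkₗ_mul, ← map_add, add_mul]
  zero_mul a := by
    obtain ⟨a, rfl⟩ := I.mkₗ_surjective a
    rw [← map_zero I.mkₗ, ← mkₗ_mul, zero_mul]
  mul_zero a := by
    obtain ⟨a, rfl⟩ := I.mkₗ_surjective a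
    rw [← map_zero I.mkₗ, ← mkₗ_mul, mul_zero]

instance [IsScalarTower Φ A A] : IsScalarTower Φ I.Quotient I.Quotient where
  smul_assoc r a b := by
    obtain ⟨a, rfl⟩ := I.mkₗ_surjective a
    obtain ⟨b, rfl⟩ := I.mkₗ_surjective b
    simp only [smul_eq_mul, ← map_smul, ← mkₗ_mul, smul_mul_assoc]

instance [SMulCommClass Φ A A] : SMulCommClass Φ I.Quotient I.Quotient where
  smul_comm r a b := by
    obtain ⟨a, rfl⟩ := I.mkₗ_surjective a
    obtain ⟨b, rfl⟩ := I.mkₗ_surjective b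
    simp only [smul_eq_mul, ← map_smul, ← mkₗ_mul, mul_smul_comm]

/-- An ideal is homogeneous for a family `𝒜` if it is spanned by its homogeneous elements. -/
def IsHomogeneous (𝒜 : ZMod 2 → Submodule Φ A) : Prop :=
  I.toSubmodule = ⨆ i, I.toSubmodule ⊓ 𝒜 i

/-- The grading induced on the quotient algebra. -/
def grading (𝒜 : ZMod 2 → Submodule Φ A) : ZMod 2 → Submodule Φ I.Quotient :=
  fun i => (𝒜 i).map I.mkₗ

end AlgIdeal

end Ideals

/-! ## The unital hull -/

section Hull

variable (Φ : Type*) [Field Φ] {A : Type*} [NonUnitalNonAssocRing A] [Module Φ A]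

/-- The grading of the unital hull `A^♯ = Φ·1 ⊕ A`, where `1` is even. -/
def hullGrading (𝒜 : ZMod 2 → Submodule Φ A) : ZMod 2 → Submodule Φ (Unitization Φ A) :=
  fun i => (if i = 0 then Submodule.span Φ {1} else ⊥) ⊔ (𝒜 i).map (Unitization.inrHom Φ Φ A)

end Hull

/-! ## The Grassmann algebra, Grassmann envelopes and varieties -/

section Varieties

variable (Φ : Type*) [Field Φ]

/-- The unital associative Grassmann algebra on countably many generators. -/
abbrev Grassmann : Type _ := ExteriorAlgebra Φ (ℕ →₀ Φ)

/-- The standard generators `e_0, e_1, …` of the Grassmann algebra. -/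
def gen (i : ℕ) : Grassmann Φ := ExteriorAlgebra.ι Φ (Finsupp.single i 1)

/-- `e_{j_1} ⋯ e_{j_n}` for a finite set `{j_1 < ⋯ < j_n}`. -/
def genProd (S : Finset ℕ) : Grassmann Φ := ((S.sort (· ≤ ·)).map (gen Φ)).prod

/-- The even and the odd part of the Grassmann algebra. -/
def grassmannGrading : ZMod 2 → Submodule Φ (Grassmann Φ) :=
  CliffordAlgebra.evenOdd (0 : QuadraticForm Φ (ℕ →₀ Φ))

variable {Φ}

/-- The Grassmann envelope `G(A) = A_0 ⊗ G_0 ⊕ A_1 ⊗ G_1` of a superalgebra `A = A_0 ⊕ A_1`,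
as a subspace (closed under multiplication) of the algebra `A ⊗ G`. -/
def grassmannEnvelope {A : Type*} [NonUnitalNonAssocRing A] [Module Φ A]
    (𝒜 : ZMod 2 → Submodule Φ A) : Submodule Φ (A ⊗[Φ] Grassmann Φ) :=
  Submodule.span Φ {w | ∃ (i : ZMod 2) (a : A) (g : Grassmann Φ),
    a ∈ 𝒜 i ∧ g ∈ grassmannGrading Φ i ∧ w = a ⊗ₜ[Φ] g}

variable (Φ) in
/-- A variety of algebras is given by a set of identities, that is, of nonassociative polynomials
in the variables `X_0, X_1, …`. -/
abbrev Identities : Type _ := Set (FreeNonUnitalNonAssocAlgebra Φ ℕ)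

/-- A superalgebra `A` is a `V`-superalgebra if its Grassmann envelope satisfies the identities
in `V`. -/
def IsSuperalgebraOf (V : Identities Φ) {A : Type*} [NonUnitalNonAssocRing A] [Module Φ A]
    [IsScalarTower Φ A A] [SMulCommClass Φ A A] (𝒜 : ZMod 2 → Submodule Φ A) : Prop :=
  ∀ f ∈ V, ∀ s : ℕ → A ⊗[Φ] Grassmann Φ, (∀ n, s n ∈ grassmannEnvelope 𝒜) →
    FreeNonUnitalNonAssocAlgebra.lift Φ s f = 0

variable (Φ)

/-- The variable `X_i`. -/
abbrev var (i : ℕ) : FreeNonUnitalNonAssocAlgebra Φ ℕ := FreeNonUnitalNonAssocAlgebra.of Φ i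

/-- The identities `(x,y,y) = 0` and `(x,y,z) + (y,z,x) + (z,x,y) = 0`
of `(-1,1)`-algebras. Here `associator x y z = (xy)z - x(yz)`. -/
def varietyMinusOneOne : Identities Φ :=
  {associator (var Φ 0) (var Φ 1) (var Φ 1),
   associator (var Φ 0) (var Φ 1) (var Φ 2) + associator (var Φ 1) (var Φ 2) (var Φ 0)
    + associator (var Φ 2) (var Φ 0) (var Φ 1)}

/-- The identities of strongly `(-1,1)`-algebras: in addition `[[x,y],z] = 0`. -/
def varietyStrongly : Identities Φ :=
  insert ((var Φ 0 * var Φ 1 - var Φ 1 * var Φ 0) * var Φ 2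
    - var Φ 2 * (var Φ 0 * var Φ 1 - var Φ 1 * var Φ 0)) (varietyMinusOneOne Φ)

end Varieties

/-! ## Free superalgebras of a variety -/

section Free

variable (Φ : Type*) [Field Φ]

/-- The parity of a nonassociative word: generators in `X` are even, those in `Y` are odd. -/
def parity {X Y : Type*} : FreeMagma (X ⊕ Y) → ZMod 2
  | .of (.inl _) => 0
  | .of (.inr _) => 1
  | .mul u v => parity u + parity v

/-- The grading of the free nonassociative algebra on `X ⊕ Y` by parity. -/
def freeGrading (X Y : Type*) (i : ZMod 2) :
    Submodule Φ (FreeNonUnitalNonAssocAlgebra Φ (X ⊕ Y)) :=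
  Submodule.span Φ (MonoidAlgebra.ofMagma Φ (FreeMagma (X ⊕ Y)) '' {w | parity w = i})

variable {Φ}

/-- The smallest homogeneous ideal of the free nonassociative superalgebra on even generators `X`
and odd generators `Y` whose quotient is a `V`-superalgebra. -/
def varietyIdeal (V : Identities Φ) (X Y : Type*) :
    AlgIdeal Φ (FreeNonUnitalNonAssocAlgebra Φ (X ⊕ Y)) :=
  AlgIdeal.sInf {J | J.IsHomogeneous (freeGrading Φ X Y) ∧
    IsSuperalgebraOf V (J.grading (freeGrading Φ X Y))}

/-- The free `V`-superalgebra `F_V[X;Y]`. -/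
abbrev FreeSuper (V : Identities Φ) (X Y : Type*) : Type _ := (varietyIdeal V X Y).Quotient

/-- The even generators of `F_V[X;Y]`. -/
def FreeSuper.even (V : Identities Φ) {X : Type*} (Y : Type*) (z : X) : FreeSuper V X Y :=
  (varietyIdeal V X Y).mkₗ (FreeNonUnitalNonAssocAlgebra.of Φ (Sum.inl z))

/-- The odd generators of `F_V[X;Y]`. -/
def FreeSuper.odd (V : Identities Φ) (X : Type*) {Y : Type*} (y : Y) : FreeSuper V X Y :=
  (varietyIdeal V X Y).mkₗ (FreeNonUnitalNonAssocAlgebra.of Φ (Sum.inr y))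

/-- The grading of `F_V[X;Y]`. -/
def FreeSuper.grading (V : Identities Φ) (X Y : Type*) : ZMod 2 → Submodule Φ (FreeSuper V X Y) :=
  (varietyIdeal V X Y).grading (freeGrading Φ X Y)

end Free

/-! ## The free strongly `(-1,1)`-superalgebra `F[Z;x]` with central even generators -/

section Central

variable (Φ : Type*) [Field Φ]

/-- The ideal of the free strongly `(-1,1)`-superalgebra `F_St[Z;x]` generated by all
`[z, f]`, `z ∈ Z`. -/
def centralIdeal (Z : Type*) : AlgIdeal Φ (FreeSuper (varietyStrongly Φ) Z Unit) :=
  AlgIdeal.span Φ {w | ∃ (z : Z) (f : FreeSuper (varietyStrongly Φ) Z Unit),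
    w = FreeSuper.even (varietyStrongly Φ) Unit z * f
      - f * FreeSuper.even (varietyStrongly Φ) Unit z}

/-- The superalgebra `F[Z;x]`. -/
abbrev FZx (Z : Type*) : Type _ := (centralIdeal Φ Z).Quotient

namespace FZx

variable {Z : Type*}

/-- The generators `z ∈ Z` of `F[Z;x]`. -/
def z (z : Z) : FZx Φ Z := (centralIdeal Φ Z).mkₗ (FreeSuper.even (varietyStrongly Φ) Unit z)

variable (Z)

/-- The odd generator `x` of `F[Z;x]`. -/
def x : FZx Φ Z := (centralIdeal Φ Z).mkₗ (FreeSuper.odd (varietyStrongly Φ) Z ())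

/-- The grading of `F[Z;x]`. -/
def grading : ZMod 2 → Submodule Φ (FZx Φ Z) :=
  (centralIdeal Φ Z).grading (FreeSuper.grading (varietyStrongly Φ) Z Unit)

end FZx

/-! ### The quotients `F_t`, `F_1`, `F_0` of `F[z;x]` -/

/-- The generator `z` of `F[z;x]`. -/
abbrev z₁ : FZx Φ Unit := FZx.z Φ ()

/-- The generator `x` of `F[z;x]`. -/
abbrev x₁ : FZx Φ Unit := FZx.x Φ Unit

/-- The ideal `((x²,x,x), ((z,x,x),x,x))` of `F[z;x]`. -/
def idealT : AlgIdeal Φ (FZx Φ Unit) :=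
  AlgIdeal.span Φ {associator (x₁ Φ * x₁ Φ) (x₁ Φ) (x₁ Φ),
    associator (associator (z₁ Φ) (x₁ Φ) (x₁ Φ)) (x₁ Φ) (x₁ Φ)}

/-- The ideal `(x², ((z,x,x),x,x))` of `F[z;x]`. -/
def idealZero : AlgIdeal Φ (FZx Φ Unit) :=
  AlgIdeal.span Φ {x₁ Φ * x₁ Φ, associator (associator (z₁ Φ) (x₁ Φ) (x₁ Φ)) (x₁ Φ) (x₁ Φ)}

/-- The ideal `(x² - 1, ((z,x,x),x,x))` of the unital hull of `F[z;x]`. -/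
def idealOne : AlgIdeal Φ (Unitization Φ (FZx Φ Unit)) :=
  AlgIdeal.span Φ {Unitization.inr (x₁ Φ * x₁ Φ) - 1,
    Unitization.inr (associator (associator (z₁ Φ) (x₁ Φ) (x₁ Φ)) (x₁ Φ) (x₁ Φ))}

instance hull_isScalarTower {A : Type*} [NonUnitalNonAssocRing A] [Module Φ A]
    [IsScalarTower Φ A A] : IsScalarTower Φ (Unitization Φ A) (Unitization Φ A) where
  smul_assoc r a b := by
    ext
    · simp [mul_assoc]
    · simp [smul_add, mul_smul, smul_mul_assoc, smul_comm r]

instance hull_smulCommClass {A : Type*} [NonUnitalNonAssocRing A] [Module Φ A]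
    [SMulCommClass Φ A A] : SMulCommClass Φ (Unitization Φ A) (Unitization Φ A) where
  smul_comm r a b := by
    ext
    · simp [mul_left_comm]
    · simp [smul_add, mul_smul, mul_smul_comm, smul_comm r]

/-- `F_t = F[z;x] / ((x²,x,x), ((z,x,x),x,x))`. -/
abbrev FT : Type _ := (idealT Φ).Quotient

/-- `F_0 = F[z;x] / (x², ((z,x,x),x,x))`. -/
abbrev FZero : Type _ := (idealZero Φ).Quotient

/-- `F_1 = F[z;x]^♯ / (x² - 1, ((z,x,x),x,x))`. -/
abbrev FOne : Type _ := (idealOne Φ).Quotient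

namespace FT
/-- The image of `z` in `F_t`. -/
def z : FT Φ := (idealT Φ).mkₗ (z₁ Φ)
/-- The image of `x` in `F_t`. -/
def x : FT Φ := (idealT Φ).mkₗ (x₁ Φ)
/-- The grading of `F_t`. -/
def grading : ZMod 2 → Submodule Φ (FT Φ) := (idealT Φ).grading (FZx.grading Φ Unit)
end FT

namespace FZero
/-- The image of `z` in `F_0`. -/
def z : FZero Φ := (idealZero Φ).mkₗ (z₁ Φ)
/-- The image of `x` in `F_0`. -/
def x : FZero Φ := (idealZero Φ).mkₗ (x₁ Φ)
/-- The grading of `F_0`. -/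
def grading : ZMod 2 → Submodule Φ (FZero Φ) := (idealZero Φ).grading (FZx.grading Φ Unit)
end FZero

namespace FOne
/-- The image of `1` in `F_1`. -/
def one : FOne Φ := (idealOne Φ).mkₗ 1
/-- The image of `z` in `F_1`. -/
def z : FOne Φ := (idealOne Φ).mkₗ (Unitization.inr (z₁ Φ))
/-- The image of `x` in `F_1`. -/
def x : FOne Φ := (idealOne Φ).mkₗ (Unitization.inr (x₁ Φ))
/-- The grading of `F_1`. -/
def grading : ZMod 2 → Submodule Φ (FOne Φ) :=
  (idealOne Φ).grading (hullGrading Φ (FZx.grading Φ Unit))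
end FOne

end Central

/-! ## Twisted superalgebras of even vector type -/

section VectorType

variable {Φ : Type*} [Field Φ] {Γ : Type*} [CommRing Γ] [Algebra Φ Γ]

/-- The twisted superalgebra of vector type `B(Γ,D,γ) = Γ ⊕ Γ̄` of a commutative algebra `Γ`
(all of `Γ` is even); the pair `(a, b)` stands for `a + b̄`. -/
def VectorType (_D : Derivation Φ Γ Γ) (_γ : Γ) : Type _ := Γ × Γ

namespace VectorType

variable (D : Derivation Φ Γ Γ) (γ : Γ)

instance : AddCommGroup (VectorType D γ) := inferInstanceAs (AddCommGroup (Γ × Γ))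

instance : Module Φ (VectorType D γ) := inferInstanceAs (Module Φ (Γ × Γ))

/-- The element `a` of the even part. -/
def ev (a : Γ) : VectorType D γ := (a, 0)

/-- The element `ā` of the odd part. -/
def bar (a : Γ) : VectorType D γ := (0, a)

/-- The linear projection to the even part. -/
def fstₗ : VectorType D γ →ₗ[Φ] Γ := LinearMap.fst Φ Γ Γ

/-- The linear projection to the odd part. -/
def sndₗ : VectorType D γ →ₗ[Φ] Γ := LinearMap.snd Φ Γ Γ

/-- `a × b = ab`, `a × b̄ = ā × b = \overline{ab}`, `ā × b̄ = γab + 2D(a)b + aD(b)`. -/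
instance : Mul (VectorType D γ) where
  mul p q := (p.1 * q.1 + (γ * (p.2 * q.2) + 2 * D p.2 * q.2 + p.2 * D q.2),
    p.1 * q.2 + p.2 * q.1)

@[simp] theorem fst_ev (a : Γ) : fstₗ D γ (ev D γ a) = a := rfl

@[simp] theorem snd_ev (a : Γ) : sndₗ D γ (ev D γ a) = 0 := rfl

@[simp] theorem fst_bar (a : Γ) : fstₗ D γ (bar D γ a) = 0 := rfl

@[simp] theorem snd_bar (a : Γ) : sndₗ D γ (bar D γ a) = a := rfl

variable {D γ}

@[ext]
theorem ext {p q : VectorType D γ} (h₁ : fstₗ D γ p = fstₗ D γ q) (h₂ : sndₗ D γ p = sndₗ D γ q) :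
    p = q := Prod.ext h₁ h₂

theorem fst_mul (p q : VectorType D γ) : fstₗ D γ (p * q) =
    fstₗ D γ p * fstₗ D γ q + (γ * (sndₗ D γ p * sndₗ D γ q)
      + 2 * D (sndₗ D γ p) * sndₗ D γ q + sndₗ D γ p * D (sndₗ D γ q)) := rfl

theorem snd_mul (p q : VectorType D γ) : sndₗ D γ (p * q) =
    fstₗ D γ p * sndₗ D γ q + sndₗ D γ p * fstₗ D γ q := rfl

variable (D γ)

instance : NonUnitalNonAssocRing (VectorType D γ) where
  left_distrib a b c := by ext <;> simp only [fst_mul, snd_mul, map_add] <;> ring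
  right_distrib a b c := by ext <;> simp only [fst_mul, snd_mul, map_add] <;> ring
  zero_mul a := by ext <;> simp [fst_mul, snd_mul]
  mul_zero a := by ext <;> simp [fst_mul, snd_mul]

instance : IsScalarTower Φ (VectorType D γ) (VectorType D γ) where
  smul_assoc r a b := by
    ext <;> simp only [smul_eq_mul, fst_mul, snd_mul, map_smul, Derivation.map_smul] <;>
      simp only [Algebra.smul_def] <;> ring

instance : SMulCommClass Φ (VectorType D γ) (VectorType D γ) where
  smul_comm r a b := by
    ext <;> simp only [smul_eq_mul, fst_mul, snd_mul, map_smul, Derivation.map_smul] <;>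
      simp only [Algebra.smul_def] <;> ring

/-- The grading of `B(Γ,D,γ)`: the even part is `Γ`, the odd part is `Γ̄`. -/
def grading : ZMod 2 → Submodule Φ (VectorType D γ) :=
  fun i => if i = 0 then LinearMap.ker (sndₗ D γ) else LinearMap.ker (fstₗ D γ)

end VectorType

end VectorType

section BZero

variable {Φ : Type*} [Field Φ] {σ : Type*}

/-- The subsuperalgebra `B_0(Φ[T],D,γ) = Φ_0[T] ⊕ \overline{Φ[T]}` of `B(Φ[T],D,γ)`, where
`Φ_0[T]` is the algebra of polynomials without constant term; it requires that `γ` and the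
values of `D` have no constant term. -/
def BZero (D : Derivation Φ (MvPolynomial σ Φ) (MvPolynomial σ Φ)) (γ : MvPolynomial σ Φ)
    (hD : ∀ a, MvPolynomial.constantCoeff (D a) = 0) (hγ : MvPolynomial.constantCoeff γ = 0) :
    NonUnitalSubalgebra Φ (VectorType D γ) where
  carrier := {p | MvPolynomial.constantCoeff (VectorType.fstₗ D γ p) = 0}
  add_mem' {a b} ha hb := by
    simp only [Set.mem_ofPred_eq, map_add] at *
    rw [ha, hb, add_zero]
  zero_mem' := by simp
  mul_mem' {a b} ha hb := by
    simp only [Set.mem_ofPred_eq, VectorType.fst_mul, map_add, map_mul] at *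
    simp [ha, hD, hγ]
  smul_mem' r a ha := by
    simp only [Set.mem_ofPred_eq, map_smul] at *
    rw [MvPolynomial.smul_eq_C_mul, map_mul, ha, mul_zero]

/-- The grading of `B_0(Φ[T],D,γ)`. -/
def BZero.grading (D : Derivation Φ (MvPolynomial σ Φ) (MvPolynomial σ Φ)) (γ : MvPolynomial σ Φ)
    (hD : ∀ a, MvPolynomial.constantCoeff (D a) = 0) (hγ : MvPolynomial.constantCoeff γ = 0) :
    ZMod 2 → Submodule Φ (BZero D γ hD hγ) :=
  fun i => (VectorType.grading D γ i).comap (BZero D γ hD hγ).toSubmodule.subtype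

end BZero

section Polynomials

open MvPolynomial

variable (Φ : Type*) [Field Φ]

/-- The index set of the variables `T_Z`: `inl i` is `t_i`, and `inr (z, i)` is `z_i`. -/
abbrev TZ (Z : Type*) : Type _ := ℕ ⊕ Z × ℕ

/-- The derivation of `Φ[T_Z]` with `D(t_i) = t_{i+1}` and `D(z_i) = z_{i+1}`. -/
def shiftD (Z : Type*) : Derivation Φ (MvPolynomial (TZ Z) Φ) (MvPolynomial (TZ Z) Φ) :=
  mkDerivation Φ (Sum.elim (fun i => X (Sum.inl (i + 1))) (fun p => X (Sum.inr (p.1, p.2 + 1))))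

theorem constantCoeff_shiftD (Z : Type*) (a : MvPolynomial (TZ Z) Φ) :
    constantCoeff (shiftD Φ Z a) = 0 := by
  induction a using MvPolynomial.induction_on with
  | C r => simp [shiftD]
  | add p q hp hq => rw [map_add, map_add, hp, hq, add_zero]
  | mul_X p i hp =>
    rw [Derivation.leibniz, smul_eq_mul, smul_eq_mul, map_add, map_mul, map_mul, hp, mul_zero,
      add_zero]
    rcases i with i | i <;> simp [shiftD, mkDerivation_X]

/-- `s d/dz` on `Φ[t,z,s]`, where `t, z, s` are the variables number `0, 1, 2`. -/
def sddz₃ : Derivation Φ (MvPolynomial (Fin 3) Φ) (MvPolynomial (Fin 3) Φ) :=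
  (X 2 : MvPolynomial (Fin 3) Φ) • pderiv 1

/-- `s d/dz` on `Φ[z,s]`, where `z, s` are the variables number `0, 1`. -/
def sddz₂ : Derivation Φ (MvPolynomial (Fin 2) Φ) (MvPolynomial (Fin 2) Φ) :=
  (X 1 : MvPolynomial (Fin 2) Φ) • pderiv 0

theorem constantCoeff_sddz₃ (a : MvPolynomial (Fin 3) Φ) : constantCoeff (sddz₃ Φ a) = 0 := by
  simp [sddz₃]

theorem constantCoeff_sddz₂ (a : MvPolynomial (Fin 2) Φ) : constantCoeff (sddz₂ Φ a) = 0 := by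
  simp [sddz₂]

end Polynomials

/-! ## Isomorphisms of superalgebras and bases -/

section Bases

/-- An isomorphism of superalgebras: a bijective homomorphism that respects the gradings. -/
def IsSuperIso {Φ A B : Type*} [Field Φ] [NonUnitalNonAssocRing A] [Module Φ A]
    [NonUnitalNonAssocRing B] [Module Φ B] (𝒜 : ZMod 2 → Submodule Φ A)
    (ℬ : ZMod 2 → Submodule Φ B) (f : A →ₙₐ[Φ] B) : Prop :=
  Function.Bijective f ∧ ∀ i a, a ∈ 𝒜 i ↔ f a ∈ ℬ i

/-- The operator `R_{a,b} = R_a R_b - R_{ab}`, acting on the right: `u ↦ (ua)b - u(ab)`. -/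
def opR {A : Type*} [NonUnitalNonAssocRing A] (a b : A) : A → A :=
  fun u => (u * a) * b - u * (a * b)

/-- `IsMonomial v m a` says that `a` is a product of the elements `v i`, in some order and with
some arrangement of brackets, in which `v i` occurs `m i` times. -/
inductive IsMonomial {ι A : Type*} [Mul A] (v : ι → A) : (ι →₀ ℕ) → A → Prop
  | var (i : ι) : IsMonomial v (Finsupp.single i 1) (v i)
  | mul {m n : ι →₀ ℕ} {a b : A} : IsMonomial v m a → IsMonomial v n b →
      IsMonomial v (m + n) (a * b)

/-- `IsNormalWord v x (m, ε) a` says that `a = u x^ε` with `u` a monomial of exponent `m` in the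
elements `v i`; for `m = 0`, `ε = 1` the word is `x`. (There is no word for `m = 0`, `ε = 0`.) -/
inductive IsNormalWord {ι A : Type*} [Mul A] (v : ι → A) (x : A) : (ι →₀ ℕ) × Fin 2 → A → Prop
  | even {m : ι →₀ ℕ} {a : A} : IsMonomial v m a → IsNormalWord v x (m, 0) a
  | gen : IsNormalWord v x (0, 1) x
  | odd {m : ι →₀ ℕ} {a : A} : IsMonomial v m a → IsNormalWord v x (m, 1) (a * x)

/-- The elements `u x^ε`, where `ε ∈ {0,1}` and `u` runs over the commutative and associative
monomials in the `v i`, `u x^ε ≠ 1`, form a basis: all monomials in the `v i` with the same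
exponents are equal, whatever the order of the factors and the brackets, and the resulting family,
indexed by the pairs `(m, ε) ≠ (0, 0)`, is a basis. -/
def HasNormalBasis (Φ : Type*) {ι A : Type*} [Field Φ] [NonUnitalNonAssocRing A] [Module Φ A]
    (v : ι → A) (x : A) : Prop :=
  ∃ b : Module.Basis {p : (ι →₀ ℕ) × Fin 2 // p ≠ 0} Φ A,
    ∀ p a, IsNormalWord v x p.1 a ↔ b p = a

/-- The same with the unit element, indexed by `(0, 0)`, included in the basis. -/
def HasUnitalNormalBasis (Φ : Type*) {ι A : Type*} [Field Φ] [NonUnitalNonAssocRing A]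
    [Module Φ A] (one : A) (v : ι → A) (x : A) : Prop :=
  ∃ b : Module.Basis ((ι →₀ ℕ) × Fin 2) Φ A,
    b 0 = one ∧ ∀ p, p ≠ 0 → ∀ a, IsNormalWord v x p a ↔ b p = a

end Bases

/-! ## The Grassmann `(-1,1)`-algebra -/

section GrassmannMinusOneOne

variable (Φ : Type*) [Field Φ]

/-- The free `(-1,1)`-superalgebra `F_{(-1,1)}[∅;x]` on one odd generator. -/
abbrev Fx : Type _ := FreeSuper (varietyMinusOneOne Φ) Empty Unit

/-- The generator of `F_{(-1,1)}[∅;x]`. -/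
def Fx.x : Fx Φ := FreeSuper.odd (varietyMinusOneOne Φ) Empty ()

/-- The Grassmann `(-1,1)`-algebra: the subalgebra of the Grassmann envelope of
`F_{(-1,1)}[∅;x]` generated by the elements `x ⊗ e_i`. -/
def grassmannMinusOneOne : NonUnitalSubalgebra Φ (Fx Φ ⊗[Φ] Grassmann Φ) :=
  NonUnitalAlgebra.adjoin Φ (Set.range fun i => Fx.x Φ ⊗ₜ[Φ] gen Φ i)

/-- The degree in `x` of `(x²)^I x^ε`, where `x² R_{x,x}^k` has degree `2k + 2`. -/
def wordDegree (p : (ℕ →₀ ℕ) × Fin 2) : ℕ :=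
  (p.1.sum fun k n => n * (2 * k + 2)) + (p.2 : ℕ)

end GrassmannMinusOneOne

end MinusOneOne

end

open MinusOneOne

noncomputable section

namespace MinusOneOne

/-! ## The Grassmann algebra -/

section Grassmann

variable (Φ : Type*) [Field Φ]

/-! Everything is compared with the superalgebras `B(Γ,D,γ)`. There the superidentities can be
checked directly, `1̄ × 1̄ = γ`, and `R_{1̄,1̄}` acts on `Γ` as `2D`. A homomorphism with `x ↦ 1̄`
and `z ↦ z_0` therefore sends `x²R_{x,x}^i` to `2^i t_i` and `zR_{x,x}^j` to `2^j z_j`. Normal words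
go to nonzero multiples of distinct monomials, even or barred, so they are linearly independent
(`map_isNormalWord`, `linearIndependent_wordImage`).

Spanning rests on the space of even elements that commute with everything (`evenCenter`). Right
alternativity and characteristic different from 2 and 3 kill every associator with two factors in
this space, so it is a commutative associative algebra. The identity `[[a,b],c] = 0` puts `x²` into
it and makes it stable under `R_{x,x}`, which acts on it as a derivation (`opR_mul`). If `M` is the
span of the monomials in `x²R_{x,x}^i` and `zR_{x,x}^j`, then `M` is stable under `R_{x,x}` and `M +
Mx + Φx` is closed under multiplication (`normalSpanning_genFamily`). A spanning family with
independent image is a basis, and the homomorphism is injective. This gives `F[Z;x]`, and `F_t`,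
`F_0`, `F_1` once the killed generators are discarded.

For the free `(-1,1)`-superalgebra on one odd generator, `[[a,b],c] = 0` is not an axiom and must be
derived. Let `F` be the free nonassociative algebra on `x`, `I` its ideal of identities and `K ⊇ I`
the kernel of the evaluation `x ↦ 1̄`. Modulo `I + KF + FK` the algebra is an extension of
`B_0(Φ[t_0,t_1,…],D,t_0)` by an ideal that annihilates everything. Products in it are bilinear
functions of the images, and the superidentities become linear relations among four bilinear maps
(`ExtensionProducts`). These relations force even elements to commute with everything
(`ExtensionProducts.odd_comm`, `ExtensionProducts.even_comm`). The strong identity follows, the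
normal basis argument applies, and `K = I + KF + FK`. As `I` is graded by degree and words have
positive degree, induction on the degree gives `K = I` (`ker_le_varietyIdeal`). Tensoring the
homogeneous normal basis with the products `e_S` of matching degree gives the basis of the Grassmann
algebra of the variety. -/

/-- The products `e_{j_1} ⋯ e_{j_n}` form a basis of the Grassmann algebra. -/
def grassmannBasis : Module.Basis (Finset ℕ) Φ (Grassmann Φ) :=
  (Finsupp.basisSingleOne (R := Φ) (ι := ℕ)).ExteriorAlgebra

theorem grassmannBasis_apply (S : Finset ℕ) : grassmannBasis Φ S = genProd Φ S := by
  rw [grassmannBasis, ExteriorAlgebra.basis_apply_ofCard _ (rfl : S.card = S.card),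
    ExteriorAlgebra.ιMulti_family, ExteriorAlgebra.ιMulti_apply, genProd]
  congr 1
  refine List.ext_getElem (by simp) fun i h₁ h₂ => ?_
  simp [gen, Set.powersetCard.ofFinEmbEquiv_symm_apply, Finset.orderEmbOfFin_apply]

theorem genProd_mul_of_not_disjoint {S T : Finset ℕ} (h : ¬Disjoint S T) :
    genProd Φ S * genProd Φ T = 0 := by
  rw [← grassmannBasis_apply, ← grassmannBasis_apply]
  exact ExteriorAlgebra.basis_mul_of_not_disjoint _ (Set.powersetCard.ofCard (s := S) rfl)
    (Set.powersetCard.ofCard (s := T) rfl) h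

theorem genProd_mul_of_disjoint {S T : Finset ℕ} (h : Disjoint S T) :
    ∃ u : ℤˣ, genProd Φ S * genProd Φ T = u • genProd Φ (S ∪ T) := by
  have := ExteriorAlgebra.basis_mul_of_disjoint (Finsupp.basisSingleOne (R := Φ) (ι := ℕ))
    (Set.powersetCard.ofCard (s := S) rfl) (Set.powersetCard.ofCard (s := T) rfl) h
  rw [← grassmannBasis_apply, ← grassmannBasis_apply, ← grassmannBasis_apply,
    ← Finset.disjUnion_eq_union S T h]
  exact ⟨_, this⟩

theorem genProd_toFinset {l : List ℕ} (hl : l.SortedLT) :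
    genProd Φ l.toFinset = (l.map (gen Φ)).prod := by
  rw [genProd, (List.toFinset_sort (r := (· ≤ ·)) hl.nodup).2 hl.sortedLE.pairwise]

theorem genProd_ne_zero (S : Finset ℕ) : genProd Φ S ≠ 0 := by
  rw [← grassmannBasis_apply]
  exact (grassmannBasis Φ).ne_zero S

variable {Φ}

/-- The sign in the rule of signs. -/
def sgn (Φ : Type*) [Field Φ] (i j : ZMod 2) : Φ := if i = 1 ∧ j = 1 then -1 else 1

@[simp] theorem sgn_zero_left (j : ZMod 2) : sgn Φ 0 j = 1 := by simp [sgn]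

@[simp] theorem sgn_zero_right (j : ZMod 2) : sgn Φ j 0 = 1 := by simp [sgn]

@[simp] theorem sgn_one_one : sgn Φ 1 1 = -1 := by simp [sgn]

theorem zmod_two_cases (i : ZMod 2) : i = 0 ∨ i = 1 := by
  revert i; decide

theorem one_add_one_zmod_two : (1 : ZMod 2) + 1 = 0 := by decide

theorem sgn_comm (i j : ZMod 2) : sgn Φ i j = sgn Φ j i := by
  rcases zmod_two_cases i with rfl | rfl <;> rcases zmod_two_cases j with rfl | rfl <;> simp

/-- The quadratic form is zero, so all vectors are orthogonal and the sign rule for orthogonal parts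
of a Clifford algebra applies with both isometries the identity. -/
theorem grassmann_mul_comm {i j : ZMod 2} {g h : Grassmann Φ} (hg : g ∈ grassmannGrading Φ i)
    (hh : h ∈ grassmannGrading Φ j) : h * g = sgn Φ i j • (g * h) := by
  have H := CliffordAlgebra.map_mul_map_of_isOrtho_of_mem_evenOdd
    (QuadraticMap.Isometry.id (0 : QuadraticForm Φ (ℕ →₀ Φ)))
    (QuadraticMap.Isometry.id (0 : QuadraticForm Φ (ℕ →₀ Φ)))
    (fun x y => by simp [QuadraticMap.isOrtho_def]) h g hh hg
  rw [CliffordAlgebra.map_id] at H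
  simp only [AlgHom.id_apply] at H
  rw [H]
  rcases zmod_two_cases i with rfl | rfl <;> rcases zmod_two_cases j with rfl | rfl <;> simp

theorem grassmann_mul_mem {i j : ZMod 2} {g h : Grassmann Φ} (hg : g ∈ grassmannGrading Φ i)
    (hh : h ∈ grassmannGrading Φ j) : g * h ∈ grassmannGrading Φ (i + j) :=
  (CliffordAlgebra.evenOdd.gradedMonoid (0 : QuadraticForm Φ (ℕ →₀ Φ))).mul_mem hg hh

/-- The element `1` for `i = 0` and `e_n` for `i = 1`. -/
def homGen (Φ : Type*) [Field Φ] (i : ZMod 2) (n : ℕ) : Grassmann Φ :=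
  if i = 0 then 1 else gen Φ n

theorem homGen_mem (i : ZMod 2) (n : ℕ) : homGen Φ i n ∈ grassmannGrading Φ i := by
  rcases zmod_two_cases i with rfl | rfl
  · rw [homGen, if_pos rfl]
    exact (CliffordAlgebra.evenOdd.gradedMonoid (0 : QuadraticForm Φ (ℕ →₀ Φ))).one_mem
  · rw [homGen, if_neg one_ne_zero]
    exact CliffordAlgebra.ι_mem_evenOdd_one _ _

/-- Distinct indices make the product a basis element of the Grassmann algebra. This nonzero factor
can later be cancelled, which brings an identity of the envelope back to the superalgebra. -/
theorem homGen_mul_ne_zero (i j k : ZMod 2) : homGen Φ i 0 * homGen Φ j 1 * homGen Φ k 2 ≠ 0 := by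
  have key : homGen Φ i 0 * homGen Φ j 1 * homGen Φ k 2 =
      genProd Φ ((if i = 0 then [] else [0]) ++ (if j = 0 then [] else [1]) ++
        (if k = 0 then [] else [2]) : List ℕ).toFinset := by
    rw [genProd_toFinset]
    · rcases zmod_two_cases i with rfl | rfl <;> rcases zmod_two_cases j with rfl | rfl <;>
        rcases zmod_two_cases k with rfl | rfl <;> simp [homGen, mul_assoc]
    · rcases zmod_two_cases i with rfl | rfl <;> rcases zmod_two_cases j with rfl | rfl <;>
        rcases zmod_two_cases k with rfl | rfl <;> simp [List.sortedLT_iff_pairwise]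
  rw [key]
  exact genProd_ne_zero _ _

/-- Contraction of the second factor with any functional gives a multiple of `a`; if `a ≠ 0`, all
functionals vanish on `g`. -/
theorem eq_zero_of_tmul_eq_zero {M N : Type*} [AddCommGroup M] [Module Φ M] [AddCommGroup N]
    [Module Φ N] {a : M} {g : N} (hg : g ≠ 0) (h : a ⊗ₜ[Φ] g = 0) : a = 0 := by
  by_contra ha
  apply hg
  rw [← Module.forall_dual_apply_eq_zero_iff Φ g]
  intro φ
  have h' := congrArg (TensorProduct.rid Φ M ∘ φ.lTensor M) h
  simp only [Function.comp_apply, LinearMap.lTensor_tmul, TensorProduct.rid_tmul, map_zero] at h'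
  exact (smul_eq_zero.1 h').resolve_right ha

end Grassmann

/-! ## Superidentities -/

section SuperIdentities

variable {Φ : Type*} [Field Φ] {A : Type*} [NonUnitalNonAssocRing A] [Module Φ A]

/-- The supercommutator of elements of parities `i` and `j`. -/
def superComm (Φ : Type*) [Field Φ] {A : Type*} [NonUnitalNonAssocRing A] [Module Φ A]
    (i j : ZMod 2) (a b : A) : A := a * b - sgn Φ i j • (b * a)

/-- The superidentities of `(-1,1)`-superalgebras, for homogeneous elements. -/
structure SuperMinusOneOne (𝒜 : ZMod 2 → Submodule Φ A) : Prop where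
  right_alt : ∀ {i j k : ZMod 2} {a b c : A}, a ∈ 𝒜 i → b ∈ 𝒜 j → c ∈ 𝒜 k →
    associator a b c + sgn Φ j k • associator a c b = 0
  cyclic : ∀ {i j k : ZMod 2} {a b c : A}, a ∈ 𝒜 i → b ∈ 𝒜 j → c ∈ 𝒜 k →
    associator a b c + sgn Φ i (j + k) • associator b c a
      + sgn Φ k (i + j) • associator c a b = 0

/-- The superidentity `[[a,b],c] = 0`, for homogeneous elements. -/
def SuperCommCentral (𝒜 : ZMod 2 → Submodule Φ A) : Prop :=
  ∀ {i j k : ZMod 2} {a b c : A}, a ∈ 𝒜 i → b ∈ 𝒜 j → c ∈ 𝒜 k →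
    superComm Φ (i + j) k (superComm Φ i j a b) c = 0

variable [IsScalarTower Φ A A] [SMulCommClass Φ A A]

theorem associator_tmul (a b c : A) (f g h : Grassmann Φ) :
    associator (a ⊗ₜ[Φ] f) (b ⊗ₜ[Φ] g) (c ⊗ₜ[Φ] h) = associator a b c ⊗ₜ[Φ] (f * g * h) := by
  simp only [associator, Algebra.TensorProduct.tmul_mul_tmul, TensorProduct.sub_tmul, mul_assoc]

omit [IsScalarTower Φ A A] [SMulCommClass Φ A A] in
theorem tmul_mem_grassmannEnvelope {𝒜 : ZMod 2 → Submodule Φ A} {i : ZMod 2} {a : A}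
    (ha : a ∈ 𝒜 i) {g : Grassmann Φ} (hg : g ∈ grassmannGrading Φ i) :
    a ⊗ₜ[Φ] g ∈ grassmannEnvelope 𝒜 :=
  Submodule.subset_span ⟨i, a, g, ha, hg, rfl⟩

omit [IsScalarTower Φ A A] [SMulCommClass Φ A A] in
/-- Trilinear induction on the Grassmann envelope. -/
theorem grassmannEnvelope_induction₃ {𝒜 : ZMod 2 → Submodule Φ A} {M : Type*} [AddCommGroup M]
    (F : A ⊗[Φ] Grassmann Φ →+ A ⊗[Φ] Grassmann Φ →+ A ⊗[Φ] Grassmann Φ →+ M)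
    (h : ∀ {i j k : ZMod 2} {a b c : A} {f g h : Grassmann Φ}, a ∈ 𝒜 i → b ∈ 𝒜 j → c ∈ 𝒜 k →
      f ∈ grassmannGrading Φ i → g ∈ grassmannGrading Φ j → h ∈ grassmannGrading Φ k →
      F (a ⊗ₜ f) (b ⊗ₜ g) (c ⊗ₜ h) = 0)
    {u v w : A ⊗[Φ] Grassmann Φ} (hu : u ∈ grassmannEnvelope 𝒜) (hv : v ∈ grassmannEnvelope 𝒜)
    (hw : w ∈ grassmannEnvelope 𝒜) : F u v w = 0 := by
  -- `F` is only additive, so the linear span is replaced by an additive closure; scalars are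
  -- absorbed into the factor `a`.
  have span_eq : ∀ x ∈ grassmannEnvelope 𝒜, x ∈ AddSubgroup.closure
      {w | ∃ (i : ZMod 2) (a : A) (g : Grassmann Φ),
        a ∈ 𝒜 i ∧ g ∈ grassmannGrading Φ i ∧ w = a ⊗ₜ[Φ] g} := by
    intro x hx
    induction hx using Submodule.span_induction with
    | mem x hx => exact AddSubgroup.subset_closure hx
    | zero => exact zero_mem _
    | add x y _ _ hx hy => exact add_mem hx hy
    | smul r x hx' hx =>
      clear hx'
      induction hx using AddSubgroup.closure_induction with
      | mem x hx =>
        obtain ⟨i, a, g, ha, hg, rfl⟩ := hx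
        exact AddSubgroup.subset_closure ⟨i, r • a, g, (𝒜 i).smul_mem r ha, hg, rfl⟩
      | zero => rw [smul_zero]; exact zero_mem _
      | add x y _ _ hx hy => rw [smul_add]; exact add_mem hx hy
      | neg x _ hx => rw [smul_neg]; exact neg_mem hx
  replace hu := span_eq u hu
  replace hv := span_eq v hv
  replace hw := span_eq w hw
  induction hu using AddSubgroup.closure_induction with
  | mem u hu =>
    obtain ⟨i, a, f, ha, hf, rfl⟩ := hu
    induction hv using AddSubgroup.closure_induction with
    | mem v hv =>
      obtain ⟨j, b, g, hb, hg, rfl⟩ := hv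
      induction hw using AddSubgroup.closure_induction with
      | mem w hw =>
        obtain ⟨k, c, e, hc, he, rfl⟩ := hw
        exact h ha hb hc hf hg he
      | zero => simp
      | add x y _ _ hx hy => simp [hx, hy]
      | neg x _ hx => simp [hx]
    | zero => simp
    | add x y _ _ hx hy => simp [hx, hy]
    | neg x _ hx => simp [hx]
  | zero => simp
  | add x y _ _ hx hy => simp [hx, hy]
  | neg x _ hx => simp [hx]

theorem lift_associator (s : ℕ → A ⊗[Φ] Grassmann Φ) (f g h : FreeNonUnitalNonAssocAlgebra Φ ℕ) :
    FreeNonUnitalNonAssocAlgebra.lift Φ s (associator f g h) =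
      associator (FreeNonUnitalNonAssocAlgebra.lift Φ s f)
        (FreeNonUnitalNonAssocAlgebra.lift Φ s g) (FreeNonUnitalNonAssocAlgebra.lift Φ s h) := by
  simp only [associator, map_sub, map_mul]

/-- `(a,b,b) = 0` is quadratic and cannot be tested on spanning elements, but its linearization can.
The super sign is the one that reorders the Grassmann factors. -/
theorem right_alt_envelope {𝒜 : ZMod 2 → Submodule Φ A} (h𝒜 : SuperMinusOneOne 𝒜)
    {u v w : A ⊗[Φ] Grassmann Φ} (hu : u ∈ grassmannEnvelope 𝒜) (hv : v ∈ grassmannEnvelope 𝒜)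
    (hw : w ∈ grassmannEnvelope 𝒜) : associator u v w + associator u w v = 0 := by
  let α : A ⊗[Φ] Grassmann Φ →+ A ⊗[Φ] Grassmann Φ →+ A ⊗[Φ] Grassmann Φ →+
    A ⊗[Φ] Grassmann Φ := AddMonoidHom.associator
  refine grassmannEnvelope_induction₃ (𝒜 := 𝒜) (α + AddMonoidHom.flipHom.comp α) ?_ hu hv hw
  intro i j k a b c f g h ha hb hc hf hg hh
  change associator (a ⊗ₜ[Φ] f) (b ⊗ₜ[Φ] g) (c ⊗ₜ[Φ] h)
    + associator (a ⊗ₜ[Φ] f) (c ⊗ₜ[Φ] h) (b ⊗ₜ[Φ] g) = 0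
  rw [associator_tmul, associator_tmul, mul_assoc f h g, grassmann_mul_comm hg hh, mul_smul_comm,
    TensorProduct.tmul_smul, TensorProduct.smul_tmul', ← mul_assoc, ← TensorProduct.add_tmul,
    h𝒜.right_alt ha hb hc, TensorProduct.zero_tmul]

theorem isSuperalgebraOf_minusOneOne {𝒜 : ZMod 2 → Submodule Φ A} (h2 : (2 : Φ) ≠ 0)
    (h𝒜 : SuperMinusOneOne 𝒜) : IsSuperalgebraOf (varietyMinusOneOne Φ) 𝒜 := by
  rintro f (rfl | rfl) s hs
  · rw [lift_associator, FreeNonUnitalNonAssocAlgebra.lift_of_apply,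
      FreeNonUnitalNonAssocAlgebra.lift_of_apply]
    -- Equal last arguments give `2 (u,v,v) = 0`.
    have := right_alt_envelope h𝒜 (hs 0) (hs 1) (hs 1)
    rw [← two_smul Φ] at this
    exact (smul_eq_zero.1 this).resolve_left h2
  · simp only [map_add, lift_associator, FreeNonUnitalNonAssocAlgebra.lift_of_apply]
    let α : A ⊗[Φ] Grassmann Φ →+ A ⊗[Φ] Grassmann Φ →+ A ⊗[Φ] Grassmann Φ →+
      A ⊗[Φ] Grassmann Φ := AddMonoidHom.associator
    refine grassmannEnvelope_induction₃ (𝒜 := 𝒜)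
      (α + (AddMonoidHom.flipHom.comp α).flip + AddMonoidHom.flipHom.comp α.flip)
      ?_ (hs 0) (hs 1) (hs 2)
    intro i j k a b c f g h ha hb hc hf hg hh
    change associator (a ⊗ₜ[Φ] f) (b ⊗ₜ[Φ] g) (c ⊗ₜ[Φ] h)
      + associator (b ⊗ₜ[Φ] g) (c ⊗ₜ[Φ] h) (a ⊗ₜ[Φ] f)
      + associator (c ⊗ₜ[Φ] h) (a ⊗ₜ[Φ] f) (b ⊗ₜ[Φ] g) = 0
    rw [associator_tmul, associator_tmul, associator_tmul,
      grassmann_mul_comm hf (grassmann_mul_mem hg hh), mul_assoc h f g,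
      grassmann_mul_comm (grassmann_mul_mem hf hg) hh, ← mul_assoc, sgn_comm (i + j) k,
      TensorProduct.tmul_smul, TensorProduct.smul_tmul', TensorProduct.tmul_smul,
      TensorProduct.smul_tmul', ← TensorProduct.add_tmul, ← TensorProduct.add_tmul,
      h𝒜.cyclic ha hb hc, TensorProduct.zero_tmul]

theorem comm_tmul {i j : ZMod 2} (a b : A) {f g : Grassmann Φ} (hf : f ∈ grassmannGrading Φ i)
    (hg : g ∈ grassmannGrading Φ j) : a ⊗ₜ[Φ] f * b ⊗ₜ[Φ] g - b ⊗ₜ[Φ] g * a ⊗ₜ[Φ] f =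
      superComm Φ i j a b ⊗ₜ[Φ] (f * g) := by
  rw [Algebra.TensorProduct.tmul_mul_tmul, Algebra.TensorProduct.tmul_mul_tmul,
    grassmann_mul_comm hf hg, TensorProduct.tmul_smul, TensorProduct.smul_tmul',
    ← TensorProduct.sub_tmul, superComm]

theorem isSuperalgebraOf_strongly {𝒜 : ZMod 2 → Submodule Φ A} (h2 : (2 : Φ) ≠ 0)
    (h𝒜 : SuperMinusOneOne 𝒜) (h𝒜' : SuperCommCentral 𝒜) :
    IsSuperalgebraOf (varietyStrongly Φ) 𝒜 := by
  rintro f (rfl | hf) s hs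
  · simp only [map_sub, map_mul, FreeNonUnitalNonAssocAlgebra.lift_of_apply]
    let μ : A ⊗[Φ] Grassmann Φ →+ A ⊗[Φ] Grassmann Φ →+ A ⊗[Φ] Grassmann Φ := AddMonoidHom.mul
    let κ := μ - μ.flip
    let F : A ⊗[Φ] Grassmann Φ →+ A ⊗[Φ] Grassmann Φ →+ A ⊗[Φ] Grassmann Φ →+
      A ⊗[Φ] Grassmann Φ := (AddMonoidHom.compHom κ).comp κ
    change F (s 0) (s 1) (s 2) = 0
    refine grassmannEnvelope_induction₃ (𝒜 := 𝒜) F ?_ (hs 0) (hs 1) (hs 2)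
    intro i j k a b c f g h ha hb hc hf hg hh
    change (a ⊗ₜ[Φ] f * b ⊗ₜ[Φ] g - b ⊗ₜ[Φ] g * a ⊗ₜ[Φ] f) * c ⊗ₜ[Φ] h
      - c ⊗ₜ[Φ] h * (a ⊗ₜ[Φ] f * b ⊗ₜ[Φ] g - b ⊗ₜ[Φ] g * a ⊗ₜ[Φ] f) = 0
    rw [comm_tmul a b hf hg, comm_tmul _ c (grassmann_mul_mem hf hg) hh, h𝒜' ha hb hc,
      TensorProduct.zero_tmul]
  · exact isSuperalgebraOf_minusOneOne h2 h𝒜 f hf s hs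

omit [IsScalarTower Φ A A] [SMulCommClass Φ A A] in
theorem homGen_tmul_mem {𝒜 : ZMod 2 → Submodule Φ A} {i : ZMod 2} {a : A} (ha : a ∈ 𝒜 i)
    (n : ℕ) : a ⊗ₜ[Φ] homGen Φ i n ∈ grassmannEnvelope 𝒜 :=
  tmul_mem_grassmannEnvelope ha (homGen_mem i n)

/-- The identities are evaluated at `a ⊗ g₀`, `b ⊗ g₁`, `c ⊗ g₂`, where each `gₙ` is `1` or `e_n`
according to parity. After reordering, the common factor `g₀g₁g₂` is nonzero and cancels. -/
theorem superMinusOneOne_of_isSuperalgebraOf {𝒜 : ZMod 2 → Submodule Φ A}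
    (h : IsSuperalgebraOf (varietyMinusOneOne Φ) 𝒜) : SuperMinusOneOne 𝒜 where
  right_alt {i j k a b c} ha hb hc := by
    have H : ∀ u ∈ grassmannEnvelope 𝒜, ∀ v ∈ grassmannEnvelope 𝒜, associator u v v = 0 := by
      intro u hu v hv
      have := h _ (Or.inl rfl) (fun n => if n = 0 then u else v)
        (fun n => by split_ifs <;> assumption)
      simpa [lift_associator] using this
    have hu := homGen_tmul_mem ha 0
    have hv := homGen_tmul_mem hb 1
    have hw := homGen_tmul_mem hc 2
    have key : associator (a ⊗ₜ[Φ] homGen Φ i 0) (b ⊗ₜ[Φ] homGen Φ j 1) (c ⊗ₜ[Φ] homGen Φ k 2)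
        + associator (a ⊗ₜ[Φ] homGen Φ i 0) (c ⊗ₜ[Φ] homGen Φ k 2) (b ⊗ₜ[Φ] homGen Φ j 1) = 0 := by
      -- Polarization: `(u, v+w, v+w) = 0` is expanded.
      have h₁ := H _ hu _ (add_mem hv hw)
      have h₂ := H _ hu _ hv
      have h₃ := H _ hu _ hw
      rw [← AddMonoidHom.associator_apply] at h₁ h₂ h₃ ⊢
      rw [← AddMonoidHom.associator_apply]
      simp only [map_add, AddMonoidHom.add_apply, h₂, h₃] at h₁
      simpa [add_comm] using h₁
    rw [associator_tmul, associator_tmul, mul_assoc (homGen Φ i 0) (homGen Φ k 2),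
      grassmann_mul_comm (homGen_mem j 1) (homGen_mem k 2), mul_smul_comm,
      TensorProduct.tmul_smul, TensorProduct.smul_tmul', ← mul_assoc,
      ← TensorProduct.add_tmul] at key
    exact eq_zero_of_tmul_eq_zero (homGen_mul_ne_zero i j k) key
  cyclic {i j k a b c} ha hb hc := by
    have hu := homGen_tmul_mem ha 0
    have hv := homGen_tmul_mem hb 1
    have hw := homGen_tmul_mem hc 2
    have key := h _ (Or.inr rfl) (fun n => if n = 0 then a ⊗ₜ[Φ] homGen Φ i 0 else
      if n = 1 then b ⊗ₜ[Φ] homGen Φ j 1 else c ⊗ₜ[Φ] homGen Φ k 2)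
        (fun n => by split_ifs <;> assumption)
    simp only [map_add, lift_associator, FreeNonUnitalNonAssocAlgebra.lift_of_apply, if_true,
      one_ne_zero, OfNat.ofNat_ne_zero, OfNat.ofNat_ne_one, if_false] at key
    rw [associator_tmul, associator_tmul, associator_tmul,
      grassmann_mul_comm (homGen_mem i 0) (grassmann_mul_mem (homGen_mem j 1) (homGen_mem k 2)),
      mul_assoc (homGen Φ k 2) (homGen Φ i 0),
      grassmann_mul_comm (grassmann_mul_mem (homGen_mem i 0) (homGen_mem j 1)) (homGen_mem k 2),
      ← mul_assoc, sgn_comm (i + j) k,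
      TensorProduct.tmul_smul, TensorProduct.smul_tmul', TensorProduct.tmul_smul,
      TensorProduct.smul_tmul', ← TensorProduct.add_tmul, ← TensorProduct.add_tmul] at key
    exact eq_zero_of_tmul_eq_zero (homGen_mul_ne_zero i j k) key

theorem superCommCentral_of_strongly {𝒜 : ZMod 2 → Submodule Φ A}
    (h : IsSuperalgebraOf (varietyStrongly Φ) 𝒜) : SuperCommCentral 𝒜 := by
  intro i j k a b c ha hb hc
  have hu := homGen_tmul_mem ha 0
  have hv := homGen_tmul_mem hb 1
  have hw := homGen_tmul_mem hc 2
  have key := h _ (Or.inl rfl) (fun n => if n = 0 then a ⊗ₜ[Φ] homGen Φ i 0 else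
    if n = 1 then b ⊗ₜ[Φ] homGen Φ j 1 else c ⊗ₜ[Φ] homGen Φ k 2)
      (fun n => by split_ifs <;> assumption)
  simp only [map_sub, map_mul, FreeNonUnitalNonAssocAlgebra.lift_of_apply, if_true,
    one_ne_zero, OfNat.ofNat_ne_zero, OfNat.ofNat_ne_one, if_false] at key
  rw [comm_tmul a b (homGen_mem i 0) (homGen_mem j 1),
    comm_tmul _ c (grassmann_mul_mem (homGen_mem i 0) (homGen_mem j 1)) (homGen_mem k 2)] at key
  exact eq_zero_of_tmul_eq_zero (homGen_mul_ne_zero i j k) key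

end SuperIdentities

/-! ## Ideals, quotients and gradings -/

section Quotients

variable {Φ : Type*} [Field Φ] {A : Type*} [NonUnitalNonAssocRing A] [Module Φ A]
  {B : Type*} [NonUnitalNonAssocRing B] [Module Φ B]

namespace AlgIdeal

theorem mem_sInf {S : Set (AlgIdeal Φ A)} {a : A} :
    a ∈ (sInf S).toSubmodule ↔ ∀ J ∈ S, a ∈ J.toSubmodule := by
  simp [sInf]

theorem subset_span {s : Set A} {a : A} (ha : a ∈ s) : a ∈ (span Φ s).toSubmodule :=
  mem_sInf.2 fun _ hJ => hJ a ha

theorem span_le {s : Set A} {J : AlgIdeal Φ A} (h : ∀ a ∈ s, a ∈ J.toSubmodule) :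
    (span Φ s).toSubmodule ≤ J.toSubmodule :=
  fun _ ha => mem_sInf.1 ha J h

variable (I : AlgIdeal Φ A)

theorem mkₗ_eq_zero_iff {a : A} : I.mkₗ a = 0 ↔ a ∈ I.toSubmodule := by
  rw [← map_zero I.mkₗ, mkₗ_eq_iff, sub_zero]

/-- The canonical projection, as a homomorphism of algebras. -/
def mkHom : A →ₙₐ[Φ] I.Quotient :=
  { I.mkₗ with
    map_mul' := I.mkₗ_mul
    map_zero' := map_zero I.mkₗ }

theorem mkₗ_associator (a b c : A) :
    I.mkₗ (associator a b c) = associator (I.mkₗ a) (I.mkₗ b) (I.mkₗ c) := by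
  simp only [associator, map_sub, mkₗ_mul]

/-- The kernel of a homomorphism. -/
def ker (f : A →ₙₐ[Φ] B) : AlgIdeal Φ A where
  toSubmodule := LinearMap.ker (f : A →ₗ[Φ] B)
  mul_left_mem a x hx := by
    have hx' : f x = 0 := hx
    change f (a * x) = 0
    rw [map_mul, hx', mul_zero]
  mul_right_mem a x hx := by
    have hx' : f x = 0 := hx
    change f (x * a) = 0
    rw [map_mul, hx', zero_mul]

theorem mem_ker {f : A →ₙₐ[Φ] B} {a : A} : a ∈ (ker f).toSubmodule ↔ f a = 0 := Iff.rfl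

/-- The homomorphism induced on a quotient. -/
def lift (f : A →ₙₐ[Φ] B) (h : ∀ a ∈ I.toSubmodule, f a = 0) : I.Quotient →ₙₐ[Φ] B :=
  { I.toSubmodule.liftQ (f : A →ₗ[Φ] B) h with
    map_mul' := fun a b => by
      obtain ⟨a, rfl⟩ := I.mkₗ_surjective a
      obtain ⟨b, rfl⟩ := I.mkₗ_surjective b
      exact map_mul f a b
    map_zero' := map_zero (I.toSubmodule.liftQ (f : A →ₗ[Φ] B) h) }

end AlgIdeal

/-- The even and the odd part span the algebra and multiply by the rule of parities. -/
structure SuperGraded (𝒜 : ZMod 2 → Submodule Φ A) : Prop where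
  mul_mem : ∀ {i j : ZMod 2} {a b : A}, a ∈ 𝒜 i → b ∈ 𝒜 j → a * b ∈ 𝒜 (i + j)
  sup_eq_top : 𝒜 0 ⊔ 𝒜 1 = ⊤

variable {𝒜 : ZMod 2 → Submodule Φ A}

theorem SuperGraded.exists_eq_add (h : SuperGraded 𝒜) (a : A) :
    ∃ a₀ ∈ 𝒜 0, ∃ a₁ ∈ 𝒜 1, a = a₀ + a₁ := by
  have ha : a ∈ 𝒜 0 ⊔ 𝒜 1 := h.sup_eq_top ▸ Submodule.mem_top
  obtain ⟨a₀, h₀, a₁, h₁, rfl⟩ := Submodule.mem_sup.1 ha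
  exact ⟨a₀, h₀, a₁, h₁, rfl⟩

theorem SuperGraded.quotient (h : SuperGraded 𝒜) (I : AlgIdeal Φ A) :
    SuperGraded (I.grading 𝒜) where
  mul_mem := by
    rintro i j _ _ ⟨a, ha, rfl⟩ ⟨b, hb, rfl⟩
    exact ⟨a * b, h.mul_mem ha hb, I.mkₗ_mul a b⟩
  sup_eq_top := by
    rw [AlgIdeal.grading, AlgIdeal.grading, ← Submodule.map_sup, h.sup_eq_top, Submodule.map_top,
      LinearMap.range_eq_top.2 I.mkₗ_surjective]

theorem mkₗ_right_alt (I : AlgIdeal Φ A) (r : Φ) (a b c : A) :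
    I.mkₗ (associator a b c + r • associator a c b) =
      associator (I.mkₗ a) (I.mkₗ b) (I.mkₗ c)
        + r • associator (I.mkₗ a) (I.mkₗ c) (I.mkₗ b) := by
  rw [map_add, map_smul, I.mkₗ_associator, I.mkₗ_associator]

theorem mkₗ_cyclic (I : AlgIdeal Φ A) (r s : Φ) (a b c : A) :
    I.mkₗ (associator a b c + r • associator b c a + s • associator c a b) =
      associator (I.mkₗ a) (I.mkₗ b) (I.mkₗ c)
        + r • associator (I.mkₗ b) (I.mkₗ c) (I.mkₗ a)
        + s • associator (I.mkₗ c) (I.mkₗ a) (I.mkₗ b) := by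
  rw [map_add, map_add, map_smul, map_smul, I.mkₗ_associator, I.mkₗ_associator, I.mkₗ_associator]

theorem mkₗ_superComm (I : AlgIdeal Φ A) (i j : ZMod 2) (a b : A) :
    I.mkₗ (superComm Φ i j a b) = superComm Φ i j (I.mkₗ a) (I.mkₗ b) := by
  rw [superComm, superComm, map_sub, map_smul, I.mkₗ_mul, I.mkₗ_mul]

/-- Membership in the ideal is the convenient form of the superidentities: it passes to
intersections and to larger ideals. -/
theorem superMinusOneOne_quotient_iff (I : AlgIdeal Φ A) :
    SuperMinusOneOne (I.grading 𝒜) ↔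
      (∀ {i j k : ZMod 2} {a b c : A}, a ∈ 𝒜 i → b ∈ 𝒜 j → c ∈ 𝒜 k →
        associator a b c + sgn Φ j k • associator a c b ∈ I.toSubmodule) ∧
      (∀ {i j k : ZMod 2} {a b c : A}, a ∈ 𝒜 i → b ∈ 𝒜 j → c ∈ 𝒜 k →
        associator a b c + sgn Φ i (j + k) • associator b c a
          + sgn Φ k (i + j) • associator c a b ∈ I.toSubmodule) := by
  refine ⟨fun h => ⟨fun ha hb hc => ?_, fun ha hb hc => ?_⟩, fun h => ⟨?_, ?_⟩⟩
  · rw [← I.mkₗ_eq_zero_iff, mkₗ_right_alt]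
    exact h.right_alt ⟨_, ha, rfl⟩ ⟨_, hb, rfl⟩ ⟨_, hc, rfl⟩
  · rw [← I.mkₗ_eq_zero_iff, mkₗ_cyclic]
    exact h.cyclic ⟨_, ha, rfl⟩ ⟨_, hb, rfl⟩ ⟨_, hc, rfl⟩
  · rintro i j k _ _ _ ⟨a, ha, rfl⟩ ⟨b, hb, rfl⟩ ⟨c, hc, rfl⟩
    rw [← mkₗ_right_alt, I.mkₗ_eq_zero_iff]
    exact h.1 ha hb hc
  · rintro i j k _ _ _ ⟨a, ha, rfl⟩ ⟨b, hb, rfl⟩ ⟨c, hc, rfl⟩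
    rw [← mkₗ_cyclic, I.mkₗ_eq_zero_iff]
    exact h.2 ha hb hc

theorem superCommCentral_quotient_iff (I : AlgIdeal Φ A) :
    SuperCommCentral (I.grading 𝒜) ↔
      ∀ {i j k : ZMod 2} {a b c : A}, a ∈ 𝒜 i → b ∈ 𝒜 j → c ∈ 𝒜 k →
        superComm Φ (i + j) k (superComm Φ i j a b) c ∈ I.toSubmodule := by
  refine ⟨fun h i j k a b c ha hb hc => ?_, fun h => ?_⟩
  · rw [← I.mkₗ_eq_zero_iff, mkₗ_superComm, mkₗ_superComm]
    exact h ⟨_, ha, rfl⟩ ⟨_, hb, rfl⟩ ⟨_, hc, rfl⟩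
  · rintro i j k _ _ _ ⟨a, ha, rfl⟩ ⟨b, hb, rfl⟩ ⟨c, hc, rfl⟩
    rw [← mkₗ_superComm, ← mkₗ_superComm, I.mkₗ_eq_zero_iff]
    exact h ha hb hc

theorem SuperMinusOneOne.quotient (h : SuperMinusOneOne 𝒜) (I : AlgIdeal Φ A) :
    SuperMinusOneOne (I.grading 𝒜) :=
  (superMinusOneOne_quotient_iff I).2
    ⟨fun ha hb hc => h.right_alt ha hb hc ▸ zero_mem _,
      fun ha hb hc => h.cyclic ha hb hc ▸ zero_mem _⟩

theorem SuperCommCentral.quotient (h : SuperCommCentral 𝒜) (I : AlgIdeal Φ A) :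
    SuperCommCentral (I.grading 𝒜) :=
  (superCommCentral_quotient_iff I).2 fun ha hb hc => h ha hb hc ▸ zero_mem _

variable {ℬ : ZMod 2 → Submodule Φ B}

theorem map_associator_of_hom (f : A →ₙₐ[Φ] B) (a b c : A) :
    f (associator a b c) = associator (f a) (f b) (f c) := by
  simp only [associator, map_sub, map_mul]

/-- The quotient by the kernel embeds into `B` compatibly with parities and inherits its identities.
-/
theorem superMinusOneOne_ker (f : A →ₙₐ[Φ] B) (hf : ∀ i, ∀ a ∈ 𝒜 i, f a ∈ ℬ i)
    (h : SuperMinusOneOne ℬ) : SuperMinusOneOne ((AlgIdeal.ker f).grading 𝒜) := by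
  refine (superMinusOneOne_quotient_iff _).2 ⟨fun ha hb hc => ?_, fun ha hb hc => ?_⟩
  · rw [AlgIdeal.mem_ker, map_add, map_smul, map_associator_of_hom, map_associator_of_hom]
    exact h.right_alt (hf _ _ ha) (hf _ _ hb) (hf _ _ hc)
  · rw [AlgIdeal.mem_ker, map_add, map_add, map_smul, map_smul, map_associator_of_hom,
      map_associator_of_hom, map_associator_of_hom]
    exact h.cyclic (hf _ _ ha) (hf _ _ hb) (hf _ _ hc)

theorem map_superComm (f : A →ₙₐ[Φ] B) (i j : ZMod 2) (a b : A) :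
    f (superComm Φ i j a b) = superComm Φ i j (f a) (f b) := by
  rw [superComm, superComm, map_sub, map_smul, map_mul, map_mul]

theorem superCommCentral_ker (f : A →ₙₐ[Φ] B) (hf : ∀ i, ∀ a ∈ 𝒜 i, f a ∈ ℬ i)
    (h : SuperCommCentral ℬ) : SuperCommCentral ((AlgIdeal.ker f).grading 𝒜) := by
  refine (superCommCentral_quotient_iff _).2 fun ha hb hc => ?_
  rw [AlgIdeal.mem_ker, map_superComm, map_superComm]
  exact h (hf _ _ ha) (hf _ _ hb) (hf _ _ hc)

theorem isHomogeneous_of_exists (I : AlgIdeal Φ A)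
    (h : ∀ a ∈ I.toSubmodule, ∃ a₀ ∈ I.toSubmodule ⊓ 𝒜 0, ∃ a₁ ∈ I.toSubmodule ⊓ 𝒜 1,
      a = a₀ + a₁) : I.IsHomogeneous 𝒜 := by
  refine le_antisymm (fun a ha => ?_) (iSup_le fun i => inf_le_left)
  obtain ⟨a₀, h₀, a₁, h₁, rfl⟩ := h a ha
  exact add_mem (Submodule.mem_iSup_of_mem 0 h₀) (Submodule.mem_iSup_of_mem 1 h₁)

/-- If `f (a₀ + a₁) = 0`, then `f a₀ = -f a₁` is both even and odd, hence zero. -/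
theorem isHomogeneous_ker (f : A →ₙₐ[Φ] B) (hf : ∀ i, ∀ a ∈ 𝒜 i, f a ∈ ℬ i)
    (h𝒜 : SuperGraded 𝒜) (hℬ : ℬ 0 ⊓ ℬ 1 = ⊥) : (AlgIdeal.ker f).IsHomogeneous 𝒜 := by
  refine isHomogeneous_of_exists _ fun a ha => ?_
  obtain ⟨a₀, h₀, a₁, h₁, rfl⟩ := h𝒜.exists_eq_add a
  rw [AlgIdeal.mem_ker, map_add] at ha
  have e₀ : f a₀ = 0 := by
    rw [← Submodule.mem_bot Φ, ← hℬ]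
    refine ⟨hf 0 _ h₀, ?_⟩
    rw [SetLike.mem_coe, eq_neg_of_add_eq_zero_left ha]
    exact neg_mem (hf 1 _ h₁)
  have e₁ : f a₁ = 0 := by rwa [e₀, zero_add] at ha
  exact ⟨a₀, ⟨e₀, h₀⟩, a₁, ⟨e₁, h₁⟩, rfl⟩

theorem isSuperIso_of_bijective (f : A →ₙₐ[Φ] B) (hf : ∀ i, ∀ a ∈ 𝒜 i, f a ∈ ℬ i)
    (h𝒜 : 𝒜 0 ⊔ 𝒜 1 = ⊤) (hℬ : ℬ 0 ⊓ ℬ 1 = ⊥) (hb : Function.Bijective f) :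
    IsSuperIso 𝒜 ℬ f := by
  refine ⟨hb, fun i a => ⟨hf i a, fun ha => ?_⟩⟩
  obtain ⟨a₀, h₀, a₁, h₁, rfl⟩ := Submodule.mem_sup.1 (h𝒜 ▸ Submodule.mem_top : a ∈ 𝒜 0 ⊔ 𝒜 1)
  rw [map_add] at ha
  rcases zmod_two_cases i with rfl | rfl
  · have : f a₁ ∈ ℬ 0 ⊓ ℬ 1 :=
      ⟨by simpa using sub_mem ha (hf 0 _ h₀), hf 1 _ h₁⟩
    rw [hℬ, Submodule.mem_bot, map_eq_zero_iff f hb.1] at this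
    rwa [this, add_zero]
  · have : f a₀ ∈ ℬ 0 ⊓ ℬ 1 :=
      ⟨hf 0 _ h₀, by simpa using sub_mem ha (hf 1 _ h₁)⟩
    rw [hℬ, Submodule.mem_bot, map_eq_zero_iff f hb.1] at this
    rwa [this, zero_add]

end Quotients

/-! ## The free nonassociative superalgebra -/

section Free

variable {Φ : Type*} [Field Φ] {W : Type*}

/-- A nonassociative word, as an element of the free nonassociative algebra. -/
abbrev word (Φ : Type*) [Field Φ] (w : FreeMagma W) : FreeNonUnitalNonAssocAlgebra Φ W :=
  MonoidAlgebra.ofMagma Φ (FreeMagma W) w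

theorem word_mul (u v : FreeMagma W) : word Φ (u * v) = word Φ u * word Φ v :=
  map_mul (MonoidAlgebra.ofMagma Φ (FreeMagma W)) u v

@[elab_as_elim]
theorem free_induction {p : FreeNonUnitalNonAssocAlgebra Φ W → Prop}
    (a : FreeNonUnitalNonAssocAlgebra Φ W) (hw : ∀ w, p (word Φ w)) (h0 : p 0)
    (hadd : ∀ a b, p a → p b → p (a + b)) (hsmul : ∀ (r : Φ) a, p a → p (r • a)) : p a := by
  induction a using MonoidAlgebra.induction_linear with
  | zero => exact h0
  | add a b ha hb => exact hadd a b ha hb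
  | single w r =>
    have : MonoidAlgebra.single w r = r • word Φ w := by simp [word]
    rw [this]
    exact hsmul r _ (hw w)

/-- The projection to the span of the words with property `P`. -/
def wordProj (Φ : Type*) [Field Φ] (P : FreeMagma W → Prop) [DecidablePred P] :
    FreeNonUnitalNonAssocAlgebra Φ W →ₗ[Φ] FreeNonUnitalNonAssocAlgebra Φ W :=
  (MonoidAlgebra.basis (FreeMagma W) Φ).constr Φ fun w => if P w then word Φ w else 0

@[simp] theorem wordProj_word (P : FreeMagma W → Prop) [DecidablePred P] (w : FreeMagma W) :
    wordProj Φ P (word Φ w) = if P w then word Φ w else 0 := by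
  have : word Φ w = MonoidAlgebra.basis (FreeMagma W) Φ w := by simp [word]
  rw [wordProj, this, Module.Basis.constr_basis, ← this]

variable {X Y : Type*}

theorem parity_mul (u v : FreeMagma (X ⊕ Y)) : parity (u * v) = parity u + parity v := rfl

theorem word_mem_freeGrading (w : FreeMagma (X ⊕ Y)) : word Φ w ∈ freeGrading Φ X Y (parity w) :=
  Submodule.subset_span ⟨w, rfl, rfl⟩

theorem superGraded_free : SuperGraded (freeGrading Φ X Y) where
  mul_mem {i j a b} ha hb := by
    induction ha, hb using Submodule.span_induction₂ with
    | mem_mem a b ha hb =>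
      obtain ⟨u, rfl, rfl⟩ := ha
      obtain ⟨v, rfl, rfl⟩ := hb
      rw [← map_mul]
      exact word_mem_freeGrading (u * v)
    | zero_left => simp
    | zero_right => simp
    | add_left _ _ _ _ _ _ h₁ h₂ => rw [add_mul]; exact add_mem h₁ h₂
    | add_right _ _ _ _ _ _ h₁ h₂ => rw [mul_add]; exact add_mem h₁ h₂
    | smul_left r _ _ _ _ h => rw [smul_mul_assoc]; exact Submodule.smul_mem _ r h
    | smul_right r _ _ _ _ h => rw [mul_smul_comm]; exact Submodule.smul_mem _ r h
  sup_eq_top := by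
    refine eq_top_iff.2 fun a _ => ?_
    induction a using free_induction with
    | hw w =>
      rcases zmod_two_cases (parity w) with h | h
      · exact Submodule.mem_sup_left (h ▸ word_mem_freeGrading w)
      · exact Submodule.mem_sup_right (h ▸ word_mem_freeGrading w)
    | h0 => exact zero_mem _
    | hadd a b ha hb => exact add_mem (ha trivial) (hb trivial)
    | hsmul r a ha => exact Submodule.smul_mem _ r (ha trivial)

variable {B : Type*} [NonUnitalNonAssocRing B] [Module Φ B] [IsScalarTower Φ B B]
  [SMulCommClass Φ B B] {ℬ : ZMod 2 → Submodule Φ B}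

theorem lift_mem_grading (hmul : ∀ {i j : ZMod 2} {a b : B}, a ∈ ℬ i → b ∈ ℬ j → a * b ∈ ℬ (i + j))
    (g : X ⊕ Y → B) (hX : ∀ x, g (.inl x) ∈ ℬ 0) (hY : ∀ y, g (.inr y) ∈ ℬ 1) :
    ∀ i, ∀ a ∈ freeGrading Φ X Y i, FreeNonUnitalNonAssocAlgebra.lift Φ g a ∈ ℬ i := by
  have key : ∀ w : FreeMagma (X ⊕ Y),
      FreeNonUnitalNonAssocAlgebra.lift Φ g (word Φ w) ∈ ℬ (parity w) := by
    intro w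
    induction w with
    | ih1 s =>
      have := FreeNonUnitalNonAssocAlgebra.lift_of_apply (R := Φ) g s
      rw [FreeNonUnitalNonAssocAlgebra.of, Function.comp_apply] at this
      rw [this]
      cases s with
      | inl x => exact hX x
      | inr y => exact hY y
    | ih2 u v hu hv =>
      rw [word_mul, map_mul, parity_mul]
      exact hmul hu hv
  intro i a ha
  induction ha using Submodule.span_induction with
  | mem a ha =>
    obtain ⟨w, rfl, rfl⟩ := ha
    exact key w
  | zero => rw [map_zero]; exact zero_mem _
  | add a b _ _ ha hb => rw [map_add]; exact add_mem ha hb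
  | smul r a _ ha => rw [map_smul]; exact Submodule.smul_mem _ r ha

/-- The homomorphism from a free superalgebra of a variety, defined by the images of the
generators. -/
def FreeSuper.lift {V : Identities Φ} (g : X ⊕ Y → B)
    (h : ∀ a ∈ (varietyIdeal V X Y).toSubmodule, FreeNonUnitalNonAssocAlgebra.lift Φ g a = 0) :
    FreeSuper V X Y →ₙₐ[Φ] B :=
  (varietyIdeal V X Y).lift (FreeNonUnitalNonAssocAlgebra.lift Φ g) h

theorem varietyIdeal_le {V : Identities Φ} {J : AlgIdeal Φ (FreeNonUnitalNonAssocAlgebra Φ (X ⊕ Y))}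
    (h : J.IsHomogeneous (freeGrading Φ X Y))
    (h' : IsSuperalgebraOf V (J.grading (freeGrading Φ X Y))) :
    (varietyIdeal V X Y).toSubmodule ≤ J.toSubmodule :=
  fun _ ha => AlgIdeal.mem_sInf.1 ha J ⟨h, h'⟩

/-- The superidentities hold modulo every ideal of the defining family, hence modulo the
intersection. -/
theorem superMinusOneOne_freeSuper {V : Identities Φ} (hV : varietyMinusOneOne Φ ⊆ V) :
    SuperMinusOneOne (FreeSuper.grading V X Y) := by
  refine (superMinusOneOne_quotient_iff _).2 ⟨fun ha hb hc => ?_, fun ha hb hc => ?_⟩ <;>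
  refine AlgIdeal.mem_sInf.2 fun J hJ => ?_ <;>
  have hJ' := (superMinusOneOne_quotient_iff J).1
    (superMinusOneOne_of_isSuperalgebraOf fun f hf => hJ.2 f (hV hf))
  · exact hJ'.1 ha hb hc
  · exact hJ'.2 ha hb hc

theorem superCommCentral_freeSuper :
    SuperCommCentral (FreeSuper.grading (varietyStrongly Φ) X Y) := by
  refine (superCommCentral_quotient_iff _).2 fun ha hb hc => AlgIdeal.mem_sInf.2 fun J hJ => ?_
  exact (superCommCentral_quotient_iff J).1 (superCommCentral_of_strongly hJ.2) ha hb hc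

theorem superGraded_freeSuper (V : Identities Φ) : SuperGraded (FreeSuper.grading V X Y) :=
  superGraded_free.quotient _

/-- A subspace that contains the generators and is closed under multiplication is everything. -/
theorem free_eq_top (S : Submodule Φ (FreeNonUnitalNonAssocAlgebra Φ W))
    (hS : ∀ s, FreeNonUnitalNonAssocAlgebra.of Φ s ∈ S)
    (hmul : ∀ a ∈ S, ∀ b ∈ S, a * b ∈ S) : S = ⊤ := by
  refine eq_top_iff.2 fun a ha => ?_
  clear ha
  induction a using free_induction with
  | hw w =>
    induction w with
    | ih1 s => exact hS s
    | ih2 u v hu hv => rw [word_mul]; exact hmul _ hu _ hv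
  | h0 => exact zero_mem _
  | hadd a b ha hb => exact add_mem ha hb
  | hsmul r a ha => exact Submodule.smul_mem _ r ha

end Free

/-! ## The superalgebra `F[Z;x]` -/

section FZx

variable {Φ : Type*} [Field Φ] {Z : Type*}

theorem FZx.superGraded : SuperGraded (FZx.grading Φ Z) := (superGraded_freeSuper _).quotient _

theorem FZx.superMinusOneOne : SuperMinusOneOne (FZx.grading Φ Z) :=
  (superMinusOneOne_freeSuper fun _ => Or.inr).quotient _

theorem FZx.superCommCentral : SuperCommCentral (FZx.grading Φ Z) :=
  superCommCentral_freeSuper.quotient _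

theorem FZx.z_mem (z : Z) : FZx.z Φ z ∈ FZx.grading Φ Z 0 :=
  ⟨_, ⟨_, word_mem_freeGrading (FreeMagma.of (Sum.inl z)), rfl⟩, rfl⟩

theorem FZx.x_mem : FZx.x Φ Z ∈ FZx.grading Φ Z 1 :=
  ⟨_, ⟨_, word_mem_freeGrading (FreeMagma.of (Sum.inr ())), rfl⟩, rfl⟩

theorem FZx.z_mul (z : Z) (a : FZx Φ Z) : FZx.z Φ z * a = a * FZx.z Φ z := by
  obtain ⟨a, rfl⟩ := (centralIdeal Φ Z).mkₗ_surjective a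
  rw [FZx.z, ← AlgIdeal.mkₗ_mul, ← AlgIdeal.mkₗ_mul, AlgIdeal.mkₗ_eq_iff]
  exact AlgIdeal.subset_span ⟨z, a, rfl⟩

theorem FZx.eq_top (S : Submodule Φ (FZx Φ Z)) (hx : FZx.x Φ Z ∈ S) (hz : ∀ z, FZx.z Φ z ∈ S)
    (hmul : ∀ a ∈ S, ∀ b ∈ S, a * b ∈ S) : S = ⊤ := by
  let q := (centralIdeal Φ Z).mkₗ ∘ₗ (varietyIdeal (varietyStrongly Φ) Z Unit).mkₗ
  have hq : S.comap q = ⊤ := by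
    refine free_eq_top _ ?_ fun a ha b hb => hmul _ ha _ hb
    rintro (z | ⟨⟩)
    · exact hz z
    · exact hx
  refine eq_top_iff.2 fun a _ => ?_
  obtain ⟨a, rfl⟩ := (centralIdeal Φ Z).mkₗ_surjective a
  obtain ⟨a, rfl⟩ := (varietyIdeal (varietyStrongly Φ) Z Unit).mkₗ_surjective a
  exact (hq ▸ Submodule.mem_top : a ∈ S.comap q)

variable {B : Type*} [NonUnitalNonAssocRing B] [Module Φ B] [IsScalarTower Φ B B]
  [SMulCommClass Φ B B] {ℬ : ZMod 2 → Submodule Φ B}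

/-- The universal property of `F[Z;x]`. -/
theorem FZx.exists_hom (h2 : (2 : Φ) ≠ 0) (hB : SuperMinusOneOne ℬ) (hB' : SuperCommCentral ℬ)
    (hmul : ∀ {i j : ZMod 2} {a b : B}, a ∈ ℬ i → b ∈ ℬ j → a * b ∈ ℬ (i + j))
    (hbot : ℬ 0 ⊓ ℬ 1 = ⊥) {x : B} (hx : x ∈ ℬ 1) (z : Z → B) (hz : ∀ i, z i ∈ ℬ 0)
    (hzc : ∀ i b, z i * b = b * z i) :
    ∃ f : FZx Φ Z →ₙₐ[Φ] B, (∀ i, ∀ a ∈ FZx.grading Φ Z i, f a ∈ ℬ i) ∧ f (FZx.x Φ Z) = x ∧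
      ∀ i, f (FZx.z Φ i) = z i := by
  let g : Z ⊕ Unit → B := Sum.elim z fun _ => x
  have hg := lift_mem_grading (Φ := Φ) hmul g hz fun _ => hx
  -- The kernel of the evaluation is itself one of the ideals whose intersection is the ideal of
  -- identities.
  have hle := varietyIdeal_le (V := varietyStrongly Φ)
    (isHomogeneous_ker _ hg superGraded_free hbot)
    (isSuperalgebraOf_strongly h2 (superMinusOneOne_ker _ hg hB) (superCommCentral_ker _ hg hB'))
  let f₁ := FreeSuper.lift g hle
  have hf₁ : ∀ i, f₁ (FreeSuper.even _ _ i) = z i := fun i =>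
    FreeNonUnitalNonAssocAlgebra.lift_of_apply Φ g (Sum.inl i)
  have hf₁' : f₁ (FreeSuper.odd _ _ ()) = x :=
    FreeNonUnitalNonAssocAlgebra.lift_of_apply Φ g (Sum.inr ())
  have hle₁ : (centralIdeal Φ Z).toSubmodule ≤ (AlgIdeal.ker f₁).toSubmodule := by
    refine AlgIdeal.span_le ?_
    rintro _ ⟨i, a, rfl⟩
    rw [AlgIdeal.mem_ker, map_sub, map_mul, map_mul, hf₁, hzc, sub_self]
  refine ⟨(centralIdeal Φ Z).lift f₁ hle₁, ?_, hf₁', hf₁⟩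
  rintro i _ ⟨_, ⟨a, ha, rfl⟩, rfl⟩
  exact hg i a ha

end FZx

/-! ## The superalgebras of vector type satisfy the superidentities -/

section VectorType

variable {Φ : Type*} [Field Φ] {Γ : Type*} [CommRing Γ] [Algebra Φ Γ] {D : Derivation Φ Γ Γ} {γ : Γ}

namespace VectorType

theorem exists_ev {p : VectorType D γ} (h : p ∈ grading D γ 0) : ∃ a, p = ev D γ a :=
  ⟨fstₗ D γ p, ext rfl h⟩

theorem exists_bar {p : VectorType D γ} (h : p ∈ grading D γ 1) : ∃ a, p = bar D γ a :=
  ⟨sndₗ D γ p, ext h rfl⟩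

theorem ev_mem (a : Γ) : ev D γ a ∈ grading D γ 0 := rfl

theorem bar_mem (a : Γ) : bar D γ a ∈ grading D γ 1 := rfl

@[simp] theorem ev_mul_ev (a b : Γ) : ev D γ a * ev D γ b = ev D γ (a * b) := by
  ext <;> simp [fst_mul, snd_mul]

@[simp] theorem ev_mul_bar (a b : Γ) : ev D γ a * bar D γ b = bar D γ (a * b) := by
  ext <;> simp [fst_mul, snd_mul]

@[simp] theorem bar_mul_ev (a b : Γ) : bar D γ a * ev D γ b = bar D γ (a * b) := by
  ext <;> simp [fst_mul, snd_mul]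

@[simp] theorem bar_mul_bar (a b : Γ) :
    bar D γ a * bar D γ b = ev D γ (γ * (a * b) + 2 * D a * b + a * D b) := by
  ext <;> simp [fst_mul, snd_mul]

theorem ev_sub (a b : Γ) : ev D γ a - ev D γ b = ev D γ (a - b) := by
  ext <;> simp

theorem bar_sub (a b : Γ) : bar D γ a - bar D γ b = bar D γ (a - b) := by
  ext <;> simp

theorem ev_add (a b : Γ) : ev D γ a + ev D γ b = ev D γ (a + b) := by
  ext <;> simp

theorem bar_add (a b : Γ) : bar D γ a + bar D γ b = bar D γ (a + b) := by
  ext <;> simp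

theorem neg_ev (a : Γ) : -ev D γ a = ev D γ (-a) := by
  ext <;> simp

theorem neg_bar (a : Γ) : -bar D γ a = bar D γ (-a) := by
  ext <;> simp

theorem ev_zero : ev D γ 0 = 0 := rfl

theorem smul_ev (r : Φ) (a : Γ) : r • ev D γ a = ev D γ (r • a) := by
  ext <;> simp

theorem smul_bar (r : Φ) (a : Γ) : r • bar D γ a = bar D γ (r • a) := by
  ext <;> simp

theorem eq_ev_add_bar (p : VectorType D γ) : p = ev D γ (fstₗ D γ p) + bar D γ (sndₗ D γ p) := by
  ext <;> simp

theorem grading_inf : grading D γ 0 ⊓ grading D γ 1 = ⊥ :=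
  (Submodule.eq_bot_iff _).2 fun _ h => ext h.2 h.1

theorem superGraded : SuperGraded (grading D γ) where
  mul_mem {i j a b} ha hb := by
    rcases zmod_two_cases i with rfl | rfl <;> rcases zmod_two_cases j with rfl | rfl
    · obtain ⟨a, rfl⟩ := exists_ev ha
      obtain ⟨b, rfl⟩ := exists_ev hb
      rw [ev_mul_ev, zero_add]
      exact ev_mem _
    · obtain ⟨a, rfl⟩ := exists_ev ha
      obtain ⟨b, rfl⟩ := exists_bar hb
      rw [ev_mul_bar, zero_add]
      exact bar_mem _
    · obtain ⟨a, rfl⟩ := exists_bar ha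
      obtain ⟨b, rfl⟩ := exists_ev hb
      rw [bar_mul_ev, add_zero]
      exact bar_mem _
    · obtain ⟨a, rfl⟩ := exists_bar ha
      obtain ⟨b, rfl⟩ := exists_bar hb
      rw [bar_mul_bar, one_add_one_zmod_two]
      exact ev_mem _
  sup_eq_top := eq_top_iff.2 fun p _ => by
    rw [eq_ev_add_bar p]
    exact add_mem (Submodule.mem_sup_left (ev_mem _)) (Submodule.mem_sup_right (bar_mem _))

theorem ev_mul_comm (a : Γ) (p : VectorType D γ) : ev D γ a * p = p * ev D γ a := by
  ext <;> simp [fst_mul, snd_mul, mul_comm]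

/-- In each of the eight parity cases the Leibniz rule reduces the claim to a polynomial identity in
the commutative ring `Γ`. -/
theorem superMinusOneOne : SuperMinusOneOne (grading D γ) where
  right_alt {i j k a b c} ha hb hc := by
    rcases zmod_two_cases i with rfl | rfl <;> rcases zmod_two_cases j with rfl | rfl <;>
    rcases zmod_two_cases k with rfl | rfl <;>
    (first | obtain ⟨a, rfl⟩ := exists_ev ha | obtain ⟨a, rfl⟩ := exists_bar ha) <;>
    (first | obtain ⟨b, rfl⟩ := exists_ev hb | obtain ⟨b, rfl⟩ := exists_bar hb) <;>
    (first | obtain ⟨c, rfl⟩ := exists_ev hc | obtain ⟨c, rfl⟩ := exists_bar hc) <;>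
    simp only [associator, ev_mul_ev, ev_mul_bar, bar_mul_ev, bar_mul_bar, sgn_zero_left,
      sgn_zero_right, sgn_one_one, one_smul, neg_smul, ev_sub, bar_sub, neg_ev, neg_bar,
      ev_add, bar_add, Derivation.leibniz, smul_eq_mul] <;>
    (rw [← ev_zero]; congr 1; ring)
  cyclic {i j k a b c} ha hb hc := by
    rcases zmod_two_cases i with rfl | rfl <;> rcases zmod_two_cases j with rfl | rfl <;>
    rcases zmod_two_cases k with rfl | rfl <;>
    (first | obtain ⟨a, rfl⟩ := exists_ev ha | obtain ⟨a, rfl⟩ := exists_bar ha) <;>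
    (first | obtain ⟨b, rfl⟩ := exists_ev hb | obtain ⟨b, rfl⟩ := exists_bar hb) <;>
    (first | obtain ⟨c, rfl⟩ := exists_ev hc | obtain ⟨c, rfl⟩ := exists_bar hc) <;>
    simp only [associator, ev_mul_ev, ev_mul_bar, bar_mul_ev, bar_mul_bar, sgn_zero_left,
      sgn_zero_right, sgn_one_one, one_smul, neg_smul, ev_sub, bar_sub, neg_ev,
      ev_add, bar_add, Derivation.leibniz, smul_eq_mul, one_add_one_zmod_two, zero_add,
      add_zero] <;>
    (rw [← ev_zero]; congr 1; ring)

/-- Even elements commute with everything, and the only nonzero supercommutators, `ā × b̄ + b̄ × ā =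
2γab + 3D(ab)`, are even. -/
theorem superCommCentral : SuperCommCentral (grading D γ) := by
  intro i j k a b c ha hb hc
  rcases zmod_two_cases i with rfl | rfl <;> rcases zmod_two_cases j with rfl | rfl <;>
  rcases zmod_two_cases k with rfl | rfl <;>
  (first | obtain ⟨a, rfl⟩ := exists_ev ha | obtain ⟨a, rfl⟩ := exists_bar ha) <;>
  (first | obtain ⟨b, rfl⟩ := exists_ev hb | obtain ⟨b, rfl⟩ := exists_bar hb) <;>
  (first | obtain ⟨c, rfl⟩ := exists_ev hc | obtain ⟨c, rfl⟩ := exists_bar hc) <;>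
  simp only [superComm, ev_mul_ev, ev_mul_bar, bar_mul_ev, bar_mul_bar, sgn_zero_left,
    sgn_zero_right, sgn_one_one, one_smul, neg_smul, ev_sub, bar_sub, neg_ev,
    map_sub, smul_eq_mul, one_add_one_zmod_two, zero_add,
    add_zero, sub_neg_eq_add, Derivation.leibniz] <;>
  (rw [← ev_zero]; congr 1; ring)

end VectorType

end VectorType

/-! ## The even commutative centre -/

section EvenCenter

variable {Φ : Type*} [Field Φ] {A : Type*} [NonUnitalNonAssocRing A] [Module Φ A]
  [IsScalarTower Φ A A] [SMulCommClass Φ A A]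

/-- The even elements that commute with every element. -/
def evenCenter (𝒜 : ZMod 2 → Submodule Φ A) : Submodule Φ A where
  carrier := {k | k ∈ 𝒜 0 ∧ ∀ a, k * a = a * k}
  add_mem' := fun ha hb => ⟨add_mem ha.1 hb.1, fun a => by rw [add_mul, mul_add, ha.2, hb.2]⟩
  zero_mem' := ⟨zero_mem _, fun a => by rw [zero_mul, mul_zero]⟩
  smul_mem' := fun r a ha =>
    ⟨Submodule.smul_mem _ r ha.1, fun b => by rw [smul_mul_assoc, mul_smul_comm, ha.2]⟩

variable {𝒜 : ZMod 2 → Submodule Φ A}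

-- An even argument makes the sign trivial, so the four homogeneous cases add up to a statement
-- about arbitrary `a` and `b`.
omit [IsScalarTower Φ A A] [SMulCommClass Φ A A] in
theorem right_alt_of_even (hg : SuperGraded 𝒜) (h𝒜 : SuperMinusOneOne 𝒜) {k : A} (hk : k ∈ 𝒜 0)
    (a b : A) : associator a b k + associator a k b = 0 := by
  obtain ⟨a₀, ha₀, a₁, ha₁, rfl⟩ := hg.exists_eq_add a
  obtain ⟨b₀, hb₀, b₁, hb₁, rfl⟩ := hg.exists_eq_add b
  have h₀₀ := h𝒜.right_alt ha₀ hb₀ hk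
  have h₀₁ := h𝒜.right_alt ha₀ hb₁ hk
  have h₁₀ := h𝒜.right_alt ha₁ hb₀ hk
  have h₁₁ := h𝒜.right_alt ha₁ hb₁ hk
  simp only [sgn_zero_right, one_smul, associator] at h₀₀ h₀₁ h₁₀ h₁₁
  simp only [associator, mul_add, add_mul]
  linear_combination (norm := module) h₀₀ + h₀₁ + h₁₀ + h₁₁

variable (hg : SuperGraded 𝒜) (h𝒜 : SuperMinusOneOne 𝒜)
include hg h𝒜

/-- Commuting `k` through gives `(k,a,b) - (a,k,b) = a(bk) - (ab)k = -(a,b,k)`, and right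
alternativity turns this into `(a,k,b)`. -/
theorem associator_evenCenter {k : A} (hk : k ∈ evenCenter 𝒜) (a b : A) :
    associator k a b = (2 : Φ) • associator a k b := by
  have h := right_alt_of_even hg h𝒜 hk.1 a b
  have e₁ := hk.2 (a * b)
  simp only [associator] at h ⊢
  rw [← hk.2 b] at h
  rw [hk.2 a]
  linear_combination (norm := module) -h - e₁

/-- The preceding relation doubles the associator when `k` and `l` are exchanged; two exchanges give
`(k,l,a) = 4 (k,l,a)`. -/
theorem associator_evenCenter_left (h3 : (3 : Φ) ≠ 0) {k l : A} (hk : k ∈ evenCenter 𝒜)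
    (hl : l ∈ evenCenter 𝒜) (a : A) : associator k l a = 0 := by
  have h₁ := associator_evenCenter hg h𝒜 hk l a
  have h₂ := associator_evenCenter hg h𝒜 hl k a
  have : (3 : Φ) • associator k l a = 0 := by
    linear_combination (norm := module) -h₁ - (2 : Φ) • h₂
  exact (smul_eq_zero.1 this).resolve_left h3

theorem associator_evenCenter_outer (h3 : (3 : Φ) ≠ 0) {k l : A} (hk : k ∈ evenCenter 𝒜)
    (hl : l ∈ evenCenter 𝒜) (a : A) : associator k a l = 0 := by
  have := right_alt_of_even hg h𝒜 hl.1 k a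
  rwa [associator_evenCenter_left hg h𝒜 h3 hk hl, add_zero] at this

theorem associator_evenCenter_right (h2 : (2 : Φ) ≠ 0) (h3 : (3 : Φ) ≠ 0) {k l : A}
    (hk : k ∈ evenCenter 𝒜) (hl : l ∈ evenCenter 𝒜) (a : A) : associator a k l = 0 := by
  have := associator_evenCenter hg h𝒜 hk a l
  rw [associator_evenCenter_outer hg h𝒜 h3 hk hl] at this
  exact (smul_eq_zero.1 this.symm).resolve_left h2

theorem mul_mem_evenCenter (h2 : (2 : Φ) ≠ 0) (h3 : (3 : Φ) ≠ 0) {k l : A}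
    (hk : k ∈ evenCenter 𝒜) (hl : l ∈ evenCenter 𝒜) : k * l ∈ evenCenter 𝒜 := by
  refine ⟨by simpa using hg.mul_mem hk.1 hl.1, fun a => ?_⟩
  have h₁ := associator_evenCenter_left hg h𝒜 h3 hk hl a
  have h₂ := associator_evenCenter_outer hg h𝒜 h3 hk hl a
  have h₃ := associator_evenCenter_right hg h𝒜 h2 h3 hk hl a
  simp only [associator, sub_eq_zero] at h₁ h₂ h₃
  rw [h₁, ← h₃, ← hk.2 a, h₂, hl.2 a]

section OddGenerator

variable {x : A} (hx : x ∈ 𝒜 1)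

/-- `x (k x) = ((k x) x + k x²) / 2`. -/
theorem two_smul_mul_mul {k : A} (hk : k ∈ evenCenter 𝒜) :
    (2 : Φ) • (x * (k * x)) = k * x * x + k * (x * x) := by
  have h := associator_evenCenter hg h𝒜 hk x x
  simp only [associator] at h
  rw [← hk.2 x] at h
  linear_combination (norm := module) h

include hx

/-- `2 (k x)(l x) = k (l x²) + 2 ((k l) x) x - k ((l x) x)`. -/
theorem two_smul_odd_mul_odd (h3 : (3 : Φ) ≠ 0) {k l : A} (hk : k ∈ evenCenter 𝒜)
    (hl : l ∈ evenCenter 𝒜) : (2 : Φ) • (k * x * (l * x)) =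
      k * (l * (x * x)) + (2 : Φ) • (k * l * x * x) - k * (l * x * x) := by
  have hlx : l * x ∈ 𝒜 1 := by simpa using hg.mul_mem hl.1 hx
  have h := h𝒜.right_alt hk.1 hx hlx
  have h₁ := congrArg (k * ·) (two_smul_mul_mul (Φ := Φ) (x := x) hg h𝒜 hl)
  have h₂ := associator_evenCenter_left hg h𝒜 h3 hk hl x
  simp only [associator, sub_eq_zero] at h₂
  simp only [mul_smul_comm, mul_add] at h₁
  simp only [associator, sgn_one_one] at h
  rw [h₂]
  linear_combination (norm := module) (2 : Φ) • h + h₁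

/-- This derivation property drives the spanning argument. The relation `(l,kx,x) = 2 (kx,l,x)`
gives `2 (kx)(lx) = ((kl)x)x + l((kx)x)`; comparison with `two_smul_odd_mul_odd` yields the Leibniz
rule. -/
theorem opR_mul (h3 : (3 : Φ) ≠ 0) {k l : A} (hk : k ∈ evenCenter 𝒜)
    (hl : l ∈ evenCenter 𝒜) : opR x x (k * l) = k * opR x x l + l * opR x x k := by
  have h₁ := two_smul_odd_mul_odd hg h𝒜 hx h3 hk hl
  have h₂ := associator_evenCenter hg h𝒜 hl (k * x) x
  have h₄ := associator_evenCenter_left hg h𝒜 h3 hl hk (x * x)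
  have h₅ := associator_evenCenter_left hg h𝒜 h3 hl hk x
  simp only [associator, sub_eq_zero] at h₄ h₅
  simp only [associator, ← hl.2 (k * x), ← h₅, hl.2 k] at h₂ h₄
  simp only [opR, mul_sub]
  linear_combination (norm := module) h₂ - h₁ - h₄

variable (h𝒜' : SuperCommCentral 𝒜)
include h𝒜'

-- The element is the supercommutator of two odd elements, so it is even and the identity `[[a,b],c]
-- = 0` says that it commutes with every homogeneous `c`.
omit h𝒜 hx in
theorem add_mem_evenCenter {a b : A} (ha : a ∈ 𝒜 1) (hb : b ∈ 𝒜 1) :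
    a * b + b * a ∈ evenCenter 𝒜 := by
  have hodd : a * b + b * a ∈ 𝒜 0 := by
    rw [← one_add_one_zmod_two]
    exact add_mem (hg.mul_mem ha hb) (hg.mul_mem hb ha)
  refine ⟨hodd, fun c => ?_⟩
  have key : ∀ k, ∀ c ∈ 𝒜 k, (a * b + b * a) * c = c * (a * b + b * a) := by
    intro k c hc
    have := h𝒜' ha hb hc
    simpa [superComm, one_add_one_zmod_two, sub_eq_zero] using this
  obtain ⟨c₀, h₀, c₁, h₁, rfl⟩ := hg.exists_eq_add c
  rw [mul_add (a * b + b * a), add_mul c₀, key 0 c₀ h₀, key 1 c₁ h₁]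

omit h𝒜 in
theorem mul_self_mem_evenCenter (h2 : (2 : Φ) ≠ 0) : x * x ∈ evenCenter 𝒜 := by
  have h := add_mem_evenCenter hg h𝒜' hx hx
  rw [← two_smul Φ] at h
  exact (Submodule.smul_mem_iff _ h2).1 h

theorem mul_mul_mem_evenCenter (h2 : (2 : Φ) ≠ 0) (h3 : (3 : Φ) ≠ 0) {k : A}
    (hk : k ∈ evenCenter 𝒜) : k * x * x ∈ evenCenter 𝒜 := by
  have hkx : k * x ∈ 𝒜 1 := by simpa using hg.mul_mem hk.1 hx
  have h := Submodule.smul_mem _ (2 : Φ) (add_mem_evenCenter hg h𝒜' hkx hx)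
  have h' := mul_mem_evenCenter hg h𝒜 h2 h3 hk (mul_self_mem_evenCenter hg hx h𝒜' h2)
  rw [← Submodule.smul_mem_iff _ h3]
  -- `3 (kx)x = 2 ((kx)x + x(kx)) - k x²`, by the formula for `2 x(kx)`.
  convert sub_mem h h' using 1
  have := two_smul_mul_mul (Φ := Φ) (x := x) hg h𝒜 hk
  linear_combination (norm := module) -this

theorem opR_mem_evenCenter (h2 : (2 : Φ) ≠ 0) (h3 : (3 : Φ) ≠ 0) {k : A}
    (hk : k ∈ evenCenter 𝒜) : opR x x k ∈ evenCenter 𝒜 :=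
  sub_mem (mul_mul_mem_evenCenter hg h𝒜 hx h𝒜' h2 h3 hk)
    (mul_mem_evenCenter hg h𝒜 h2 h3 hk (mul_self_mem_evenCenter hg hx h𝒜' h2))

end OddGenerator

end EvenCenter

/-! ## Normal words -/

section Words

variable {ι A : Type*} [Mul A] {v : ι → A} {x : A}

theorem IsMonomial.ne_zero {m : ι →₀ ℕ} {a : A} (h : IsMonomial v m a) : m ≠ 0 := by
  induction h with
  | var i => simp
  | mul _ _ h₁ _ => exact fun h => h₁ (add_eq_zero.1 h).1

theorem exists_isMonomial (v : ι → A) {m : ι →₀ ℕ} (hm : m ≠ 0) : ∃ a, IsMonomial v m a := by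
  induction m using Finsupp.induction_linear with
  | zero => exact absurd rfl hm
  | add f g hf hg =>
    rcases eq_or_ne f 0 with rfl | hf0
    · rw [zero_add] at hm ⊢
      exact hg hm
    · rcases eq_or_ne g 0 with rfl | hg0
      · rw [add_zero]
        exact hf hf0
      · obtain ⟨a, ha⟩ := hf hf0
        obtain ⟨b, hb⟩ := hg hg0
        exact ⟨a * b, ha.mul hb⟩
  | single i n =>
    rcases n with _ | n
    · simp at hm
    clear hm
    induction n with
    | zero => exact ⟨v i, .var i⟩
    | succ n ih =>
      obtain ⟨a, ha⟩ := ih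
      exact ⟨a * v i, Finsupp.single_add i (n + 1) 1 ▸ ha.mul (.var i)⟩

theorem IsNormalWord.ne_zero {p : (ι →₀ ℕ) × Fin 2} {a : A} (h : IsNormalWord v x p a) :
    p ≠ 0 := by
  cases h with
  | even h => exact fun e => h.ne_zero (congrArg Prod.fst e)
  | gen => exact fun e => one_ne_zero (congrArg Prod.snd e)
  | odd h => exact fun e => h.ne_zero (congrArg Prod.fst e)

theorem exists_isNormalWord (v : ι → A) (x : A) {p : (ι →₀ ℕ) × Fin 2} (hp : p ≠ 0) :
    ∃ a, IsNormalWord v x p a := by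
  obtain ⟨m, ε⟩ := p
  rcases eq_or_ne m 0 with rfl | hm
  · obtain rfl : ε = 1 := by
      rcases Fin.exists_fin_two.1 ⟨ε, rfl⟩ with h | h
      · exact absurd (by rw [h]; rfl) hp
      · exact h
    exact ⟨x, .gen⟩
  · obtain ⟨a, ha⟩ := exists_isMonomial v hm
    rcases Fin.exists_fin_two.1 ⟨ε, rfl⟩ with h | h
    · exact ⟨a, h ▸ .even ha⟩
    · exact ⟨a * x, h ▸ .odd ha⟩

theorem IsMonomial.mem {m : ι →₀ ℕ} {a : A} (h : IsMonomial v m a) {S : Set A}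
    (hv : ∀ i, v i ∈ S) (hS : ∀ a ∈ S, ∀ b ∈ S, a * b ∈ S) : a ∈ S := by
  induction h with
  | var i => exact hv i
  | mul _ _ h₁ h₂ => exact hS _ h₁ _ h₂

theorem IsMonomial.exists_of_map {B : Type*} [Mul B] (q : A →ₙ* B) {m : ι →₀ ℕ} {b : B}
    (h : IsMonomial (q ∘ v) m b) : ∃ a, IsMonomial v m a ∧ q a = b := by
  induction h with
  | var i => exact ⟨v i, .var i, rfl⟩
  | mul _ _ h₁ h₂ =>
    obtain ⟨a₁, h₁, rfl⟩ := h₁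
    obtain ⟨a₂, h₂, rfl⟩ := h₂
    exact ⟨a₁ * a₂, h₁.mul h₂, map_mul q _ _⟩

theorem IsMonomial.map {B : Type*} [Mul B] (q : A →ₙ* B) {m : ι →₀ ℕ} {a : A}
    (h : IsMonomial v m a) : IsMonomial (q ∘ v) m (q a) := by
  induction h with
  | var i => exact .var i
  | mul _ _ h₁ h₂ => rw [map_mul]; exact h₁.mul h₂

theorem IsMonomial.of_comp {κ : Type*} (j : κ → ι) {m : κ →₀ ℕ} {a : A}
    (h : IsMonomial (v ∘ j) m a) : IsMonomial v (m.mapDomain j) a := by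
  induction h with
  | var i => rw [Finsupp.mapDomain_single]; exact .var _
  | mul _ _ h₁ h₂ => rw [Finsupp.mapDomain_add]; exact h₁.mul h₂

theorem IsNormalWord.exists_of_map {B : Type*} [Mul B] (q : A →ₙ* B) {p : (ι →₀ ℕ) × Fin 2} {b : B}
    (h : IsNormalWord (q ∘ v) (q x) p b) : ∃ a, IsNormalWord v x p a ∧ q a = b := by
  cases h with
  | even h =>
    obtain ⟨a, h', rfl⟩ := h.exists_of_map
    exact ⟨a, .even h', rfl⟩
  | gen => exact ⟨x, .gen, rfl⟩
  | odd h =>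
    obtain ⟨a, h', rfl⟩ := h.exists_of_map
    exact ⟨a * x, .odd h', map_mul q _ _⟩

theorem IsNormalWord.of_comp {κ : Type*} (j : κ → ι) {p : (κ →₀ ℕ) × Fin 2} {a : A}
    (h : IsNormalWord (v ∘ j) x p a) : IsNormalWord v x (p.1.mapDomain j, p.2) a := by
  cases h with
  | even h => exact .even (h.of_comp j)
  | gen => rw [Finsupp.mapDomain_zero]; exact .gen
  | odd h => exact .odd (h.of_comp j)

end Words

/-! ### Spanning by normal words, possibly together with a unit. -/

section Spanning

variable {Φ : Type*} [Field Φ] {A : Type*} [NonUnitalNonAssocRing A] [Module Φ A]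
  {ι : Type*} {v : ι → A} {x : A} {U : Set A}

/-- Normal words with the same exponents are equal, and the normal words together with the
elements of `U` span the algebra. -/
def NormalSpanning (Φ : Type*) [Field Φ] {A : Type*} [NonUnitalNonAssocRing A] [Module Φ A]
    {ι : Type*} (U : Set A) (v : ι → A) (x : A) : Prop :=
  (∀ p a a', IsNormalWord v x p a → IsNormalWord v x p a' → a = a') ∧
    Submodule.span Φ (U ∪ {a | ∃ p, IsNormalWord v x p a}) = ⊤

/-- The span of the monomials in `v` and of `U`. -/
def monomialSpan (Φ : Type*) [Field Φ] {A : Type*} [NonUnitalNonAssocRing A] [Module Φ A]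
    {ι : Type*} (U : Set A) (v : ι → A) : Submodule Φ A :=
  Submodule.span Φ (U ∪ {a | ∃ m, IsMonomial v m a})

theorem monomialSpan_le :
    monomialSpan Φ U v ≤ Submodule.span Φ (U ∪ {a | ∃ p, IsNormalWord v x p a}) :=
  Submodule.span_mono <| Set.union_subset_union_right _ fun _ ⟨m, h⟩ => ⟨(m, 0), .even h⟩

theorem mem_monomialSpan (i : ι) : v i ∈ monomialSpan Φ U v :=
  Submodule.subset_span (Or.inr ⟨_, .var i⟩)

variable [IsScalarTower Φ A A] [SMulCommClass Φ A A]

/-- The elements of `U` act as two-sided units. In the applications `U` is empty, or consists of the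
unit of `F_1`. -/
theorem mul_mem_monomialSpan (hU : ∀ u ∈ U, ∀ a, u * a = a ∧ a * u = a) {a b : A}
    (ha : a ∈ monomialSpan Φ U v) (hb : b ∈ monomialSpan Φ U v) :
    a * b ∈ monomialSpan Φ U v := by
  have hb' := hb
  induction ha, hb using Submodule.span_induction₂ with
  | mem_mem a b ha hb =>
    rcases ha with ha | ⟨m, ha⟩
    · rw [(hU a ha b).1]
      exact Submodule.subset_span hb
    · rcases hb with hb | ⟨n, hb⟩
      · rw [(hU b hb a).2]
        exact Submodule.subset_span (Or.inr ⟨m, ha⟩)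
      · exact Submodule.subset_span (Or.inr ⟨_, ha.mul hb⟩)
  | zero_left => simp
  | zero_right => simp
  | add_left _ _ _ _ _ _ h₁ h₂ => rw [add_mul]; exact add_mem (h₁ hb') (h₂ hb')
  | add_right b c a _ hb hc h₁ h₂ => rw [mul_add]; exact add_mem (h₁ ‹_›) (h₂ ‹_›)
  | smul_left r _ _ _ _ h => rw [smul_mul_assoc]; exact Submodule.smul_mem _ r (h hb')
  | smul_right r _ _ _ _ h => rw [mul_smul_comm]; exact Submodule.smul_mem _ r (h ‹_›)

omit [SMulCommClass Φ A A] in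
theorem mul_mem_span_isNormalWord (hU : ∀ u ∈ U, ∀ a, u * a = a ∧ a * u = a) {a : A}
    (ha : a ∈ monomialSpan Φ U v) :
    a * x ∈ Submodule.span Φ (U ∪ {a | ∃ p, IsNormalWord v x p a}) := by
  induction ha using Submodule.span_induction with
  | mem a ha =>
    rcases ha with ha | ⟨m, ha⟩
    · rw [(hU a ha x).1]
      exact Submodule.subset_span (Or.inr ⟨_, .gen⟩)
    · exact Submodule.subset_span (Or.inr ⟨_, .odd ha⟩)
  | zero => simp
  | add _ _ _ _ h₁ h₂ => rw [add_mul]; exact add_mem h₁ h₂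
  | smul r _ _ h => rw [smul_mul_assoc]; exact Submodule.smul_mem _ r h

variable {B : Type*} [NonUnitalNonAssocRing B] [Module Φ B] [IsScalarTower Φ B B]
  [SMulCommClass Φ B B]

omit [IsScalarTower Φ A A] [SMulCommClass Φ A A] in
/-- Transfer of normal spanning families along a homomorphism. -/
theorem NormalSpanning.of_hom (h : NormalSpanning Φ ∅ v x) (q : A →ₙₐ[Φ] B) {U : Set B}
    (hU : ∀ u ∈ U, ∀ b, u * b = b ∧ b * u = b)
    (hq : ∀ b, b ∈ Submodule.span Φ U ⊔ LinearMap.range (q : A →ₗ[Φ] B))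
    {κ : Type*} {w : κ → B} (j : κ → ι) (hw : w = q ∘ v ∘ j)
    (hv : ∀ i, q (v i) ∈ monomialSpan Φ U w) : NormalSpanning Φ U w (q x) := by
  refine ⟨fun p b b' hb hb' => ?_, ?_⟩
  · subst hw
    -- Words in the images lift to words in `v`, reindexed along `j`, and there equal exponents
    -- already force equality.
    obtain ⟨a, ha, rfl⟩ := IsNormalWord.exists_of_map (q : A →ₙ* B) hb
    obtain ⟨a', ha', rfl⟩ := IsNormalWord.exists_of_map (q : A →ₙ* B) hb'
    rw [h.1 _ _ _ (ha.of_comp j) (ha'.of_comp j)]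
  · refine eq_top_iff.2 fun b _ => ?_
    refine (sup_le (Submodule.span_mono Set.subset_union_left) ?_ :
      Submodule.span Φ U ⊔ LinearMap.range (q : A →ₗ[Φ] B) ≤ _) (hq b)
    rw [LinearMap.range_eq_map, ← h.2, Submodule.map_span, Submodule.span_le]
    rintro _ ⟨a, ha | ⟨p, ha⟩, rfl⟩
    · exact absurd ha (Set.notMem_empty a)
    -- The images of all generators, including those outside the range of `j`, lie in a subspace
    -- closed under multiplication.
    · have hmon : ∀ m a, IsMonomial v m a → q a ∈ monomialSpan Φ U w := fun m a ha =>
        (ha.map (q : A →ₙ* B)).mem (S := monomialSpan Φ U w) hv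
          fun _ h₁ _ h₂ => mul_mem_monomialSpan hU h₁ h₂
      cases ha with
      | even ha => exact monomialSpan_le (hmon _ _ ha)
      | gen => exact Submodule.subset_span (Or.inr ⟨_, .gen⟩)
      | odd ha =>
        change q (_ * x) ∈ _
        rw [map_mul]
        exact mul_mem_span_isNormalWord hU (hmon _ _ ha)

end Spanning

/-! ## Bases from homomorphisms to superalgebras of vector type -/

section Bases

open MvPolynomial

variable {Φ : Type*} [Field Φ] {A : Type*} [NonUnitalNonAssocRing A] [Module Φ A]
  {ι σ : Type*} {v : ι → A} {x : A}

variable {D : Derivation Φ (MvPolynomial σ Φ) (MvPolynomial σ Φ)} {γ : MvPolynomial σ Φ}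

/-- The image of a normal word in a superalgebra of vector type. -/
def wordImage (D : Derivation Φ (MvPolynomial σ Φ) (MvPolynomial σ Φ)) (γ : MvPolynomial σ Φ)
    (e : ι ≃ σ) (c : ι → Φ) (p : (ι →₀ ℕ) × Fin 2) : VectorType D γ :=
  if p.2 = 0 then .ev D γ (monomial (p.1.mapDomain e) (p.1.prod fun i n => c i ^ n))
  else .bar D γ (monomial (p.1.mapDomain e) (p.1.prod fun i n => c i ^ n))

theorem map_isMonomial {f : A →ₙₐ[Φ] VectorType D γ} {e : ι ≃ σ} {c : ι → Φ}
    (hv : ∀ i, f (v i) = .ev D γ (monomial (Finsupp.single (e i) 1) (c i))) {m : ι →₀ ℕ} {a : A}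
    (h : IsMonomial v m a) :
    f a = .ev D γ (monomial (m.mapDomain e) (m.prod fun i n => c i ^ n)) := by
  induction h with
  | var i => rw [hv, Finsupp.mapDomain_single, Finsupp.prod_single_index (by simp), pow_one]
  | mul _ _ h₁ h₂ =>
    rw [map_mul, h₁, h₂, VectorType.ev_mul_ev, monomial_mul, Finsupp.mapDomain_add,
      Finsupp.prod_add_index' (fun _ => pow_zero _) fun _ _ _ => pow_add _ _ _]

theorem map_isNormalWord {f : A →ₙₐ[Φ] VectorType D γ} {e : ι ≃ σ} {c : ι → Φ}
    (hv : ∀ i, f (v i) = .ev D γ (monomial (Finsupp.single (e i) 1) (c i)))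
    (hx : f x = .bar D γ 1) {p : (ι →₀ ℕ) × Fin 2} {a : A} (h : IsNormalWord v x p a) :
    f a = wordImage D γ e c p := by
  cases h with
  | even h => rw [map_isMonomial hv h, wordImage, if_pos rfl]
  | gen =>
    rw [hx, wordImage, if_neg one_ne_zero, Finsupp.mapDomain_zero, Finsupp.prod_zero_index,
      monomial_zero', map_one]
  | odd h =>
    rw [map_mul, map_isMonomial hv h, hx, wordImage, if_neg one_ne_zero, VectorType.ev_mul_bar,
      mul_one]

theorem prod_pow_ne_zero {c : ι → Φ} (hc : ∀ i, c i ≠ 0) (m : ι →₀ ℕ) :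
    (m.prod fun i n => c i ^ n) ≠ 0 :=
  Finset.prod_ne_zero_iff.2 fun i _ => pow_ne_zero _ (hc i)

/-- Up to the nonzero scalars `∏ c i ^ m i`, these are the monomial basis of each of the two copies
of the polynomial ring. -/
theorem linearIndependent_wordImage (e : ι ≃ σ) {c : ι → Φ} (hc : ∀ i, c i ≠ 0) :
    LinearIndependent Φ (wordImage D γ e c) := by
  let b₀ : Module.Basis (ι →₀ ℕ) Φ (MvPolynomial σ Φ) :=
    ((basisMonomials σ Φ).reindex (Finsupp.domCongr e).symm.toEquiv).unitsSMul
      fun m => Units.mk0 _ (prod_pow_ne_zero hc m)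
  have hb₀ : ∀ m, b₀ m = monomial (m.mapDomain e) (m.prod fun i n => c i ^ n) := by
    intro m
    simp only [b₀, Module.Basis.unitsSMul_apply, Module.Basis.reindex_apply, Units.smul_mk0]
    rw [coe_basisMonomials, smul_monomial, smul_eq_mul, mul_one]
    congr 2
    exact Finsupp.equivMapDomain_eq_mapDomain e m
  let b₁ : Module.Basis ((ι →₀ ℕ) × Fin 2) Φ (MvPolynomial σ Φ × MvPolynomial σ Φ) :=
    (b₀.prod b₀).reindex
      (((Equiv.boolProdEquivSum _).symm.trans (finTwoEquiv.symm.prodCongr (.refl _))).trans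
        (Equiv.prodComm _ _))
  have hb₁ : wordImage D γ e c = b₁ := by
    funext ⟨m, ε⟩
    rcases Fin.exists_fin_two.1 ⟨ε, rfl⟩ with rfl | rfl
    · rw [wordImage, if_pos rfl, ← hb₀]
      simp [b₁, finTwoEquiv]
      rfl
    · rw [wordImage, if_neg one_ne_zero, ← hb₀]
      simp [b₁, finTwoEquiv]
      rfl
  rw [hb₁]
  exact b₁.linearIndependent

/-- Independence of the images makes a spanning family a basis; `f` then maps a basis to an
independent family and is injective. -/
theorem exists_basis_of_linearIndependent {κ V W : Type*} [AddCommGroup V] [Module Φ V]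
    [AddCommGroup W] [Module Φ W] (f : V →ₗ[Φ] W) (w : κ → V)
    (hs : Submodule.span Φ (Set.range w) = ⊤) (hi : LinearIndependent Φ (f ∘ w)) :
    (∃ b : Module.Basis κ Φ V, ⇑b = w) ∧ Function.Injective f := by
  let b := Module.Basis.mk (LinearIndependent.of_comp f hi) hs.ge
  have hb : ⇑b = w := Module.Basis.coe_mk _ _
  refine ⟨⟨b, hb⟩, (injective_iff_map_eq_zero f).2 fun a ha => ?_⟩
  have := linearIndependent_iff.1 hi (b.repr a) (by
    rw [← hb, ← Finsupp.apply_linearCombination, b.linearCombination_repr, ha])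
  rwa [map_eq_zero_iff _ b.repr.injective] at this

theorem hasNormalBasis_of_hom (f : A →ₙₐ[Φ] VectorType D γ) (h : NormalSpanning Φ ∅ v x)
    (e : ι ≃ σ) {c : ι → Φ} (hc : ∀ i, c i ≠ 0)
    (hv : ∀ i, f (v i) = .ev D γ (monomial (Finsupp.single (e i) 1) (c i)))
    (hx : f x = .bar D γ 1) : HasNormalBasis Φ v x ∧ Function.Injective f := by
  choose w hw using fun p : {p : (ι →₀ ℕ) × Fin 2 // p ≠ 0} => exists_isNormalWord v x p.2
  obtain ⟨⟨b, hb⟩, hf⟩ := exists_basis_of_linearIndependent (f : A →ₗ[Φ] VectorType D γ) w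
    (by
      rw [← h.2]
      congr 1
      rw [Set.empty_union]
      refine Set.Subset.antisymm ?_ ?_
      · rintro _ ⟨p, rfl⟩
        exact ⟨p, hw p⟩
      · rintro a ⟨p, ha⟩
        exact ⟨⟨p, ha.ne_zero⟩, h.1 _ _ _ (hw _) ha⟩)
    (by
      have hfw : ⇑(f : A →ₗ[Φ] VectorType D γ) ∘ w = wordImage D γ e c ∘ Subtype.val :=
        funext fun p => map_isNormalWord hv hx (hw p)
      rw [hfw]
      exact (linearIndependent_wordImage (D := D) (γ := γ) e hc).comp _ Subtype.val_injective)
  refine ⟨⟨b, fun p a => ?_⟩, hf⟩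
  rw [hb]
  exact ⟨h.1 _ _ _ (hw p), fun ha => ha ▸ hw p⟩

theorem hasUnitalNormalBasis_of_hom (f : A →ₙₐ[Φ] VectorType D γ) {one : A}
    (h : NormalSpanning Φ {one} v x) (e : ι ≃ σ) {c : ι → Φ} (hc : ∀ i, c i ≠ 0)
    (hv : ∀ i, f (v i) = .ev D γ (monomial (Finsupp.single (e i) 1) (c i)))
    (hx : f x = .bar D γ 1) (hone : f one = .ev D γ 1) :
    HasUnitalNormalBasis Φ one v x ∧ Function.Injective f := by
  choose w hw using fun p : {p : (ι →₀ ℕ) × Fin 2 // p ≠ 0} => exists_isNormalWord v x p.2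
  classical
  -- No normal word has exponent `(0, 0)`; the unit fills this place, and its image is the constant
  -- monomial.
  let w' : (ι →₀ ℕ) × Fin 2 → A := fun p => if hp : p = 0 then one else w ⟨p, hp⟩
  have hw' : ∀ p, p ≠ 0 → IsNormalWord v x p (w' p) := fun p hp => by
    simpa only [w', dif_neg hp] using hw ⟨p, hp⟩
  have hw'0 : w' 0 = one := by simp [w']
  obtain ⟨⟨b, hb⟩, hf⟩ := exists_basis_of_linearIndependent (f : A →ₗ[Φ] VectorType D γ) w'
    (by
      rw [← h.2]
      congr 1
      refine Set.Subset.antisymm ?_ ?_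
      · rintro _ ⟨p, rfl⟩
        rcases eq_or_ne p 0 with rfl | hp
        · exact Or.inl hw'0
        · exact Or.inr ⟨p, hw' p hp⟩
      · rintro a (rfl | ⟨p, ha⟩)
        · exact ⟨0, hw'0⟩
        · exact ⟨p, h.1 _ _ _ (hw' p ha.ne_zero) ha⟩)
    (by
      have hfw : ⇑(f : A →ₗ[Φ] VectorType D γ) ∘ w' = wordImage D γ e c := by
        funext p
        rcases eq_or_ne p 0 with rfl | hp
        · change f (w' 0) = _
          rw [hw'0, hone, wordImage, if_pos Prod.snd_zero, Prod.fst_zero, Finsupp.mapDomain_zero,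
            Finsupp.prod_zero_index, monomial_zero', map_one]
        · exact map_isNormalWord hv hx (hw' p hp)
      rw [hfw]
      exact linearIndependent_wordImage (D := D) (γ := γ) e hc)
  refine ⟨⟨b, by rw [hb, hw'0], fun p hp a => ?_⟩, hf⟩
  rw [hb]
  exact ⟨h.1 _ _ _ (hw' p hp), fun ha => ha ▸ hw' p hp⟩

/-- Images of normal words are, up to scalars, all nonconstant even monomials and all odd ones. The
constant term of the even part is the only obstruction. -/
theorem mem_range_of_hom (f : A →ₙₐ[Φ] VectorType D γ) (e : ι ≃ σ) {c : ι → Φ}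
    (hc : ∀ i, c i ≠ 0) (hv : ∀ i, f (v i) = .ev D γ (monomial (Finsupp.single (e i) 1) (c i)))
    (hx : f x = .bar D γ 1) (p : VectorType D γ)
    (hp : constantCoeff (VectorType.fstₗ D γ p) = 0) : ∃ a, f a = p := by
  let R := LinearMap.range (f : A →ₗ[Φ] VectorType D γ)
  have hword : ∀ q : (ι →₀ ℕ) × Fin 2, q ≠ 0 → wordImage D γ e c q ∈ R := fun q hq => by
    obtain ⟨a, ha⟩ := exists_isNormalWord v x hq
    exact ⟨a, map_isNormalWord hv hx ha⟩
  have hdom : ∀ n : σ →₀ ℕ, (n.mapDomain e.symm).mapDomain e = n := fun n => by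
    rw [← Finsupp.mapDomain_comp, Equiv.self_comp_symm, Finsupp.mapDomain_id]
  have hev : ∀ (n : σ →₀ ℕ) (r : Φ), n ≠ 0 → VectorType.ev D γ (monomial n r) ∈ R := by
    intro n r hn
    have hn' : ((n.mapDomain e.symm, 0) : (ι →₀ ℕ) × Fin 2) ≠ 0 := fun h => hn <| by
      have h₀ : n.mapDomain e.symm = 0 := congrArg Prod.fst h
      rw [← hdom n, h₀, Finsupp.mapDomain_zero]
    have := R.smul_mem (r * ((n.mapDomain e.symm).prod fun i n => c i ^ n)⁻¹) (hword _ hn')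
    rwa [wordImage, if_pos rfl, VectorType.smul_ev, smul_monomial, hdom, smul_eq_mul,
      inv_mul_cancel_right₀ (prod_pow_ne_zero hc _)] at this
  have hbar : ∀ (n : σ →₀ ℕ) (r : Φ), VectorType.bar D γ (monomial n r) ∈ R := by
    intro n r
    have := R.smul_mem (r * ((n.mapDomain e.symm).prod fun i n => c i ^ n)⁻¹)
      (hword (n.mapDomain e.symm, 1) fun h => one_ne_zero (congrArg Prod.snd h))
    rwa [wordImage, if_neg one_ne_zero, VectorType.smul_bar, smul_monomial, hdom, smul_eq_mul,
      inv_mul_cancel_right₀ (prod_pow_ne_zero hc _)] at this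
  change p ∈ R
  rw [VectorType.eq_ev_add_bar p]
  have key : ∀ s : MvPolynomial σ Φ, s = s.support.sum fun n => monomial n (coeff n s) := as_sum
  refine add_mem ?_ ?_
  · let evₗ : MvPolynomial σ Φ →+ VectorType D γ :=
      { toFun := .ev D γ, map_zero' := rfl, map_add' := fun a b => (VectorType.ev_add a b).symm }
    change evₗ _ ∈ R
    rw [key (VectorType.fstₗ D γ p), map_sum]
    refine sum_mem fun n hn => hev n _ ?_
    rintro rfl
    exact mem_support_iff.1 hn hp
  · let barₗ : MvPolynomial σ Φ →+ VectorType D γ :=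
      { toFun := .bar D γ, map_zero' := rfl, map_add' := fun a b => (VectorType.bar_add a b).symm }
    change barₗ _ ∈ R
    rw [key (VectorType.sndₗ D γ p), map_sum]
    exact sum_mem fun n _ => hbar n _

end Bases

/-! ## Normal words span strongly `(-1,1)`-superalgebras generated by an odd element and central
even elements -/

section Core

variable {Φ : Type*} [Field Φ] {A : Type*} [NonUnitalNonAssocRing A] [Module Φ A]

/-- The family of the elements `x² R_{x,x}^i` and `z R_{x,x}^j`. -/
def genFamily {Z : Type*} (x : A) (z : Z → A) : TZ Z → A :=
  Sum.elim (fun i => (opR x x)^[i] (x * x)) (fun p => (opR x x)^[p.2] (z p.1))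

variable [IsScalarTower Φ A A] [SMulCommClass Φ A A] {𝒜 : ZMod 2 → Submodule Φ A}
  {ι : Type*} {v : ι → A} {x : A}

/-- Monomials are computed inside the even centre, where multiplication is commutative and
associative, so only the exponents matter. -/
theorem isNormalWord_unique (hg : SuperGraded 𝒜) (h𝒜 : SuperMinusOneOne 𝒜) (h2 : (2 : Φ) ≠ 0)
    (h3 : (3 : Φ) ≠ 0) (hv : ∀ i, v i ∈ evenCenter 𝒜) (p : (ι →₀ ℕ) × Fin 2) (a a' : A)
    (h : IsNormalWord v x p a) (h' : IsNormalWord v x p a') : a = a' := by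
  let K := {k // k ∈ evenCenter 𝒜}
  let _ : CommSemigroup K :=
    { mul := fun k l => ⟨k * l, mul_mem_evenCenter hg h𝒜 h2 h3 k.2 l.2⟩
      mul_assoc := fun k l m =>
        Subtype.ext (sub_eq_zero.1 (associator_evenCenter_left hg h𝒜 h3 k.2 l.2 m))
      mul_comm := fun k l => Subtype.ext (k.2.2 l) }
  -- The centre is only a semigroup; an adjoined unit lets a monomial be written as a product over
  -- all indices, including zero exponents.
  let V : ι → WithOne K := fun i => ((⟨v i, hv i⟩ : K) : WithOne K)
  have key : ∀ m a, IsMonomial v m a →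
      ∃ k : K, k.1 = a ∧ (k : WithOne K) = m.prod fun i n => V i ^ n := by
    intro m a h
    induction h with
    | var i => exact ⟨⟨v i, hv i⟩, rfl, by rw [Finsupp.prod_single_index (by simp), pow_one]⟩
    | mul _ _ h₁ h₂ =>
      obtain ⟨k, rfl, hk⟩ := h₁
      obtain ⟨l, rfl, hl⟩ := h₂
      refine ⟨k * l, rfl, ?_⟩
      rw [WithOne.coe_mul, hk, hl,
        Finsupp.prod_add_index' (fun _ => pow_zero _) fun _ _ _ => pow_add _ _ _]
  have uniq : ∀ m a a', IsMonomial v m a → IsMonomial v m a' → a = a' := by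
    intro m a a' h h'
    obtain ⟨k, rfl, hk⟩ := key m a h
    obtain ⟨l, rfl, hl⟩ := key m a' h'
    rw [← hl, WithOne.coe_inj] at hk
    rw [hk]
  cases h with
  | even h =>
    cases h' with
    | even h' => exact uniq _ _ _ h h'
  | gen =>
    cases h' with
    | gen => rfl
    | odd h' => exact absurd rfl h'.ne_zero
  | odd h =>
    cases h' with
    | gen => exact absurd rfl h.ne_zero
    | odd h' => rw [uniq _ _ _ h h']

variable {Z : Type*} {z : Z → A}

/-- With `M` the span of the monomials, `M ∪ Mx ∪ {x}` is closed under multiplication: all products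
reduce to the action of `R_{x,x}` and of `x²` on `M`. It contains the generators, so it spans. -/
theorem normalSpanning_genFamily (hg : SuperGraded 𝒜) (h𝒜 : SuperMinusOneOne 𝒜)
    (h𝒜' : SuperCommCentral 𝒜) (h2 : (2 : Φ) ≠ 0) (h3 : (3 : Φ) ≠ 0) (hx : x ∈ 𝒜 1)
    (hz : ∀ i, z i ∈ evenCenter 𝒜)
    (htop : ∀ S : Submodule Φ A, x ∈ S → (∀ i, z i ∈ S) →
      (∀ a ∈ S, ∀ b ∈ S, a * b ∈ S) → S = ⊤) :
    NormalSpanning Φ ∅ (genFamily x z) x := by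
  have hxx := mul_self_mem_evenCenter hg hx h𝒜' h2
  have hiter : ∀ (n : ℕ) (k : A), k ∈ evenCenter 𝒜 → (opR x x)^[n] k ∈ evenCenter 𝒜 := by
    intro n k hk
    induction n with
    | zero => exact hk
    | succ n ih =>
      rw [Function.iterate_succ_apply']
      exact opR_mem_evenCenter hg h𝒜 hx h𝒜' h2 h3 ih
  have hv : ∀ i, genFamily x z i ∈ evenCenter 𝒜 := by
    rintro (i | p)
    · exact hiter i _ hxx
    · exact hiter p.2 _ (hz p.1)
  have hR : ∀ i, opR x x (genFamily x z i) ∈ monomialSpan Φ ∅ (genFamily x z) := by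
    rintro (i | p)
    · have := mem_monomialSpan (Φ := Φ) (U := ∅) (v := genFamily x z) (.inl (i + 1))
      rwa [genFamily, Sum.elim_inl, Function.iterate_succ_apply'] at this
    · have := mem_monomialSpan (Φ := Φ) (U := ∅) (v := genFamily x z) (.inr (p.1, p.2 + 1))
      rwa [genFamily, Sum.elim_inr, Function.iterate_succ_apply'] at this
  refine ⟨isNormalWord_unique hg h𝒜 h2 h3 hv, ?_⟩
  set M := monomialSpan Φ ∅ (genFamily x z) with hM
  have hU : ∀ u ∈ (∅ : Set A), ∀ a, u * a = a ∧ a * u = a := fun u hu => absurd hu id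
  have hmul : ∀ {a b}, a ∈ M → b ∈ M → a * b ∈ M := fun ha hb => mul_mem_monomialSpan hU ha hb
  have hmon : ∀ m a, IsMonomial (genFamily x z) m a → a ∈ evenCenter 𝒜 := fun m a ha =>
    ha.mem (S := evenCenter 𝒜) hv fun _ h₁ _ h₂ => mul_mem_evenCenter hg h𝒜 h2 h3 h₁ h₂
  have hMK : M ≤ evenCenter 𝒜 := by
    refine Submodule.span_le.2 ?_
    rintro a (ha | ⟨m, ha⟩)
    · exact absurd ha id
    · exact hmon m a ha
  have hmonM : ∀ m a, IsMonomial (genFamily x z) m a → a ∈ M := fun m a ha =>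
    Submodule.subset_span (Or.inr ⟨m, ha⟩)
  -- `R_{x,x}` shifts the generators of `M` and is a derivation, so it preserves `M`.
  have hMR : ∀ a ∈ M, opR x x a ∈ M := by
    intro a ha
    induction ha using Submodule.span_induction with
    | mem a ha =>
      rcases ha with ha | ⟨m, ha⟩
      · exact absurd ha id
      · induction ha with
        | var i => exact hR i
        | mul h₁ h₂ h₃ h₄ =>
          rw [opR_mul hg h𝒜 hx h3 (hmon _ _ h₁) (hmon _ _ h₂)]
          exact add_mem (hmul (hmonM _ _ h₁) h₄) (hmul (hmonM _ _ h₂) h₃)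
    | zero => simp [opR]
    | add a b _ _ ha hb =>
      have : opR x x (a + b) = opR x x a + opR x x b := by simp only [opR, add_mul]; abel
      rw [this]
      exact add_mem ha hb
    | smul r a _ ha =>
      have : opR x x (r • a) = r • opR x x a := by simp only [opR, smul_mul_assoc, smul_sub]
      rw [this]
      exact Submodule.smul_mem _ r ha
  have hxxM : x * x ∈ M := mem_monomialSpan (v := genFamily x z) (.inl 0)
  have hkxx : ∀ k ∈ M, k * x * x ∈ M := fun k hk => by
    have : k * x * x = opR x x k + k * (x * x) := by simp [opR]
    rw [this]
    exact add_mem (hMR k hk) (hmul hk hxxM)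
  have hxkx : ∀ k ∈ M, x * (k * x) ∈ M := fun k hk => by
    rw [← Submodule.smul_mem_iff _ h2, two_smul_mul_mul hg h𝒜 (hMK hk)]
    exact add_mem (hkxx k hk) (hmul hk hxxM)
  -- After doubling, the product of two odd words is expressed through products in `M` and elements
  -- `(kx)x`.
  have hkxlx : ∀ k ∈ M, ∀ l ∈ M, k * x * (l * x) ∈ M := fun k hk l hl => by
    rw [← Submodule.smul_mem_iff _ h2, two_smul_odd_mul_odd hg h𝒜 hx h3 (hMK hk) (hMK hl)]
    exact sub_mem (add_mem (hmul hk (hmul hl hxxM))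
      (Submodule.smul_mem _ _ (hkxx _ (hmul hk hl)))) (hmul hk (hkxx l hl))
  let T : Set A := {a | a ∈ M ∨ (∃ k ∈ M, a = k * x) ∨ a = x}
  have hT : ∀ a ∈ T, ∀ b ∈ T, a * b ∈ T := by
    rintro a (ha | ⟨k, hk, rfl⟩ | rfl) b (hb | ⟨l, hl, rfl⟩ | rfl)
    · exact Or.inl (hmul ha hb)
    · refine Or.inr (Or.inl ⟨a * l, hmul ha hl, ?_⟩)
      exact (sub_eq_zero.1 (associator_evenCenter_left hg h𝒜 h3 (hMK ha) (hMK hl) x)).symm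
    · exact Or.inr (Or.inl ⟨a, ha, rfl⟩)
    · refine Or.inr (Or.inl ⟨b * k, hmul hb hk, ?_⟩)
      rw [← (hMK hb).2]
      exact (sub_eq_zero.1 (associator_evenCenter_left hg h𝒜 h3 (hMK hb) (hMK hk) x)).symm
    · exact Or.inl (hkxlx k hk l hl)
    · exact Or.inl (hkxx k hk)
    · exact Or.inr (Or.inl ⟨b, hb, ((hMK hb).2 a).symm⟩)
    · exact Or.inl (hxkx l hl)
    · exact Or.inl hxxM
  have hS : Submodule.span Φ T = ⊤ := by
    refine htop _ (Submodule.subset_span (Or.inr (Or.inr rfl)))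
      (fun i => Submodule.subset_span (Or.inl (mem_monomialSpan (v := genFamily x z) (.inr (i, 0))))) fun a ha b hb => ?_
    induction ha, hb using Submodule.span_induction₂ with
    | mem_mem a b ha hb => exact Submodule.subset_span (hT a ha b hb)
    | zero_left => simp
    | zero_right => simp
    | add_left _ _ _ _ _ _ h₁ h₂ => rw [add_mul]; exact add_mem h₁ h₂
    | add_right _ _ _ _ _ _ h₁ h₂ => rw [mul_add]; exact add_mem h₁ h₂
    | smul_left r _ _ _ _ h => rw [smul_mul_assoc]; exact Submodule.smul_mem _ r h
    | smul_right r _ _ _ _ h => rw [mul_smul_comm]; exact Submodule.smul_mem _ r h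
  refine eq_top_iff.2 (hS ▸ Submodule.span_le.2 ?_)
  rintro a (ha | ⟨k, hk, rfl⟩ | rfl)
  · exact monomialSpan_le ha
  · exact mul_mem_span_isNormalWord hU hk
  · exact Submodule.subset_span (Or.inr ⟨_, .gen⟩)

end Core

/-! ## The superalgebras `F[Z;x]`, `F_t`, `F_0`, `F_1` -/

section Isomorphisms

open MvPolynomial

variable {Φ : Type*} [Field Φ]

section

variable {A B : Type*} [NonUnitalNonAssocRing A] [Module Φ A] [NonUnitalNonAssocRing B] [Module Φ B]

theorem map_opR_iterate (f : A →ₙₐ[Φ] B) (x u : A) (n : ℕ) :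
    f ((opR x x)^[n] u) = (opR (f x) (f x))^[n] (f u) := by
  induction n generalizing u with
  | zero => rfl
  | succ n ih =>
    rw [Function.iterate_succ_apply, Function.iterate_succ_apply, ih]
    simp only [opR, map_sub, map_mul]

theorem opR_zero (x : A) : opR x x 0 = 0 := by simp [opR]

theorem opR_iterate_eq_zero {x u : A} {n : ℕ} (h : (opR x x)^[n] u = 0) (k : ℕ) :
    (opR x x)^[k + n] u = 0 := by
  rw [Function.iterate_add_apply, h]
  exact Function.iterate_fixed (opR_zero x) k

theorem map_genFamily {Z : Type*} (f : A →ₙₐ[Φ] B) (x : A) (z : Z → A) (i : TZ Z) :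
    f (genFamily x z i) = genFamily (f x) (f ∘ z) i := by
  rcases i with i | p
  · simp only [genFamily, Sum.elim_inl, map_opR_iterate, map_mul]
  · simp only [genFamily, Sum.elim_inr, map_opR_iterate, Function.comp_apply]

end

/-- `(a × 1̄) × 1̄ = γa + 2D(a)`, while `a × (1̄ × 1̄) = γa`. This factor is the source of the
powers of `2` below and of one use of characteristic different from `2`. -/
theorem opR_bar_ev {Γ : Type*} [CommRing Γ] [Algebra Φ Γ] {D : Derivation Φ Γ Γ} {γ : Γ} (a : Γ) :
    opR (VectorType.bar D γ 1) (VectorType.bar D γ 1) (.ev D γ a) = .ev D γ (2 * D a) := by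
  simp only [opR, VectorType.ev_mul_bar, VectorType.bar_mul_bar, VectorType.ev_mul_ev,
    VectorType.ev_sub, mul_one, Derivation.map_one_eq_zero]
  congr 1
  ring

variable {σ : Type*} {D : Derivation Φ (MvPolynomial σ Φ) (MvPolynomial σ Φ)} {γ : MvPolynomial σ Φ}
  {A : Type*} [NonUnitalNonAssocRing A] [Module Φ A] {𝒜 : ZMod 2 → Submodule Φ A}
  {ι : Type*} {v : ι → A} {x : A}

theorem BZero.grading_inf (hD : ∀ a, constantCoeff (D a) = 0) (hγ : constantCoeff γ = 0) :
    BZero.grading D γ hD hγ 0 ⊓ BZero.grading D γ hD hγ 1 = ⊥ := by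
  rw [BZero.grading, BZero.grading, ← Submodule.comap_inf, VectorType.grading_inf,
    Submodule.comap_bot, Submodule.ker_subtype]

/-- Normal words are nonempty, so their even images have no constant term and `f` takes values in
`B_0`. Injectivity comes from independence of the images, surjectivity from `mem_range_of_hom`. -/
theorem exists_isSuperIso (hD : ∀ a, constantCoeff (D a) = 0) (hγ : constantCoeff γ = 0)
    (h𝒜 : SuperGraded 𝒜) (f : A →ₙₐ[Φ] VectorType D γ)
    (hf : ∀ i, ∀ a ∈ 𝒜 i, f a ∈ VectorType.grading D γ i) (h : NormalSpanning Φ ∅ v x)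
    (e : ι ≃ σ) {c : ι → Φ} (hc : ∀ i, c i ≠ 0)
    (hv : ∀ i, f (v i) = .ev D γ (monomial (Finsupp.single (e i) 1) (c i)))
    (hx : f x = .bar D γ 1) :
    ∃ g : A →ₙₐ[Φ] BZero D γ hD hγ, IsSuperIso 𝒜 (BZero.grading D γ hD hγ) g ∧
      ∀ a, (g a).1 = f a := by
  classical
  have hmem : ∀ a, f a ∈ BZero D γ hD hγ := by
    have : ∀ a ∈ Submodule.span Φ (∅ ∪ {a | ∃ p, IsNormalWord v x p a}),
        a ∈ (BZero D γ hD hγ).toSubmodule.comap (f : A →ₗ[Φ] VectorType D γ) := by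
      refine fun a ha => Submodule.span_le.2 ?_ ha
      rintro a (ha | ⟨p, ha⟩)
      · exact absurd ha id
      · change constantCoeff (VectorType.fstₗ D γ (f a)) = 0
        rw [map_isNormalWord hv hx ha, wordImage]
        split_ifs with hp
        · rw [VectorType.fst_ev, constantCoeff_monomial, if_neg]
          intro h0
          have h1 : p.1 = 0 := Finsupp.mapDomain_injective e.injective
            (h0.trans Finsupp.mapDomain_zero.symm)
          exact ha.ne_zero (Prod.ext h1 hp)
        · rw [VectorType.fst_bar, map_zero]
    exact fun a => this a (h.2 ▸ Submodule.mem_top)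
  let g : A →ₙₐ[Φ] BZero D γ hD hγ := NonUnitalAlgHom.codRestrict f _ hmem
  refine ⟨g, isSuperIso_of_bijective g (fun i a ha => hf i a ha) h𝒜.sup_eq_top
    (BZero.grading_inf hD hγ) ⟨fun a b hab => ?_, fun p => ?_⟩, fun a => rfl⟩
  · exact (hasNormalBasis_of_hom f h e hc hv hx).2 (congrArg Subtype.val hab)
  · obtain ⟨a, ha⟩ := mem_range_of_hom f e hc hv hx p.1 p.2
    exact ⟨a, Subtype.ext ha⟩

theorem shiftD_inl (Z : Type*) (i : ℕ) :
    shiftD Φ Z (X (Sum.inl i)) = X (Sum.inl (i + 1)) := by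
  rw [shiftD, mkDerivation_X, Sum.elim_inl]

theorem shiftD_inr (Z : Type*) (p : Z × ℕ) :
    shiftD Φ Z (X (Sum.inr p)) = X (Sum.inr (p.1, p.2 + 1)) := by
  rw [shiftD, mkDerivation_X, Sum.elim_inr]

/-- The coefficient `2^i` of `t_i` and of `z_i` in the images of `x² R_{x,x}^i`, `z R_{x,x}^i`. -/
def genCoeff (Φ : Type*) [Field Φ] {Z : Type*} : TZ Z → Φ :=
  Sum.elim (fun i => 2 ^ i) fun p => 2 ^ p.2

theorem genFamily_bar {Z : Type*} (i : TZ Z) :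
    genFamily (VectorType.bar (shiftD Φ Z) (X (Sum.inl 0)) 1)
      (fun z => .ev _ _ (X (Sum.inr (z, 0)))) i =
      .ev _ _ (monomial (Finsupp.single i 1) (genCoeff Φ i)) := by
  have key : ∀ i : TZ Z, monomial (Finsupp.single i 1) (genCoeff Φ i) = genCoeff Φ i • X i := by
    intro i
    rw [X, smul_monomial, smul_eq_mul, mul_one]
  rw [key]
  rcases i with i | ⟨z, j⟩
  · rw [genFamily, Sum.elim_inl, genCoeff, Sum.elim_inl]
    induction i with
    | zero => simp
    | succ i ih =>
      rw [Function.iterate_succ_apply', ih, opR_bar_ev, Derivation.map_smul, shiftD_inl, pow_succ]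
      congr 1
      simp only [smul_eq_C_mul, map_mul, map_pow, map_ofNat]
      ring
  · rw [genFamily, Sum.elim_inr, genCoeff, Sum.elim_inr]
    induction j with
    | zero => simp
    | succ j ih =>
      rw [Function.iterate_succ_apply', ih, opR_bar_ev, Derivation.map_smul, shiftD_inr, pow_succ]
      congr 1
      simp only [smul_eq_C_mul, map_mul, map_pow, map_ofNat]
      ring

theorem genCoeff_ne_zero (h2 : (2 : Φ) ≠ 0) {Z : Type*} (i : TZ Z) : genCoeff Φ i ≠ 0 := by
  rcases i with i | p
  · exact pow_ne_zero _ h2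
  · exact pow_ne_zero _ h2

end Isomorphisms

section Quotients

open MvPolynomial

variable {Φ : Type*} [Field Φ]

theorem FZx.exists_hom_vectorType {Γ : Type*} [CommRing Γ] [Algebra Φ Γ] {Z : Type*}
    (h2 : (2 : Φ) ≠ 0) (D : Derivation Φ Γ Γ) (γ : Γ) (z : Z → Γ) :
    ∃ f : FZx Φ Z →ₙₐ[Φ] VectorType D γ,
      (∀ i, ∀ a ∈ FZx.grading Φ Z i, f a ∈ VectorType.grading D γ i) ∧
      f (FZx.x Φ Z) = .bar D γ 1 ∧ ∀ i, f (FZx.z Φ i) = .ev D γ (z i) :=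
  FZx.exists_hom h2 VectorType.superMinusOneOne VectorType.superCommCentral
    VectorType.superGraded.mul_mem VectorType.grading_inf (VectorType.bar_mem 1)
    (fun i => .ev D γ (z i)) (fun _ => VectorType.ev_mem _) fun _ => VectorType.ev_mul_comm _

theorem FZx.normalSpanning (h2 : (2 : Φ) ≠ 0) (h3 : (3 : Φ) ≠ 0) (Z : Type*) :
    NormalSpanning Φ ∅ (genFamily (FZx.x Φ Z) (FZx.z Φ)) (FZx.x Φ Z) :=
  normalSpanning_genFamily FZx.superGraded FZx.superMinusOneOne FZx.superCommCentral h2 h3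
    FZx.x_mem (fun i => ⟨FZx.z_mem i, FZx.z_mul i⟩) FZx.eq_top

theorem FZx.isSuperIso_hasNormalBasis (h2 : (2 : Φ) ≠ 0) (h3 : (3 : Φ) ≠ 0) (Z : Type*) :
    (∃ f : FZx Φ Z →ₙₐ[Φ] BZero (shiftD Φ Z) (X (Sum.inl 0)) (constantCoeff_shiftD Φ Z)
        (constantCoeff_X Φ _),
      IsSuperIso (FZx.grading Φ Z) (BZero.grading _ _ _ _) f ∧
        (f (FZx.x Φ Z)).1 = VectorType.bar _ _ 1 ∧
        ∀ z : Z, (f (FZx.z Φ z)).1 = VectorType.ev _ _ (X (Sum.inr (z, 0)))) ∧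
    HasNormalBasis Φ (genFamily (FZx.x Φ Z) (FZx.z Φ)) (FZx.x Φ Z) := by
  obtain ⟨f, hf, hfx, hfz⟩ := FZx.exists_hom_vectorType (Z := Z) h2 (shiftD Φ Z) (X (Sum.inl 0))
    fun z => X (Sum.inr (z, 0))
  have hv : ∀ i, f (genFamily (FZx.x Φ Z) (FZx.z Φ) i) =
      .ev _ _ (monomial (Finsupp.single (Equiv.refl (TZ Z) i) 1) (genCoeff Φ i)) := by
    intro i
    rw [map_genFamily, hfx, show ⇑f ∘ FZx.z Φ = _ from funext hfz, genFamily_bar]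
    rfl
  have hs := FZx.normalSpanning (Φ := Φ) h2 h3 Z
  obtain ⟨g, hg, hgf⟩ := exists_isSuperIso (constantCoeff_shiftD Φ Z)
    (constantCoeff_X Φ (Sum.inl 0 : TZ Z)) FZx.superGraded f hf hs (Equiv.refl _)
    (genCoeff_ne_zero h2) hv hfx
  exact ⟨⟨g, hg, (hgf _).trans hfx, fun z => (hgf _).trans (hfz z)⟩,
    (hasNormalBasis_of_hom f hs (Equiv.refl _) (genCoeff_ne_zero h2) hv hfx).1⟩

theorem HasNormalBasis.reindex {A : Type*} [NonUnitalNonAssocRing A] [Module Φ A] {ι κ : Type*}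
    {v : ι → A} {x : A} (h : HasNormalBasis Φ v x) (e : κ ≃ ι) : HasNormalBasis Φ (v ∘ e) x := by
  obtain ⟨b, hb⟩ := h
  let E : {p : (κ →₀ ℕ) × Fin 2 // p ≠ 0} ≃ {p : (ι →₀ ℕ) × Fin 2 // p ≠ 0} :=
    (((Finsupp.domCongr e : (κ →₀ ℕ) ≃+ (ι →₀ ℕ)).prodCongr (AddEquiv.refl (Fin 2))).toEquiv).subtypeEquiv
      fun p => by
        rw [not_iff_not]
        exact (map_eq_zero_iff
          ((Finsupp.domCongr e : (κ →₀ ℕ) ≃+ (ι →₀ ℕ)).prodCongr (AddEquiv.refl (Fin 2)))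
          (AddEquiv.injective _)).symm
  refine ⟨b.reindex E.symm, fun p a => ?_⟩
  rw [Module.Basis.reindex_apply, Equiv.symm_symm, ← hb]
  have hE : (E p).1 = (p.1.1.mapDomain e, p.1.2) :=
    Prod.ext (Finsupp.equivMapDomain_eq_mapDomain e p.1.1) rfl
  rw [hE]
  refine ⟨fun h => h.of_comp e, fun h => ?_⟩
  have h' : IsNormalWord ((v ∘ e) ∘ e.symm) x (p.1.1.mapDomain e, p.1.2) a := by
    rwa [Function.comp_assoc, Equiv.self_comp_symm]
  have := h'.of_comp
  rwa [← Finsupp.mapDomain_comp, Equiv.symm_comp_self, Finsupp.mapDomain_id] at this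

theorem FZx.hasNormalBasis_unit (h2 : (2 : Φ) ≠ 0) (h3 : (3 : Φ) ≠ 0) :
    HasNormalBasis Φ (Sum.elim (fun i : ℕ => (opR (x₁ Φ) (x₁ Φ))^[i] (x₁ Φ * x₁ Φ))
      (fun j : ℕ => (opR (x₁ Φ) (x₁ Φ))^[j] (z₁ Φ))) (x₁ Φ) := by
  convert (FZx.isSuperIso_hasNormalBasis h2 h3 Unit).2.reindex
    (Equiv.sumCongr (Equiv.refl ℕ) (Equiv.punitProd ℕ).symm) using 1
  funext i
  rcases i with i | i <;> rfl

theorem associator_eq_opR {A : Type*} [NonUnitalNonAssocRing A] (u x : A) :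
    associator u x x = opR x x u := rfl

theorem sddz₃_X_zero : sddz₃ Φ (X 0) = 0 := by
  simp [sddz₃, pderiv_X]

theorem sddz₃_X_one : sddz₃ Φ (X 1) = X 2 := by
  simp [sddz₃, pderiv_X]

theorem sddz₃_X_two : sddz₃ Φ (X 2) = 0 := by
  simp [sddz₃, pderiv_X]

theorem sddz₂_X_zero : sddz₂ Φ (X 0) = X 1 := by
  simp [sddz₂, pderiv_X]

theorem sddz₂_X_one : sddz₂ Φ (X 1) = 0 := by
  simp [sddz₂, pderiv_X]

theorem two_mul_X {σ : Type*} (i : σ) :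
    2 * X i = (monomial (Finsupp.single i 1) 2 : MvPolynomial σ Φ) := by
  rw [X, two_mul, ← map_add, one_add_one_eq_two]

theorem opR_bar_ev_two_mul {Γ : Type*} [CommRing Γ] [Algebra Φ Γ] {D : Derivation Φ Γ Γ} {γ : Γ}
    (a : Γ) : opR (VectorType.bar D γ 1) (VectorType.bar D γ 1) (.ev D γ (2 * a)) =
      .ev D γ (4 * D a) := by
  rw [opR_bar_ev, two_mul a, map_add]
  congr 1
  ring

/-- If `f` annihilates `((z,x,x),x,x)`, then it sends `z R_{x,x}^j`, `j ≥ 2`, to zero. -/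
theorem map_genFamily_inr_eq_zero {A : Type*} [NonUnitalNonAssocRing A] [Module Φ A]
    (f : FZx Φ Unit →ₙₐ[Φ] A)
    (h : f (associator (associator (z₁ Φ) (x₁ Φ) (x₁ Φ)) (x₁ Φ) (x₁ Φ)) = 0) (j : ℕ) :
    f (genFamily (x₁ Φ) (FZx.z Φ) (Sum.inr ((), j + 2))) = 0 := by
  rw [map_genFamily, genFamily, Sum.elim_inr]
  refine opR_iterate_eq_zero ?_ j
  rw [associator_eq_opR, associator_eq_opR] at h
  rw [← h, Function.iterate_succ_apply, Function.iterate_one]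
  simp only [opR, map_sub, map_mul, Function.comp_apply]

/-! ### The superalgebra `F_t` -/

/-- The evaluation in `B(Φ[t,z,s], s d/dz, t)` factors through the quotient. Of the generators
spanning `F[z;x]` only `x²`, `z` and `zR_{x,x}` survive, and they map to `t`, `z` and `2s`. -/
theorem FT.isSuperIso_hasNormalBasis (h2 : (2 : Φ) ≠ 0) (h3 : (3 : Φ) ≠ 0) :
    (∃ f : FT Φ →ₙₐ[Φ] BZero (sddz₃ Φ) (X 0) (constantCoeff_sddz₃ Φ) (constantCoeff_X Φ _),
      IsSuperIso (FT.grading Φ) (BZero.grading _ _ _ _) f ∧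
        (f (FT.x Φ)).1 = VectorType.bar _ _ 1 ∧
        (f (FT.z Φ)).1 = VectorType.ev _ _ (X 1)) ∧
    HasNormalBasis Φ ![FT.x Φ * FT.x Φ, FT.z Φ, opR (FT.x Φ) (FT.x Φ) (FT.z Φ)] (FT.x Φ) := by
  obtain ⟨f₀, hf₀, hfx, hfz⟩ := FZx.exists_hom_vectorType (Z := Unit) h2 (sddz₃ Φ) (X 0)
    fun _ => X 1
  -- The two relations hold in the model because `D t = 0` and `D s = 0`.
  have hle : (idealT Φ).toSubmodule ≤ (AlgIdeal.ker f₀).toSubmodule := by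
    refine AlgIdeal.span_le ?_
    rintro _ (rfl | rfl) <;> rw [AlgIdeal.mem_ker]
    · rw [map_associator_of_hom, map_mul, hfx, VectorType.bar_mul_bar, associator_eq_opR, opR_bar_ev]
      simp [sddz₃_X_zero, VectorType.ev_zero]
    · rw [map_associator_of_hom, map_associator_of_hom, hfx, hfz, associator_eq_opR,
        associator_eq_opR, opR_bar_ev, opR_bar_ev_two_mul]
      simp [sddz₃_X_one, sddz₃_X_two, VectorType.ev_zero]
  let f := (idealT Φ).lift f₀ hle
  let q := (idealT Φ).mkHom
  let w : Fin 3 → FT Φ := ![FT.x Φ * FT.x Φ, FT.z Φ, opR (FT.x Φ) (FT.x Φ) (FT.z Φ)]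
  have hq : ∀ {a}, a ∈ (idealT Φ).toSubmodule → q a = 0 := fun ha =>
    (AlgIdeal.mkₗ_eq_zero_iff _).2 ha
  have hs : NormalSpanning Φ ∅ w (FT.x Φ) := by
    refine (FZx.normalSpanning (Φ := Φ) h2 h3 Unit).of_hom q (fun u hu => absurd hu id)
      (fun b => ?_) ![.inl 0, .inr ((), 0), .inr ((), 1)] ?_ ?_
    · obtain ⟨a, rfl⟩ := (idealT Φ).mkₗ_surjective b
      exact Submodule.mem_sup_right ⟨a, rfl⟩
    · funext i
      fin_cases i <;> rfl
    · rintro ((_ | i) | ⟨⟨⟩, (_ | _ | j)⟩)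
      · exact mem_monomialSpan (v := w) 0
      -- `x²R_{x,x}` is the relator `(x²,x,x)`, so all its further iterates vanish too.
      · have : q (genFamily (x₁ Φ) (FZx.z Φ) (Sum.inl (i + 1))) = 0 := by
          rw [map_genFamily, genFamily, Sum.elim_inl]
          refine opR_iterate_eq_zero ?_ i
          rw [← map_mul, ← map_opR_iterate]
          exact hq (AlgIdeal.subset_span (Or.inl rfl))
        rw [this]
        exact zero_mem _
      · exact mem_monomialSpan (v := w) 1
      · exact mem_monomialSpan (v := w) 2
      · rw [map_genFamily_inr_eq_zero q (hq (AlgIdeal.subset_span (Or.inr rfl)))]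
        exact zero_mem _
  have hc : ∀ i, (![1, 1, 2] : Fin 3 → Φ) i ≠ 0 := by
    intro i
    fin_cases i
    exacts [one_ne_zero, one_ne_zero, h2]
  have hfx' : f (FT.x Φ) = .bar _ _ 1 := hfx
  have hfz' : f (FT.z Φ) = .ev _ _ (X 1) := hfz ()
  have hR : f (opR (FT.x Φ) (FT.x Φ) (FT.z Φ)) = .ev _ _ (monomial (Finsupp.single 2 1) 2) := by
    rw [← Function.iterate_one (opR (FT.x Φ) (FT.x Φ)), map_opR_iterate, hfx', hfz',
      Function.iterate_one, opR_bar_ev, sddz₃_X_one, two_mul_X]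
  have hv : ∀ i, f (w i) = .ev _ _ (monomial (Finsupp.single (Equiv.refl (Fin 3) i) 1)
      ((![1, 1, 2] : Fin 3 → Φ) i)) := by
    intro i
    fin_cases i
    · change f (FT.x Φ * FT.x Φ) = .ev _ _ (X 0)
      rw [map_mul, hfx', VectorType.bar_mul_bar]
      simp
    · exact hfz'
    · exact hR
  obtain ⟨g, hg, hgf⟩ := exists_isSuperIso (constantCoeff_sddz₃ Φ) (constantCoeff_X Φ 0)
    (FZx.superGraded.quotient (idealT Φ)) f (by rintro i _ ⟨a, ha, rfl⟩; exact hf₀ i a ha) hs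
    (Equiv.refl _) hc hv hfx'
  exact ⟨⟨g, hg, (hgf _).trans hfx', (hgf _).trans hfz'⟩,
    (hasNormalBasis_of_hom f hs (Equiv.refl _) hc hv hfx').1⟩

/-! ### The superalgebra `F_0` -/

/-- With `γ = 0` the square of `1̄` is zero, so the variable `t` disappears from the model. -/
theorem FZero.isSuperIso_hasNormalBasis (h2 : (2 : Φ) ≠ 0) (h3 : (3 : Φ) ≠ 0) :
    (∃ f : FZero Φ →ₙₐ[Φ] BZero (sddz₂ Φ) 0 (constantCoeff_sddz₂ Φ) (map_zero constantCoeff),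
      IsSuperIso (FZero.grading Φ) (BZero.grading _ _ _ _) f ∧
        (f (FZero.x Φ)).1 = VectorType.bar _ _ 1 ∧
        (f (FZero.z Φ)).1 = VectorType.ev _ _ (X 0)) ∧
    HasNormalBasis Φ ![FZero.z Φ, opR (FZero.x Φ) (FZero.x Φ) (FZero.z Φ)] (FZero.x Φ) := by
  obtain ⟨f₀, hf₀, hfx, hfz⟩ := FZx.exists_hom_vectorType (Z := Unit) h2 (sddz₂ Φ) 0
    fun _ => X 0
  have hle : (idealZero Φ).toSubmodule ≤ (AlgIdeal.ker f₀).toSubmodule := by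
    refine AlgIdeal.span_le ?_
    rintro _ (rfl | rfl) <;> rw [AlgIdeal.mem_ker]
    · rw [map_mul, hfx, VectorType.bar_mul_bar]
      simp [VectorType.ev_zero]
    · rw [map_associator_of_hom, map_associator_of_hom, hfx, hfz, associator_eq_opR,
        associator_eq_opR, opR_bar_ev, opR_bar_ev_two_mul]
      simp [sddz₂_X_zero, sddz₂_X_one, VectorType.ev_zero]
  let f := (idealZero Φ).lift f₀ hle
  let q := (idealZero Φ).mkHom
  let w : Fin 2 → FZero Φ := ![FZero.z Φ, opR (FZero.x Φ) (FZero.x Φ) (FZero.z Φ)]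
  have hq : ∀ {a}, a ∈ (idealZero Φ).toSubmodule → q a = 0 := fun ha =>
    (AlgIdeal.mkₗ_eq_zero_iff _).2 ha
  have hs : NormalSpanning Φ ∅ w (FZero.x Φ) := by
    refine (FZx.normalSpanning (Φ := Φ) h2 h3 Unit).of_hom q (fun u hu => absurd hu id)
      (fun b => ?_) ![.inr ((), 0), .inr ((), 1)] ?_ ?_
    · obtain ⟨a, rfl⟩ := (idealZero Φ).mkₗ_surjective b
      exact Submodule.mem_sup_right ⟨a, rfl⟩
    · funext i
      fin_cases i <;> rfl
    · rintro (i | ⟨⟨⟩, (_ | _ | j)⟩)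
      · have : q (genFamily (x₁ Φ) (FZx.z Φ) (Sum.inl i)) = 0 := by
          rw [map_genFamily, genFamily, Sum.elim_inl]
          -- Here `x²` itself is a relator, so the whole family of its iterates vanishes, from
          -- exponent zero on.
          refine opR_iterate_eq_zero (n := 0) ?_ i
          rw [← map_mul]
          exact hq (AlgIdeal.subset_span (Or.inl rfl))
        rw [this]
        exact zero_mem _
      · exact mem_monomialSpan (v := w) 0
      · exact mem_monomialSpan (v := w) 1
      · rw [map_genFamily_inr_eq_zero q (hq (AlgIdeal.subset_span (Or.inr rfl)))]
        exact zero_mem _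
  have hc : ∀ i, (![1, 2] : Fin 2 → Φ) i ≠ 0 := by
    intro i
    fin_cases i
    exacts [one_ne_zero, h2]
  have hfx' : f (FZero.x Φ) = .bar _ _ 1 := hfx
  have hfz' : f (FZero.z Φ) = .ev _ _ (X 0) := hfz ()
  have hR : f (opR (FZero.x Φ) (FZero.x Φ) (FZero.z Φ)) =
      .ev _ _ (monomial (Finsupp.single 1 1) 2) := by
    rw [← Function.iterate_one (opR (FZero.x Φ) (FZero.x Φ)), map_opR_iterate, hfx', hfz',
      Function.iterate_one, opR_bar_ev, sddz₂_X_zero, two_mul_X]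
  have hv : ∀ i, f (w i) = .ev _ _ (monomial (Finsupp.single (Equiv.refl (Fin 2) i) 1)
      ((![1, 2] : Fin 2 → Φ) i)) := by
    intro i
    fin_cases i
    · exact hfz'
    · exact hR
  obtain ⟨g, hg, hgf⟩ := exists_isSuperIso (constantCoeff_sddz₂ Φ) (map_zero constantCoeff)
    (FZx.superGraded.quotient (idealZero Φ)) f (by rintro i _ ⟨a, ha, rfl⟩; exact hf₀ i a ha) hs
    (Equiv.refl _) hc hv hfx'
  exact ⟨⟨g, hg, (hgf _).trans hfx', (hgf _).trans hfz'⟩,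
    (hasNormalBasis_of_hom f hs (Equiv.refl _) hc hv hfx').1⟩

/-! ### The superalgebra `F_1` -/

section Hull

variable {A : Type*} [NonUnitalNonAssocRing A] [Module Φ A]

variable (Φ A) in
/-- The embedding of an algebra into its unital hull. -/
def hullInr : A →ₙₐ[Φ] Unitization Φ A where
  toFun := Unitization.inr
  map_smul' := Unitization.inr_smul Φ
  map_zero' := Unitization.inr_zero Φ
  map_add' := Unitization.inr_add Φ
  map_mul' := Unitization.inr_mul Φ

/-- The extension of a homomorphism to a superalgebra of vector type to the unital hull. -/
def hullLift {Γ : Type*} [CommRing Γ] [Algebra Φ Γ] {D : Derivation Φ Γ Γ} {γ : Γ}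
    (f : A →ₙₐ[Φ] VectorType D γ) : Unitization Φ A →ₙₐ[Φ] VectorType D γ where
  toFun u := u.fst • .ev D γ 1 + f u.snd
  map_smul' r u := by simp [mul_smul, smul_add]
  map_zero' := by simp
  map_add' u v := by simp only [Unitization.fst_add, Unitization.snd_add, map_add, add_smul]; abel
  map_mul' u v := by
    have h₁ : ∀ p : VectorType D γ, .ev D γ 1 * p = p := fun p => by
      ext <;> simp [VectorType.fst_mul, VectorType.snd_mul]
    have h₂ : ∀ p : VectorType D γ, p * .ev D γ 1 = p := fun p => by
      rw [← VectorType.ev_mul_comm, h₁]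
    simp only [Unitization.fst_mul, Unitization.snd_mul, map_add, map_smul, map_mul, add_mul,
      mul_add, smul_mul_assoc, mul_smul_comm, h₁, h₂, mul_smul]
    module

theorem hullGrading_sup {𝒜 : ZMod 2 → Submodule Φ A} (h : 𝒜 0 ⊔ 𝒜 1 = ⊤) :
    hullGrading Φ 𝒜 0 ⊔ hullGrading Φ 𝒜 1 = ⊤ := by
  refine eq_top_iff.2 fun u _ => ?_
  have hu : u = u.fst • 1 + Unitization.inrHom Φ Φ A u.snd := by
    ext <;> simp
  have hs : u.snd ∈ 𝒜 0 ⊔ 𝒜 1 := h ▸ Submodule.mem_top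
  obtain ⟨a, ha, b, hb, hab⟩ := Submodule.mem_sup.1 hs
  rw [hu, ← hab, map_add, ← add_assoc]
  refine Submodule.add_mem_sup (add_mem ?_ ?_) ?_
  · refine Submodule.mem_sup_left ?_
    rw [if_pos rfl]
    exact Submodule.smul_mem _ _ (Submodule.mem_span_singleton_self _)
  · exact Submodule.mem_sup_right ⟨a, ha, rfl⟩
  · exact Submodule.mem_sup_right ⟨b, hb, rfl⟩

theorem hullLift_mem_grading {Γ : Type*} [CommRing Γ] [Algebra Φ Γ] {D : Derivation Φ Γ Γ} {γ : Γ}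
    {f : A →ₙₐ[Φ] VectorType D γ} {𝒜 : ZMod 2 → Submodule Φ A}
    (hf : ∀ i, ∀ a ∈ 𝒜 i, f a ∈ VectorType.grading D γ i) (i : ZMod 2) (u : Unitization Φ A)
    (hu : u ∈ hullGrading Φ 𝒜 i) : hullLift f u ∈ VectorType.grading D γ i := by
  obtain ⟨a, ha, _, ⟨b, hb, rfl⟩, rfl⟩ := Submodule.mem_sup.1 hu
  rw [map_add]
  refine add_mem ?_ ?_
  · split_ifs at ha with hi
    · obtain ⟨r, rfl⟩ := Submodule.mem_span_singleton.1 ha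
      have : hullLift f (r • 1) = r • .ev D γ 1 := by simp [hullLift]
      rw [this, hi]
      exact Submodule.smul_mem _ _ (VectorType.ev_mem 1)
    · rw [(Submodule.mem_bot Φ).1 ha, map_zero]
      exact zero_mem _
  · have : hullLift f (Unitization.inrHom Φ Φ A b) = f b := by simp [hullLift]
    rw [this]
    exact hf i b hb

end Hull

/-- The square of `x` becomes the unit, matching `γ = 1`. Hence the monomials are taken together
with `U = {1}`, and the target is all of `B`, constants included. -/
theorem FOne.isSuperIso_hasNormalBasis (h2 : (2 : Φ) ≠ 0) (h3 : (3 : Φ) ≠ 0) :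
    (∃ f : FOne Φ →ₙₐ[Φ] VectorType (sddz₂ Φ) 1,
      IsSuperIso (FOne.grading Φ) (VectorType.grading _ _) f ∧
        f (FOne.x Φ) = VectorType.bar _ _ 1 ∧ f (FOne.z Φ) = VectorType.ev _ _ (X 0)) ∧
    HasUnitalNormalBasis Φ (FOne.one Φ) ![FOne.z Φ, opR (FOne.x Φ) (FOne.x Φ) (FOne.z Φ)]
      (FOne.x Φ) := by
  obtain ⟨f₀, hf₀, hfx, hfz⟩ := FZx.exists_hom_vectorType (Z := Unit) h2 (sddz₂ Φ) 1
    fun _ => X 0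
  have hinr : ∀ a, hullLift f₀ (Unitization.inr a) = f₀ a := fun a => by simp [hullLift]
  have hone : hullLift f₀ 1 = .ev _ _ 1 := by simp [hullLift]
  have hle : (idealOne Φ).toSubmodule ≤ (AlgIdeal.ker (hullLift f₀)).toSubmodule := by
    refine AlgIdeal.span_le ?_
    rintro _ (rfl | rfl) <;> rw [AlgIdeal.mem_ker]
    · rw [map_sub, hinr, hone, map_mul, hfx, VectorType.bar_mul_bar]
      simp
    · rw [hinr, map_associator_of_hom, map_associator_of_hom, hfx, hfz, associator_eq_opR,
        associator_eq_opR, opR_bar_ev, opR_bar_ev_two_mul]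
      simp [sddz₂_X_zero, sddz₂_X_one, VectorType.ev_zero]
  let f := (idealOne Φ).lift (hullLift f₀) hle
  let q := (idealOne Φ).mkHom.comp (hullInr Φ (FZx Φ Unit))
  let w : Fin 2 → FOne Φ := ![FOne.z Φ, opR (FOne.x Φ) (FOne.x Φ) (FOne.z Φ)]
  have hU : ∀ u ∈ ({FOne.one Φ} : Set (FOne Φ)), ∀ b, u * b = b ∧ b * u = b := by
    rintro _ rfl b
    obtain ⟨b, rfl⟩ := (idealOne Φ).mkₗ_surjective b
    rw [FOne.one, ← AlgIdeal.mkₗ_mul, ← AlgIdeal.mkₗ_mul, one_mul, mul_one]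
    exact ⟨rfl, rfl⟩
  have hxx : FOne.x Φ * FOne.x Φ = FOne.one Φ := by
    rw [FOne.x, FOne.one, ← AlgIdeal.mkₗ_mul, AlgIdeal.mkₗ_eq_iff, ← Unitization.inr_mul]
    exact AlgIdeal.subset_span (Or.inl rfl)
  have hRz : q (genFamily (x₁ Φ) (FZx.z Φ) (Sum.inr ((), 1))) =
      opR (FOne.x Φ) (FOne.x Φ) (FOne.z Φ) := by
    rw [map_genFamily]
    rfl
  have hs : NormalSpanning Φ {FOne.one Φ} w (FOne.x Φ) := by
    refine (FZx.normalSpanning (Φ := Φ) h2 h3 Unit).of_hom q hU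
      (fun b => ?_) ![.inr ((), 0), .inr ((), 1)] ?_ ?_
    · obtain ⟨u, rfl⟩ := (idealOne Φ).mkₗ_surjective b
      have hu : u = u.fst • 1 + Unitization.inr u.snd := by
        ext <;> simp
      rw [hu, map_add, map_smul]
      exact Submodule.add_mem_sup
        (Submodule.smul_mem _ _ (Submodule.mem_span_singleton_self _)) ⟨u.snd, rfl⟩
    · funext i
      fin_cases i
      · rfl
      · exact hRz.symm
    · rintro ((_ | i) | ⟨⟨⟩, (_ | _ | j)⟩)
      · have : q (genFamily (x₁ Φ) (FZx.z Φ) (Sum.inl 0)) = FOne.one Φ := by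
          rw [map_genFamily]
          exact hxx
        rw [this]
        exact Submodule.subset_span (Or.inl rfl)
      · have : q (genFamily (x₁ Φ) (FZx.z Φ) (Sum.inl (i + 1))) = 0 := by
          rw [map_genFamily, genFamily, Sum.elim_inl]
          refine opR_iterate_eq_zero ?_ i
          change opR (FOne.x Φ) (FOne.x Φ) (FOne.x Φ * FOne.x Φ) = 0
          -- `1 R_{x,x} = (1x)x - 1(xx) = 0`.
          rw [hxx, opR, (hU _ rfl _).1, (hU _ rfl _).1, sub_self]
        rw [this]
        exact zero_mem _
      · exact mem_monomialSpan (v := w) 0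
      · exact hRz ▸ mem_monomialSpan (v := w) 1
      · rw [map_genFamily_inr_eq_zero q
          ((AlgIdeal.mkₗ_eq_zero_iff _).2 (AlgIdeal.subset_span (Or.inr rfl)))]
        exact zero_mem _
  have hc : ∀ i, (![1, 2] : Fin 2 → Φ) i ≠ 0 := by
    intro i
    fin_cases i
    exacts [one_ne_zero, h2]
  have hfx' : f (FOne.x Φ) = .bar _ _ 1 := (hinr _).trans hfx
  have hfz' : f (FOne.z Φ) = .ev _ _ (X 0) := (hinr _).trans (hfz ())
  have hR : f (opR (FOne.x Φ) (FOne.x Φ) (FOne.z Φ)) =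
      .ev _ _ (monomial (Finsupp.single 1 1) 2) := by
    rw [← Function.iterate_one (opR (FOne.x Φ) (FOne.x Φ)), map_opR_iterate, hfx', hfz',
      Function.iterate_one, opR_bar_ev, sddz₂_X_zero, two_mul_X]
  have hv : ∀ i, f (w i) = .ev _ _ (monomial (Finsupp.single (Equiv.refl (Fin 2) i) 1)
      ((![1, 2] : Fin 2 → Φ) i)) := by
    intro i
    fin_cases i
    · exact hfz'
    · exact hR
  obtain ⟨hb, hinj⟩ := hasUnitalNormalBasis_of_hom f hs (Equiv.refl _) hc hv hfx' hone
  refine ⟨⟨f, isSuperIso_of_bijective f ?_ ?_ VectorType.grading_inf ⟨hinj, fun p => ?_⟩, hfx',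
    hfz'⟩, hb⟩
  · rintro i _ ⟨a, ha, rfl⟩
    exact hullLift_mem_grading hf₀ i a ha
  · change (hullGrading Φ (FZx.grading Φ Unit) 0).map (idealOne Φ).mkₗ ⊔
      (hullGrading Φ (FZx.grading Φ Unit) 1).map (idealOne Φ).mkₗ = ⊤
    rw [← Submodule.map_sup, hullGrading_sup FZx.superGraded.sup_eq_top, Submodule.map_top,
      LinearMap.range_eq_top]
    exact (idealOne Φ).mkₗ_surjective
  -- Nonempty words reach everything except constants in the even part; a multiple of the unit
  -- supplies the constant term.
  · set r := constantCoeff (VectorType.fstₗ _ _ p) with hr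
    obtain ⟨a, ha⟩ := mem_range_of_hom f (Equiv.refl _) hc hv hfx' (p - r • .ev _ _ 1) (by
      rw [map_sub, map_sub, map_smul, VectorType.fst_ev, smul_eq_C_mul, mul_one, constantCoeff_C,
        ← hr, sub_self])
    exact ⟨a + r • FOne.one Φ, by rw [map_add, map_smul, ha]; exact (congrArg (_ + r • ·) hone).trans (sub_add_cancel _ _)⟩

end Quotients

/-! ## Annihilator extensions of superalgebras of vector type -/

section ExtensionProducts

variable {Φ : Type*} [Field Φ] {Γ : Type*} [CommRing Γ] [Algebra Φ Γ] {V : Type*}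
  [AddCommGroup V] [Module Φ V]

/-- The superidentities of `(-1,1)`-algebras for the products `S k a = k ā`, `T k a = ā k`,
`P k l = k l`, `Q a b = ā b̄` in an extension of the superalgebra `I ⊕ Γ̄ ⊆ B(Γ,D,γ)` by an ideal
that annihilates the algebra. -/
structure ExtensionProducts (I : Ideal Γ) (D : Derivation Φ Γ Γ) (γ : Γ)
    (S T P Q : Γ →ₗ[Φ] Γ →ₗ[Φ] V) : Prop where
  gamma_mem : γ ∈ I
  map_mem : ∀ a, D a ∈ I
  right_alt_ev_ev_bar : ∀ {k l : Γ}, k ∈ I → l ∈ I → ∀ a,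
    S (k * l) a + T l (k * a) = (2 : Φ) • S k (l * a)
  cyclic_ev_ev_bar : ∀ {k l : Γ}, k ∈ I → l ∈ I → ∀ a,
    (S - T) (k * l) a = (S - T) k (l * a) + (S - T) l (k * a)
  right_alt_bar_bar_bar : ∀ a b c,
    S (γ * (a * b) + (2 : Φ) • (D a * b) + a * D b) c -
        T (γ * (b * c) + (2 : Φ) • (D b * c) + b * D c) a =
      S (γ * (a * c) + (2 : Φ) • (D a * c) + a * D c) b -
        T (γ * (c * b) + (2 : Φ) • (D c * b) + c * D b) a
  cyclic_bar_bar_bar : ∀ a b c,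
    (S - T) (γ * (a * b) + (2 : Φ) • (D a * b) + a * D b) c +
      (S - T) (γ * (b * c) + (2 : Φ) • (D b * c) + b * D c) a +
      (S - T) (γ * (c * a) + (2 : Φ) • (D c * a) + c * D a) b = 0
  right_alt_ev_ev_ev : ∀ {k l m : Γ}, k ∈ I → l ∈ I → m ∈ I →
    (2 : Φ) • P k (l * m) = P (k * l) m + P (k * m) l
  cyclic_ev_ev_ev : ∀ {k l m : Γ}, k ∈ I → l ∈ I → m ∈ I →
    (P - P.flip) (k * l) m + (P - P.flip) (l * m) k + (P - P.flip) (m * k) l = 0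
  right_alt_bar_ev_bar : ∀ {k : Γ}, k ∈ I → ∀ a b,
    Q (k * a) b + P (γ * (a * b) + (2 : Φ) • (D a * b) + a * D b) k = (2 : Φ) • Q a (k * b)
  right_alt_ev_bar_bar : ∀ {k : Γ}, k ∈ I → ∀ a b,
    Q (k * a) b - P k (γ * (a * b) + (2 : Φ) • (D a * b) + a * D b) =
      Q (k * b) a - P k (γ * (b * a) + (2 : Φ) • (D b * a) + b * D a)

namespace ExtensionProducts

variable {I : Ideal Γ} {D : Derivation Φ Γ Γ} {γ : Γ} {S T P Q : Γ →ₗ[Φ] Γ →ₗ[Φ] V}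
  (h : ExtensionProducts I D γ S T P Q)
include h

/-! ### Even and odd elements commute -/

/-- Right alternativity for `k, l, ā` and for `l, k, ā` is a linear system for `S k (la)` and `S l
(ka)`, with `T` written as `S - (S - T)`. Its solution reduces `S` to a product in the first
argument, up to values of `S - T`. -/
theorem three_smul_left {k l : Γ} (hk : k ∈ I) (hl : l ∈ I) (a : Γ) :
    (3 : Φ) • S k (l * a) =
      (3 : Φ) • S (k * l) a - (S - T) k (l * a) - (2 : Φ) • (S - T) l (k * a) := by
  have h₁ := h.right_alt_ev_ev_bar hk hl a
  have h₂ := h.right_alt_ev_ev_bar hl hk a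
  rw [mul_comm l k] at h₂
  simp only [LinearMap.sub_apply]
  linear_combination (norm := module) (-2 : Φ) • h₁ - h₂

/-- `S k (lm)` is reduced to `S (klm) 1` directly and through `S (kl) m`. Comparing the results and
using the cyclic identity leaves only this term. -/
theorem odd_comm_mul_left {k l m : Γ} (hk : k ∈ I) (hl : l ∈ I) (hm : m ∈ I) :
    (S - T) (k * l) m = 0 := by
  have h₁ := h.three_smul_left hk (I.mul_mem_left l hm) 1
  have h₂ := h.three_smul_left (I.mul_mem_left k hl) hm 1
  have h₃ := h.three_smul_left hk hl m
  have h₄ := h.cyclic_ev_ev_bar hl hm k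
  simp only [mul_one, mul_assoc, mul_comm m k, mul_comm l k] at h₁ h₂ h₃ h₄ ⊢
  linear_combination (norm := module) -h₁ + h₂ + h₃ + (2 : Φ) • h₄

/-- By the preceding lemma and the cyclic identity, the three values with `k`, `l` or `m` as first
argument are pairwise opposite, so each is its own negative. -/
theorem odd_comm_mul_right (h2 : (2 : Φ) ≠ 0) {k l m : Γ} (hk : k ∈ I)
    (hl : l ∈ I) (hm : m ∈ I) : (S - T) k (l * m) = 0 := by
  have key : ∀ {k l m : Γ}, k ∈ I → l ∈ I → m ∈ I →
      (S - T) k (l * m) + (S - T) l (k * m) = 0 := fun hk hl hm => by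
    rw [← h.cyclic_ev_ev_bar hk hl, h.odd_comm_mul_left hk hl hm]
  have h₁ := key hk hl hm
  have h₂ := key hl hm hk
  have h₃ := key hm hk hl
  simp only [mul_comm m l, mul_comm m k, mul_comm l k] at h₁ h₂ h₃
  refine (smul_eq_zero_iff_right h2).1 ?_
  linear_combination (norm := module) h₁ - h₂ + h₃

/-- Let `X` be the left side and `Y` the same with `k` and `m` exchanged. Right alternativity for
`k̄, 1̄, m̄`, with `S` reduced by `three_smul_left`, gives `2X + 4Y = 0`. By symmetry `4X + 2Y = 0`,
whence `6X = 0`. -/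
theorem odd_comm_map (h2 : (2 : Φ) ≠ 0) (h3 : (3 : Φ) ≠ 0) {k m : Γ} (hk : k ∈ I) (hm : m ∈ I) :
    (S - T) (D k) m + (S - T) k (D m) = 0 := by
  have key : ∀ {k m : Γ}, k ∈ I → m ∈ I → (2 : Φ) • ((S - T) (D k) m + (S - T) k (D m)) +
      (4 : Φ) • ((S - T) (D m) k + (S - T) m (D k)) = 0 := by
    intro k m hk hm
    have h₁ := h.right_alt_bar_bar_bar k 1 m
    have h₂ := h.three_smul_left (I.mul_mem_right k h.gamma_mem) hm 1
    have h₃ := h.three_smul_left (h.map_mem k) hm 1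
    have h₄ := h.three_smul_left (h.map_mem m) hk 1
    have h₅ := h.odd_comm_mul_left h.gamma_mem hk hm
    have h₆ := h.odd_comm_mul_right h2 hm h.gamma_mem hk
    simp only [Derivation.map_one_eq_zero, mul_zero, zero_mul, smul_zero, add_zero, one_mul,
      mul_one, map_add, map_smul, LinearMap.add_apply, LinearMap.smul_apply] at h₁ h₂ h₃ h₄
    rw [h₅, h₆] at h₂
    rw [mul_comm (D m) k] at h₄
    rw [← mul_assoc] at h₁
    simp only [LinearMap.sub_apply] at h₁ h₂ h₃ h₄ ⊢
    linear_combination (norm := module) (-3 : Φ) • h₁ + h₂ + (2 : Φ) • h₃ + h₄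
  have h₁ := key hk hm
  have h₂ := key hm hk
  have h₀ : (2 * 3 : Φ) ≠ 0 := mul_ne_zero h2 h3
  refine (smul_eq_zero_iff_right h₀).1 ?_
  linear_combination (norm := module) (2 : Φ) • h₂ - h₁

theorem three_smul_odd_comm_map_one {m : Γ} (hm : m ∈ I) :
    (3 : Φ) • (S - T) (D m) 1 = -((S - T) γ m + (2 : Φ) • (S - T) m γ) := by
  have h₁ := h.right_alt_bar_bar_bar 1 1 m
  have h₂ := h.three_smul_left h.gamma_mem hm 1
  simp only [Derivation.map_one_eq_zero, mul_zero, zero_mul, smul_zero, add_zero, one_mul,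
    mul_one, map_add, map_smul, LinearMap.add_apply, LinearMap.smul_apply] at h₁ h₂
  simp only [LinearMap.sub_apply] at h₁ h₂ ⊢
  linear_combination (norm := module) (-3 : Φ) • h₁ + h₂

theorem odd_comm_gamma_one (h3 : (3 : Φ) ≠ 0) : (S - T) γ 1 = 0 := by
  have h₁ := h.cyclic_bar_bar_bar 1 1 1
  simp only [Derivation.map_one_eq_zero, mul_zero, smul_zero, add_zero, mul_one] at h₁
  refine (smul_eq_zero_iff_right h3).1 ?_
  linear_combination (norm := module) h₁

/-- The cyclic identity for `1̄, 1̄, m̄` involves `S - T` at `(γ, m)`, `(γm, 1)` and `(D m, 1)`. The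
last two are known in terms of `(γ, m)` and `(m, γ)`, and `(m, γ)` cancels. -/
theorem odd_comm_gamma (h2 : (2 : Φ) ≠ 0) {m : Γ} (hm : m ∈ I) : (S - T) γ m = 0 := by
  have h₁ := h.cyclic_bar_bar_bar 1 1 m
  have h₂ := h.cyclic_ev_ev_bar h.gamma_mem hm 1
  have h₃ := h.three_smul_odd_comm_map_one hm
  simp only [Derivation.map_one_eq_zero, mul_zero, zero_mul, smul_zero, add_zero, one_mul,
    mul_one, map_add, map_smul, LinearMap.add_apply, LinearMap.smul_apply] at h₁ h₂
  refine (smul_eq_zero_iff_right h2).1 ?_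
  linear_combination (norm := module) h₁ - (2 : Φ) • h₂ - h₃

/-- `D` is skew for `S - T` on `I`, so it can be moved from the first argument to the second until
only `γ` remains. -/
theorem odd_comm_iterate (h2 : (2 : Φ) ≠ 0) (h3 : (3 : Φ) ≠ 0) (i : ℕ) {m : Γ} (hm : m ∈ I) :
    (S - T) (D^[i] γ) m = 0 := by
  have hmem : ∀ i, D^[i] γ ∈ I := fun i => by
    cases i with
    | zero => exact h.gamma_mem
    | succ i => rw [Function.iterate_succ_apply']; exact h.map_mem _
  induction i generalizing m with
  | zero => exact h.odd_comm_gamma h2 hm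
  | succ i ih =>
    have := h.odd_comm_map h2 h3 (hmem i) hm
    rwa [ih (h.map_mem m), add_zero, ← Function.iterate_succ_apply' D] at this

theorem odd_comm_iterate_one (h2 : (2 : Φ) ≠ 0) (h3 : (3 : Φ) ≠ 0) (i : ℕ) :
    (S - T) (D^[i] γ) 1 = 0 := by
  cases i with
  | zero => exact h.odd_comm_gamma_one h3
  | succ i =>
    have hmem : D^[i] γ ∈ I := by
      cases i with
      | zero => exact h.gamma_mem
      | succ i => rw [Function.iterate_succ_apply']; exact h.map_mem _
    have := h.three_smul_odd_comm_map_one hmem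
    rw [h.odd_comm_gamma h2 hmem, h.odd_comm_iterate h2 h3 i h.gamma_mem, smul_zero, add_zero,
      neg_zero, ← Function.iterate_succ_apply' D] at this
    exact (smul_eq_zero.1 this).resolve_left h3

/-! ### Even elements commute with each other -/

/-- The values of `Q` are eliminated from the right alternative laws for `1̄, k, b̄`, for `1̄, kb,
1̄` and for `k, 1̄, b̄`. -/
theorem even_comm_map_add {k : Γ} (hk : k ∈ I) (b : Γ) :
    (P - P.flip) (D b) k + P (γ * b) k - P γ (k * b) = 0 := by
  have h₁ := h.right_alt_bar_ev_bar hk 1 b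
  have h₂ := h.right_alt_bar_ev_bar (I.mul_mem_right b hk) 1 1
  have h₃ := h.right_alt_ev_bar_bar hk 1 b
  simp only [Derivation.map_one_eq_zero, mul_zero, zero_mul, smul_zero, add_zero, one_mul,
    mul_one, map_add, map_smul, LinearMap.add_apply] at h₁ h₂ h₃
  simp only [LinearMap.sub_apply, LinearMap.flip_apply]
  linear_combination (norm := module) h₁ - h₂ - h₃

/-- `Q (ak) 1` is expressed through `P` by a formula that is not visibly symmetric in `a` and `k`;
symmetry of the left side and `even_comm_map_add` give the claim. -/
theorem gamma_mul_comm {a k : Γ} (ha : a ∈ I) (hk : k ∈ I) : P (γ * a) k = P (γ * k) a := by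
  have key : ∀ {a k : Γ}, a ∈ I → k ∈ I → Q (a * k) 1 =
      (2 : Φ) • P a (D k) + P (γ * a) k + (2 : Φ) • P (D a) k := by
    intro a k ha hk
    have h₁ := h.right_alt_bar_ev_bar hk a 1
    have h₂ := h.right_alt_ev_bar_bar ha 1 k
    simp only [Derivation.map_one_eq_zero, mul_zero, zero_mul, smul_zero, add_zero, one_mul,
      mul_one, map_add, map_smul, LinearMap.add_apply, LinearMap.smul_apply, mul_comm k a]
      at h₁ h₂
    linear_combination (norm := module) -h₁ - (2 : Φ) • h₂
  have h₁ := key ha hk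
  have h₂ := key hk ha
  have h₃ := h.even_comm_map_add hk a
  have h₄ := h.even_comm_map_add ha k
  simp only [mul_comm k a] at h₂ h₃
  simp only [LinearMap.sub_apply, LinearMap.flip_apply] at h₃ h₄
  linear_combination (norm := module) h₁ - h₂ + (2 : Φ) • h₃ - (2 : Φ) • h₄

theorem gamma_mul (h2 : (2 : Φ) ≠ 0) {a k : Γ} (ha : a ∈ I) (hk : k ∈ I) :
    P (γ * a) k = P γ (a * k) := by
  have h₁ := h.right_alt_ev_ev_ev h.gamma_mem ha hk
  have h₂ := h.gamma_mul_comm ha hk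
  rw [← sub_eq_zero]
  refine (smul_eq_zero_iff_right h2).1 ?_
  linear_combination (norm := module) h₂ - h₁

/-- By `gamma_mul` the two terms with `γ` in `even_comm_map_add` cancel. -/
theorem even_comm_map (h2 : (2 : Φ) ≠ 0) {a k : Γ} (ha : a ∈ I) (hk : k ∈ I) :
    (P - P.flip) (D a) k = 0 := by
  have h₁ := h.even_comm_map_add hk a
  rwa [h.gamma_mul h2 ha hk, mul_comm a k, add_sub_cancel_right] at h₁

theorem even_comm_gamma_mul (h2 : (2 : Φ) ≠ 0) {a k : Γ} (ha : a ∈ I) (hk : k ∈ I) :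
    (P - P.flip) γ (a * k) = (2 : Φ) • (P - P.flip) (γ * k) a := by
  have h₁ := h.right_alt_ev_ev_ev ha h.gamma_mem hk
  have h₂ := h.gamma_mul h2 ha hk
  have h₃ := h.gamma_mul h2 hk ha
  simp only [mul_comm a γ, mul_comm k a] at h₁ h₃
  simp only [LinearMap.sub_apply, LinearMap.flip_apply]
  linear_combination (norm := module) h₁ + h₂ - (2 : Φ) • h₃

/-- If `k` commutes with `I`, one term of the cyclic identity drops out and the factor `k` moves
across the commutator. -/
theorem even_comm_swap {k l m : Γ} (hk : k ∈ I) (hl : l ∈ I) (hm : m ∈ I)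
    (h₀ : ∀ {m}, m ∈ I → (P - P.flip) k m = 0) :
    (P - P.flip) (k * l) m = (P - P.flip) l (m * k) := by
  have h₁ := h.cyclic_ev_ev_ev hk hl hm
  have h₂ := h₀ (I.mul_mem_left l hm)
  simp only [LinearMap.sub_apply, LinearMap.flip_apply] at h₁ h₂ ⊢
  linear_combination (norm := module) h₁ + h₂

end ExtensionProducts

/-- Induction for polynomials without constant term. -/
theorem constantCoeff_eq_zero_induction {σ : Type*} {p : MvPolynomial σ Φ → Prop}
    (h0 : p 0) (hX : ∀ i, p (MvPolynomial.X i))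
    (hmul : ∀ i a, MvPolynomial.constantCoeff a = 0 → p a → p (MvPolynomial.X i * a))
    (hadd : ∀ a b, p a → p b → p (a + b)) (hsmul : ∀ (r : Φ) a, p a → p (r • a))
    {a : MvPolynomial σ Φ} (ha : MvPolynomial.constantCoeff a = 0) : p a := by
  have key : ∀ a : MvPolynomial σ Φ,
      p (a - MvPolynomial.C (MvPolynomial.constantCoeff a)) := by
    intro a
    induction a using MvPolynomial.induction_on with
    | C r => simpa using h0
    | add a b ha hb =>
      have := hadd _ _ ha hb
      rwa [← add_sub_add_comm, ← map_add, ← map_add] at this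
    | mul_X a i ha =>
      have := hadd _ _ (hmul i _ (by simp) ha)
        (hsmul (MvPolynomial.constantCoeff a) _ (hX i))
      rw [MvPolynomial.smul_eq_C_mul] at this
      convert this using 1
      simp only [map_mul, MvPolynomial.constantCoeff_X, mul_zero, map_zero, sub_zero]
      ring
  simpa [ha] using key a

/-! ### Commutation in extensions of `B_0(Φ[t_0, t_1, …], D, t_0)`. -/

section Shift

variable {Z : Type*} [IsEmpty Z] {S T P Q : MvPolynomial (TZ Z) Φ →ₗ[Φ] MvPolynomial (TZ Z) Φ →ₗ[Φ] V}

open MvPolynomial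

theorem shiftD_iterate (Z : Type*) (i : ℕ) :
    (shiftD Φ Z)^[i] (X (Sum.inl 0)) = X (Sum.inl i) := by
  induction i with
  | zero => rfl
  | succ i ih => rw [Function.iterate_succ_apply', ih, shiftD_inl]

/-- The variables are the iterates `D^i γ`, for which the claim is known; the cyclic identity
carries it over to their products. -/
theorem ExtensionProducts.odd_comm
    (h : ExtensionProducts (RingHom.ker (constantCoeff (R := Φ))) (shiftD Φ Z) (X (Sum.inl 0)) S T P Q)
    (h2 : (2 : Φ) ≠ 0) (h3 : (3 : Φ) ≠ 0) {k : MvPolynomial (TZ Z) Φ} (hk : constantCoeff k = 0)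
    (a : MvPolynomial (TZ Z) Φ) : (S - T) k a = 0 := by
  have hX : ∀ i a, (S - T) (X i) a = 0 := by
    rintro (i | p) a
    -- The element `a` need not lie in the augmentation ideal; its constant part is covered by the
    -- case `a = 1`.
    · have ha : a - C (constantCoeff a) ∈ RingHom.ker (constantCoeff (R := Φ)) := by
        simp [RingHom.mem_ker]
      have h₁ := h.odd_comm_iterate h2 h3 i ha
      have h₂ := h.odd_comm_iterate_one h2 h3 i
      rw [shiftD_iterate] at h₁ h₂
      rw [map_sub, ← mul_one (C _), ← smul_eq_C_mul, map_smul, h₂, smul_zero, sub_zero] at h₁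
      exact h₁
    · exact isEmptyElim p.1
  revert a
  refine constantCoeff_eq_zero_induction (p := fun k => ∀ a, (S - T) k a = 0) (by simp) hX ?_ ?_ ?_
    hk
  · intro i b hb ih a
    rw [h.cyclic_ev_ev_bar (constantCoeff_X Φ i) hb, ih, hX, add_zero]
  · intro b c hb hc a
    rw [map_add, LinearMap.add_apply, hb, hc, add_zero]
  · intro r b hb a
    rw [map_smul, LinearMap.smul_apply, hb, smul_zero]

/-- The variables `t_{i+1} = D t_i` commute with the augmentation ideal by `even_comm_map`. The
variable `t_0 = γ` needs a separate argument, after which `even_comm_swap` extends the claim to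
products. -/
theorem ExtensionProducts.even_comm
    (h : ExtensionProducts (RingHom.ker (constantCoeff (R := Φ))) (shiftD Φ Z) (X (Sum.inl 0)) S T P Q)
    (h2 : (2 : Φ) ≠ 0) (h3 : (3 : Φ) ≠ 0) {k : MvPolynomial (TZ Z) Φ} (hk : constantCoeff k = 0)
    {m : MvPolynomial (TZ Z) Φ} (hm : constantCoeff m = 0) : (P - P.flip) k m = 0 := by
  have hXmem : ∀ i : TZ Z, X i ∈ RingHom.ker (constantCoeff (R := Φ)) := fun i =>
    constantCoeff_X Φ i
  have hswap : ∀ a b, (P - P.flip) a b = -(P - P.flip) b a := fun a b => by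
    simp only [LinearMap.sub_apply, LinearMap.flip_apply, neg_sub]
  have hD : ∀ i {m}, m ∈ RingHom.ker (constantCoeff (R := Φ)) →
      (P - P.flip) (X (Sum.inl (i + 1))) m = 0 := fun i m hm => by
    rw [← shiftD_inl]
    exact h.even_comm_map h2 (hXmem _) hm
  have h₀ : ∀ {m}, constantCoeff m = 0 → (P - P.flip) (X (Sum.inl 0)) m = 0 := by
    intro m hm
    refine constantCoeff_eq_zero_induction (p := fun m => (P - P.flip) (X (Sum.inl 0)) m = 0)
      (by simp) ?_ ?_ ?_ ?_ hm
    · rintro ((_ | i) | p)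
      · simp
      · rw [hswap, hD i (hXmem _), neg_zero]
      · exact isEmptyElim p.1
    · rintro ((_ | i) | p) b hb ih
      -- With `w` the commutator of `t_0` and `t_0 b`, the relation reads `w = -2w`.
      · have h₁ := h.even_comm_gamma_mul h2 (hXmem (Sum.inl 0)) hb
        rw [hswap (_ * b)] at h₁
        refine (smul_eq_zero_iff_right h3).1 ?_
        linear_combination (norm := module) h₁
      · have h₁ := h.even_comm_gamma_mul h2 (hXmem (Sum.inl (i + 1))) hb
        rw [hswap (_ * b), hD i (Ideal.mul_mem_left _ _ hb), neg_zero, smul_zero] at h₁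
        exact h₁
      · exact isEmptyElim p.1
    · intro b c hb hc
      rw [map_add, hb, hc, add_zero]
    · intro r b hb
      rw [map_smul, hb, smul_zero]
  have hX : ∀ i {m}, m ∈ RingHom.ker (constantCoeff (R := Φ)) → (P - P.flip) (X i) m = 0 := by
    rintro ((_ | i) | p) m hm
    · exact h₀ hm
    · exact hD i hm
    · exact isEmptyElim p.1
  revert m
  refine constantCoeff_eq_zero_induction
    (p := fun k => ∀ {m}, constantCoeff m = 0 → (P - P.flip) k m = 0) (fun _ => by simp) hX ?_ ?_ ?_
    hk
  · intro i b hb ih m hm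
    rw [h.even_comm_swap (hXmem i) hb hm (hX i)]
    exact ih (Ideal.mul_mem_right _ (RingHom.ker _) hm)
  · intro b c hb hc m hm
    rw [map_add, LinearMap.add_apply, hb hm, hc hm, add_zero]
  · intro r b hb m hm
    rw [map_smul, LinearMap.smul_apply, hb hm, smul_zero]

end Shift

/-! ### Evenness implies centrality in the extension -/

section Extension

variable {E : Type*} [NonUnitalNonAssocRing E] [Module Φ E] [IsScalarTower Φ E E]
  [SMulCommClass Φ E E] {ℰ : ZMod 2 → Submodule Φ E}

namespace VectorType

variable (D : Derivation Φ Γ Γ) (γ : Γ)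

/-- The linear embedding of the even part. -/
def evₗ : Γ →ₗ[Φ] VectorType D γ where
  toFun := ev D γ
  map_add' a b := (ev_add a b).symm
  map_smul' r a := (smul_ev r a).symm

/-- The linear embedding of the odd part. -/
def barₗ : Γ →ₗ[Φ] VectorType D γ where
  toFun := bar D γ
  map_add' a b := (bar_add a b).symm
  map_smul' r a := (smul_bar r a).symm

end VectorType

/-- Since the kernel of `π` annihilates everything, a product depends only on the images of its
factors. All associators become bilinear expressions in the images, and each field below is a
superidentity at homogeneous lifts. -/
theorem exists_extensionProducts {I : Ideal Γ} {D : Derivation Φ Γ Γ} {γ : Γ} (hγ : γ ∈ I)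
    (hD : ∀ a, D a ∈ I) (hg : SuperGraded ℰ) (hℰ : SuperMinusOneOne ℰ)
    (π : E →ₙₐ[Φ] VectorType D γ) (hπ : ∀ i, ∀ a ∈ ℰ i, π a ∈ VectorType.grading D γ i)
    (hrange : ∀ p, VectorType.fstₗ D γ p ∈ I ↔ ∃ a, π a = p)
    (hker : ∀ a, π a = 0 → ∀ b, a * b = 0 ∧ b * a = 0) :
    ∃ S T P Q : Γ →ₗ[Φ] Γ →ₗ[Φ] E, ExtensionProducts I D γ S T P Q ∧
      (∀ u v k a, π u = .ev D γ k → π v = .bar D γ a → u * v = S k a ∧ v * u = T k a) ∧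
      (∀ u v k l, π u = .ev D γ k → π v = .ev D γ l → u * v = P k l) := by
  -- A linear section of `π` over its image, extended arbitrarily to the whole space.
  obtain ⟨s₀, hs₀⟩ := LinearMap.exists_rightInverse_of_surjective
    (π : E →ₗ[Φ] VectorType D γ).rangeRestrict (LinearMap.range_rangeRestrict _)
  obtain ⟨s, hs⟩ := LinearMap.exists_extend s₀
  have hπs : ∀ a, π (s (π a)) = π a := fun a => by
    have h₁ : s (π a) = s₀ ⟨π a, a, rfl⟩ := LinearMap.congr_fun hs ⟨π a, a, rfl⟩
    rw [h₁]
    exact congrArg Subtype.val (LinearMap.congr_fun hs₀ ⟨π a, a, rfl⟩)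
  -- The differences `u - s (π u)` and `v - s (π v)` lie in the kernel.
  have hmul : ∀ u v, u * v = s (π u) * s (π v) := by
    intro u v
    have h₁ := (hker (u - s (π u)) (by rw [map_sub, hπs, sub_self]) v).1
    have h₂ := (hker (v - s (π v)) (by rw [map_sub, hπs, sub_self]) (s (π u))).2
    rw [sub_mul, sub_eq_zero] at h₁
    rw [mul_sub, sub_eq_zero] at h₂
    rw [h₁, h₂]
  have hass : ∀ u v w, associator u v w =
      s (π u * π v) * s (π w) - s (π u) * s (π v * π w) := fun u v w => by
    rw [associator, hmul (u * v) w, hmul u (v * w), map_mul π, map_mul π]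
  have hev : ∀ {k}, k ∈ I → ∃ u ∈ ℰ 0, π u = .ev D γ k := by
    intro k hk
    obtain ⟨u, hu⟩ := (hrange (.ev D γ k)).1 hk
    obtain ⟨u₀, hu₀, u₁, hu₁, rfl⟩ := hg.exists_eq_add u
    rw [map_add] at hu
    refine ⟨u₀, hu₀, VectorType.ext ?_ ?_⟩
    · have h₁ := congrArg (VectorType.fstₗ D γ) hu
      rwa [map_add, show VectorType.fstₗ D γ (π u₁) = 0 from hπ 1 u₁ hu₁, add_zero] at h₁
    · exact hπ 0 u₀ hu₀
  have hbar : ∀ a, ∃ u ∈ ℰ 1, π u = .bar D γ a := by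
    intro a
    obtain ⟨u, hu⟩ := (hrange (.bar D γ a)).1 (zero_mem I)
    obtain ⟨u₀, hu₀, u₁, hu₁, rfl⟩ := hg.exists_eq_add u
    rw [map_add] at hu
    refine ⟨u₁, hu₁, VectorType.ext (hπ 1 u₁ hu₁) ?_⟩
    have h₁ := congrArg (VectorType.sndₗ D γ) hu
    rwa [map_add, show VectorType.sndₗ D γ (π u₀) = 0 from hπ 0 u₀ hu₀, zero_add] at h₁
  have h2mul : ∀ a b : Γ, 2 * D a * b = (2 : Φ) • (D a * b) := fun a b => by
    rw [two_smul, mul_assoc, two_mul]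
  let m (f g : Γ →ₗ[Φ] VectorType D γ) : Γ →ₗ[Φ] Γ →ₗ[Φ] E :=
    (LinearMap.mul Φ E).compl₁₂ (s ∘ₗ f) (s ∘ₗ g)
  have hm : ∀ f g k l, m f g k l = s (f k) * s (g l) := fun f g k l => rfl
  have hevₗ : ∀ k, VectorType.evₗ D γ k = .ev D γ k := fun k => rfl
  have hbarₗ : ∀ k, VectorType.barₗ D γ k = .bar D γ k := fun k => rfl
  refine ⟨m (VectorType.evₗ D γ) (VectorType.barₗ D γ), (m (VectorType.barₗ D γ) (VectorType.evₗ D γ)).flip, m (VectorType.evₗ D γ) (VectorType.evₗ D γ),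
    m (VectorType.barₗ D γ) (VectorType.barₗ D γ), ⟨hγ, hD, ?_, ?_, ?_, ?_, ?_, ?_, ?_, ?_⟩, ?_, ?_⟩
  · intro k l hk hl a
    obtain ⟨u, hu, huk⟩ := hev hk
    obtain ⟨v, hv, hvl⟩ := hev hl
    obtain ⟨w, hw, hwa⟩ := hbar a
    have h₁ := hℰ.right_alt hu hv hw
    simp only [hass, huk, hvl, hwa, VectorType.ev_mul_ev, VectorType.ev_mul_bar,
      VectorType.bar_mul_ev, sgn_zero_left, one_smul] at h₁
    simp only [hm, hevₗ, hbarₗ, LinearMap.flip_apply]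
    rw [mul_comm a l] at h₁
    linear_combination (norm := module) h₁
  · intro k l hk hl a
    obtain ⟨u, hu, huk⟩ := hev hk
    obtain ⟨v, hv, hvl⟩ := hev hl
    obtain ⟨w, hw, hwa⟩ := hbar a
    have h₁ := hℰ.cyclic hu hv hw
    simp only [hass, huk, hvl, hwa, VectorType.ev_mul_ev, VectorType.ev_mul_bar,
      VectorType.bar_mul_ev, sgn_zero_left, add_zero, sgn_zero_right, one_smul] at h₁
    simp only [hm, hevₗ, hbarₗ, LinearMap.flip_apply, LinearMap.sub_apply]
    rw [mul_comm a k] at h₁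
    linear_combination (norm := module) h₁
  · intro a b c
    obtain ⟨u, hu, hua⟩ := hbar a
    obtain ⟨v, hv, hvb⟩ := hbar b
    obtain ⟨w, hw, hwc⟩ := hbar c
    have h₁ := hℰ.right_alt hu hv hw
    simp only [hass, hua, hvb, hwc, VectorType.bar_mul_bar, sgn_one_one, h2mul] at h₁
    simp only [hm, hevₗ, hbarₗ, LinearMap.flip_apply]
    linear_combination (norm := module) h₁
  · intro a b c
    obtain ⟨u, hu, hua⟩ := hbar a
    obtain ⟨v, hv, hvb⟩ := hbar b
    obtain ⟨w, hw, hwc⟩ := hbar c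
    have h₁ := hℰ.cyclic hu hv hw
    simp only [hass, hua, hvb, hwc, VectorType.bar_mul_bar, one_add_one_zmod_two, sgn_zero_right,
      h2mul, one_smul] at h₁
    simp only [hm, hevₗ, hbarₗ, LinearMap.flip_apply, LinearMap.sub_apply]
    linear_combination (norm := module) h₁
  · intro k l n hk hl hn
    obtain ⟨u, hu, huk⟩ := hev hk
    obtain ⟨v, hv, hvl⟩ := hev hl
    obtain ⟨w, hw, hwn⟩ := hev hn
    have h₁ := hℰ.right_alt hu hv hw
    simp only [hass, huk, hvl, hwn, VectorType.ev_mul_ev, sgn_zero_left, one_smul] at h₁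
    simp only [hm, hevₗ]
    rw [mul_comm n l] at h₁
    linear_combination (norm := module) -h₁
  · intro k l n hk hl hn
    obtain ⟨u, hu, huk⟩ := hev hk
    obtain ⟨v, hv, hvl⟩ := hev hl
    obtain ⟨w, hw, hwn⟩ := hev hn
    have h₁ := hℰ.cyclic hu hv hw
    simp only [hass, huk, hvl, hwn, VectorType.ev_mul_ev, sgn_zero_left, one_smul] at h₁
    simp only [hm, hevₗ, LinearMap.flip_apply, LinearMap.sub_apply]
    linear_combination (norm := module) h₁
  · intro k hk a b
    obtain ⟨u, hu, huk⟩ := hev hk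
    obtain ⟨v, hv, hva⟩ := hbar a
    obtain ⟨w, hw, hwb⟩ := hbar b
    have h₁ := hℰ.right_alt hv hu hw
    simp only [hass, huk, hva, hwb, VectorType.ev_mul_bar, VectorType.bar_mul_ev,
      VectorType.bar_mul_bar, sgn_zero_left, h2mul, one_smul] at h₁
    simp only [hm, hevₗ, hbarₗ]
    rw [mul_comm a k, mul_comm b k] at h₁
    linear_combination (norm := module) h₁
  · intro k hk a b
    obtain ⟨u, hu, huk⟩ := hev hk
    obtain ⟨v, hv, hva⟩ := hbar a
    obtain ⟨w, hw, hwb⟩ := hbar b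
    have h₁ := hℰ.right_alt hu hv hw
    simp only [hass, huk, hva, hwb, VectorType.ev_mul_bar,
      VectorType.bar_mul_bar, sgn_one_one, h2mul] at h₁
    simp only [hm, hevₗ, hbarₗ]
    linear_combination (norm := module) h₁
  · intro u v k a hu hv
    rw [hmul u v, hmul v u, hu, hv]
    exact ⟨rfl, rfl⟩
  · intro u v k l hu hv
    rw [hmul u v, hu, hv]
    rfl

theorem mem_evenCenter_of_extension {Z : Type*} [IsEmpty Z] (h2 : (2 : Φ) ≠ 0) (h3 : (3 : Φ) ≠ 0)
    (hg : SuperGraded ℰ) (hℰ : SuperMinusOneOne ℰ)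
    (π : E →ₙₐ[Φ] VectorType (shiftD Φ Z) (MvPolynomial.X (Sum.inl 0)))
    (hπ : ∀ i, ∀ a ∈ ℰ i, π a ∈ VectorType.grading _ _ i)
    (hrange : ∀ p, MvPolynomial.constantCoeff (VectorType.fstₗ _ _ p) = 0 ↔ ∃ a, π a = p)
    (hker : ∀ a, π a = 0 → ∀ b, a * b = 0 ∧ b * a = 0) {k : E} (hk : k ∈ ℰ 0) :
    k ∈ evenCenter ℰ := by
  obtain ⟨S, T, P, Q, h, hST, hP⟩ := exists_extensionProducts
    (I := RingHom.ker (MvPolynomial.constantCoeff (R := Φ) (σ := TZ Z))) (MvPolynomial.constantCoeff_X Φ _)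
    (constantCoeff_shiftD Φ Z) hg hℰ π hπ hrange hker
  refine ⟨hk, fun a => ?_⟩
  obtain ⟨a₀, ha₀, a₁, ha₁, rfl⟩ := hg.exists_eq_add a
  obtain ⟨k', hk'⟩ := VectorType.exists_ev (hπ 0 k hk)
  obtain ⟨a₀', ha₀'⟩ := VectorType.exists_ev (hπ 0 a₀ ha₀)
  obtain ⟨a₁', ha₁'⟩ := VectorType.exists_bar (hπ 1 a₁ ha₁)
  have hk₀ := (hrange _).2 ⟨k, hk'⟩
  have ha₀₀ := (hrange _).2 ⟨a₀, ha₀'⟩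
  have e₀ := h.even_comm h2 h3 hk₀ ha₀₀
  have e₁ := h.odd_comm h2 h3 hk₀ a₁'
  rw [LinearMap.sub_apply, LinearMap.sub_apply, sub_eq_zero] at e₀ e₁
  rw [LinearMap.flip_apply] at e₀
  rw [mul_add, add_mul, hP _ _ _ _ hk' ha₀', hP _ _ _ _ ha₀' hk', (hST _ _ _ _ hk' ha₁').1,
    (hST _ _ _ _ hk' ha₁').2]
  exact congrArg₂ _ e₀ e₁

end Extension

end ExtensionProducts

/-! ## The free `(-1,1)`-superalgebra on one odd generator -/

/-! ### Degree components of free nonassociative algebras. -/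

section Degree

variable {Φ : Type*} [Field Φ]

theorem trilinear_mem_of_span {A V : Type*} [AddCommGroup A] [Module Φ A] [AddCommGroup V]
    [Module Φ V] {s t u : Set A} {S : Submodule Φ V} {g : A → A → A → V}
    (h₁ : ∀ b c, IsLinearMap Φ fun a => g a b c) (h₂ : ∀ a c, IsLinearMap Φ fun b => g a b c)
    (h₃ : ∀ a b, IsLinearMap Φ fun c => g a b c)
    (hS : ∀ a ∈ s, ∀ b ∈ t, ∀ c ∈ u, g a b c ∈ S) {a b c : A} (ha : a ∈ Submodule.span Φ s)
    (hb : b ∈ Submodule.span Φ t) (hc : c ∈ Submodule.span Φ u) : g a b c ∈ S := by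
  have e₁ : ∀ a ∈ Submodule.span Φ s, ∀ b ∈ t, ∀ c ∈ u, g a b c ∈ S := fun a ha b hb c hc =>
    (Submodule.span_le (p := S.comap (h₁ b c).mk')).2 (fun a ha => hS a ha b hb c hc) ha
  have e₂ : ∀ a ∈ Submodule.span Φ s, ∀ b ∈ Submodule.span Φ t, ∀ c ∈ u, g a b c ∈ S :=
    fun a ha b hb c hc =>
      (Submodule.span_le (p := S.comap (h₂ a c).mk')).2 (fun b hb => e₁ a ha b hb c hc) hb
  exact (Submodule.span_le (p := S.comap (h₃ a b).mk')).2 (fun c hc => e₂ a ha b hb c hc) hc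

variable {W : Type*}

/-- The projection to the component of degree `n`. -/
abbrev degProj (Φ : Type*) [Field Φ] {W : Type*} (n : ℕ) :
    FreeNonUnitalNonAssocAlgebra Φ W →ₗ[Φ] FreeNonUnitalNonAssocAlgebra Φ W :=
  wordProj Φ fun w : FreeMagma W => w.length = n

theorem length_mul (u v : FreeMagma W) : (u * v).length = u.length + v.length := rfl

theorem degProj_mul_word (n : ℕ) (a : FreeNonUnitalNonAssocAlgebra Φ W) (w : FreeMagma W) :
    degProj Φ n (a * word Φ w) =
      if w.length ≤ n then degProj Φ (n - w.length) a * word Φ w else 0 := by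
  induction a using free_induction with
  | hw u =>
    rw [← word_mul, wordProj_word, wordProj_word, length_mul]
    have := u.length_pos
    split_ifs <;> first | omega | simp
  | h0 => simp
  | hadd a b ha hb => rw [add_mul, map_add, ha, hb]; split_ifs <;> simp [add_mul]
  | hsmul r a ha => rw [smul_mul_assoc, map_smul, ha]; split_ifs <;> simp [smul_mul_assoc]

theorem degProj_word_mul (n : ℕ) (a : FreeNonUnitalNonAssocAlgebra Φ W) (w : FreeMagma W) :
    degProj Φ n (word Φ w * a) =
      if w.length ≤ n then word Φ w * degProj Φ (n - w.length) a else 0 := by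
  induction a using free_induction with
  | hw u =>
    rw [← word_mul, wordProj_word, wordProj_word, length_mul]
    have := u.length_pos
    split_ifs <;> first | omega | simp
  | h0 => simp
  | hadd a b ha hb => rw [mul_add, map_add, ha, hb]; split_ifs <;> simp [mul_add]
  | hsmul r a ha => rw [mul_smul_comm, map_smul, ha]; split_ifs <;> simp [mul_smul_comm]

/-- An element is the sum of its components. -/
theorem exists_sum_degProj (a : FreeNonUnitalNonAssocAlgebra Φ W) :
    ∃ N, ∀ M, N ≤ M → ∑ n ∈ Finset.range M, degProj Φ n a = a := by
  induction a using free_induction with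
  | hw u =>
    refine ⟨u.length + 1, fun M hM => ?_⟩
    simp only [wordProj_word]
    rw [Finset.sum_ite_eq, if_pos (Finset.mem_range.2 hM)]
  | h0 => exact ⟨0, by simp⟩
  | hadd a b ha hb =>
    obtain ⟨N₁, h₁⟩ := ha
    obtain ⟨N₂, h₂⟩ := hb
    refine ⟨max N₁ N₂, fun M hM => ?_⟩
    simp only [map_add, Finset.sum_add_distrib]
    rw [h₁ M (le_trans (le_max_left _ _) hM), h₂ M (le_trans (le_max_right _ _) hM)]
  | hsmul r a ha =>
    obtain ⟨N, h⟩ := ha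
    exact ⟨N, fun M hM => by simp only [map_smul, ← Finset.smul_sum, h M hM]⟩

theorem mem_of_degProj_mem {S : Submodule Φ (FreeNonUnitalNonAssocAlgebra Φ W)}
    {a : FreeNonUnitalNonAssocAlgebra Φ W} (h : ∀ n, degProj Φ n a ∈ S) : a ∈ S := by
  obtain ⟨N, hN⟩ := exists_sum_degProj a
  rw [← hN N le_rfl]
  exact sum_mem fun n _ => h n

/-- The elements all of whose components belong to an ideal. -/
def AlgIdeal.gradedCore (I : AlgIdeal Φ (FreeNonUnitalNonAssocAlgebra Φ W)) :
    AlgIdeal Φ (FreeNonUnitalNonAssocAlgebra Φ W) where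
  toSubmodule := ⨅ n, I.toSubmodule.comap (degProj Φ n)
  mul_left_mem b a ha := by
    change b * a ∈ ⨅ n, I.toSubmodule.comap (degProj Φ n)
    have ha' : a ∈ ⨅ n, I.toSubmodule.comap (degProj Φ n) := ha
    simp only [Submodule.mem_iInf, Submodule.mem_comap] at ha' ⊢
    intro n
    induction b using free_induction with
    | hw w =>
      rw [degProj_word_mul]
      split_ifs
      · exact I.mul_left_mem _ (ha' _)
      · exact zero_mem _
    | h0 => rw [zero_mul, map_zero]; exact zero_mem _
    | hadd b c hb hc => rw [add_mul, map_add]; exact add_mem hb hc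
    | hsmul r b hb => rw [smul_mul_assoc, map_smul]; exact Submodule.smul_mem _ r hb
  mul_right_mem b a ha := by
    change a * b ∈ ⨅ n, I.toSubmodule.comap (degProj Φ n)
    have ha' : a ∈ ⨅ n, I.toSubmodule.comap (degProj Φ n) := ha
    simp only [Submodule.mem_iInf, Submodule.mem_comap] at ha' ⊢
    intro n
    induction b using free_induction with
    | hw w =>
      rw [degProj_mul_word]
      split_ifs
      · exact I.mul_right_mem _ (ha' _)
      · exact zero_mem _
    | h0 => rw [mul_zero, map_zero]; exact zero_mem _
    | hadd b c hb hc => rw [mul_add, map_add]; exact add_mem hb hc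
    | hsmul r b hb => rw [mul_smul_comm, map_smul]; exact Submodule.smul_mem _ r hb

theorem AlgIdeal.mem_gradedCore {I : AlgIdeal Φ (FreeNonUnitalNonAssocAlgebra Φ W)}
    {a : FreeNonUnitalNonAssocAlgebra Φ W} :
    a ∈ I.gradedCore.toSubmodule ↔ ∀ n, degProj Φ n a ∈ I.toSubmodule := by
  simp [AlgIdeal.gradedCore]

/-- Without even generators, parity is length modulo 2, so each degree component is purely even or
purely odd. -/
theorem AlgIdeal.gradedCore_isHomogeneous {X Y : Type*} [IsEmpty X]
    (I : AlgIdeal Φ (FreeNonUnitalNonAssocAlgebra Φ (X ⊕ Y))) :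
    I.gradedCore.IsHomogeneous (freeGrading Φ X Y) := by
  have hpar : ∀ w : FreeMagma (X ⊕ Y), parity w = (w.length : ZMod 2) := by
    intro w
    induction w with
    | ih1 s =>
      rcases s with s | s
      · exact isEmptyElim s
      · simp [parity]
    | ih2 u v hu hv => rw [parity_mul, length_mul, hu, hv, Nat.cast_add]
  let P : ZMod 2 → FreeNonUnitalNonAssocAlgebra Φ (X ⊕ Y) →ₗ[Φ]
      FreeNonUnitalNonAssocAlgebra Φ (X ⊕ Y) := fun i => wordProj Φ fun w => parity w = i
  have hP : ∀ i a, P i a ∈ freeGrading Φ X Y i := by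
    intro i a
    induction a using free_induction with
    | hw w =>
      simp only [P, wordProj_word]
      split_ifs with h
      · exact h ▸ word_mem_freeGrading w
      · exact zero_mem _
    | h0 => rw [map_zero]; exact zero_mem _
    | hadd a b ha hb => rw [map_add]; exact add_mem ha hb
    | hsmul r a ha => rw [map_smul]; exact Submodule.smul_mem _ r ha
  have hsum : ∀ a, a = P 0 a + P 1 a := by
    intro a
    induction a using free_induction with
    | hw w =>
      simp only [P, wordProj_word]
      rcases zmod_two_cases (parity w) with h | h <;> simp [h]
    | h0 => simp
    | hadd a b ha hb => rw [map_add, map_add, add_add_add_comm, ← ha, ← hb]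
    | hsmul r a ha => rw [map_smul, map_smul, ← smul_add, ← ha]
  have hcomm : ∀ i n a, degProj Φ n (P i a) = if (n : ZMod 2) = i then degProj Φ n a else 0 := by
    intro i n a
    induction a using free_induction with
    | hw w =>
      simp only [P, wordProj_word, hpar]
      by_cases h : w.length = n
      · subst h
        by_cases hi : (w.length : ZMod 2) = i
        · rw [if_pos hi, if_pos hi, wordProj_word, if_pos rfl]
        · rw [if_neg hi, if_neg hi, map_zero]
      · rw [if_neg h, ite_self]
        split_ifs
        · rw [wordProj_word, if_neg h]
        · rw [map_zero]
    | h0 => simp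
    | hadd a b ha hb => rw [map_add, map_add, ha, hb]; split_ifs <;> simp
    | hsmul r a ha => rw [map_smul, map_smul, ha]; split_ifs <;> simp
  have hmem : ∀ i, ∀ a ∈ I.gradedCore.toSubmodule, P i a ∈ I.gradedCore.toSubmodule := by
    intro i a ha
    rw [AlgIdeal.mem_gradedCore] at ha ⊢
    intro n
    rw [hcomm]
    split_ifs
    · exact ha n
    · exact zero_mem _
  exact isHomogeneous_of_exists _ fun a ha =>
    ⟨_, ⟨hmem 0 a ha, hP 0 a⟩, _, ⟨hmem 1 a ha, hP 1 a⟩, hsum a⟩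

theorem isLinearMap_right_alt {A : Type*} [NonUnitalNonAssocRing A] [Module Φ A]
    [IsScalarTower Φ A A] [SMulCommClass Φ A A] (r : Φ) (a b : A) :
    (IsLinearMap Φ fun c => associator c a b + r • associator c b a) ∧
    (IsLinearMap Φ fun c => associator a c b + r • associator a b c) ∧
    IsLinearMap Φ fun c => associator a b c + r • associator a c b := by
  refine ⟨⟨fun c d => ?_, fun s c => ?_⟩, ⟨fun c d => ?_, fun s c => ?_⟩,
    ⟨fun c d => ?_, fun s c => ?_⟩⟩ <;>
  simp only [associator, add_mul, mul_add, smul_mul_assoc, mul_smul_comm] <;> module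

theorem isLinearMap_cyclic {A : Type*} [NonUnitalNonAssocRing A] [Module Φ A]
    [IsScalarTower Φ A A] [SMulCommClass Φ A A] (r s : Φ) (a b : A) :
    (IsLinearMap Φ fun c => associator c a b + r • associator a b c + s • associator b c a) ∧
    (IsLinearMap Φ fun c => associator a c b + r • associator c b a + s • associator b a c) ∧
    IsLinearMap Φ fun c => associator a b c + r • associator b c a + s • associator c a b := by
  refine ⟨⟨fun c d => ?_, fun s c => ?_⟩, ⟨fun c d => ?_, fun s c => ?_⟩,
    ⟨fun c d => ?_, fun s c => ?_⟩⟩ <;>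
  simp only [associator, add_mul, mul_add, smul_mul_assoc, mul_smul_comm] <;> module

theorem degProj_associator_word (n : ℕ) (u v w : FreeMagma W) :
    degProj Φ n (associator (word Φ u) (word Φ v) (word Φ w)) =
      if u.length + v.length + w.length = n then associator (word Φ u) (word Φ v) (word Φ w)
      else 0 := by
  have h₁ : (u * v * w).length = u.length + v.length + w.length := rfl
  have h₂ : (u * (v * w)).length = u.length + v.length + w.length := by
    rw [length_mul, length_mul, add_assoc]
  rw [associator, ← word_mul, ← word_mul, ← word_mul, ← word_mul, map_sub, wordProj_word,
    wordProj_word]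
  by_cases h : u.length + v.length + w.length = n
  · rw [if_pos h, if_pos (h₁.trans h), if_pos (h₂.trans h)]
  · rw [if_neg h, if_neg (h₁ ▸ h), if_neg (h₂ ▸ h), sub_zero]

/-- By trilinearity the superidentities are tested on words, where all terms have the same length; a
degree component is then the whole expression or zero. -/
theorem superMinusOneOne_gradedCore {X Y : Type*}
    {I : AlgIdeal Φ (FreeNonUnitalNonAssocAlgebra Φ (X ⊕ Y))}
    (h : SuperMinusOneOne (I.grading (freeGrading Φ X Y))) :
    SuperMinusOneOne (I.gradedCore.grading (freeGrading Φ X Y)) := by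
  rw [superMinusOneOne_quotient_iff] at h ⊢
  refine ⟨fun {i j k a b c} ha hb hc => ?_, fun {i j k a b c} ha hb hc => ?_⟩
  · refine trilinear_mem_of_span
      (g := fun a b c => associator a b c + sgn Φ j k • associator a c b)
      (fun _ _ => (isLinearMap_right_alt _ _ _).1)
      (fun _ _ => (isLinearMap_right_alt _ _ _).2.1) (fun _ _ => (isLinearMap_right_alt _ _ _).2.2)
      ?_ ha hb hc
    rintro _ ⟨u, rfl, rfl⟩ _ ⟨v, rfl, rfl⟩ _ ⟨w, rfl, rfl⟩
    refine AlgIdeal.mem_gradedCore.2 fun n => ?_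
    rw [map_add, map_smul, degProj_associator_word, degProj_associator_word,
      add_right_comm u.length w.length]
    split_ifs
    · exact h.1 (word_mem_freeGrading u) (word_mem_freeGrading v) (word_mem_freeGrading w)
    · simp
  · refine trilinear_mem_of_span
      (g := fun a b c => associator a b c + sgn Φ i (j + k) • associator b c a
        + sgn Φ k (i + j) • associator c a b)
      (fun _ _ => (isLinearMap_cyclic _ _ _ _).1)
      (fun _ _ => (isLinearMap_cyclic _ _ _ _).2.1) (fun _ _ => (isLinearMap_cyclic _ _ _ _).2.2)
      ?_ ha hb hc
    rintro _ ⟨u, rfl, rfl⟩ _ ⟨v, rfl, rfl⟩ _ ⟨w, rfl, rfl⟩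
    refine AlgIdeal.mem_gradedCore.2 fun n => ?_
    rw [map_add, map_add, map_smul, map_smul, degProj_associator_word, degProj_associator_word,
      degProj_associator_word, ← add_rotate u.length v.length w.length,
      ← add_rotate v.length w.length, ← add_rotate u.length v.length w.length]
    split_ifs
    · exact h.2 (word_mem_freeGrading u) (word_mem_freeGrading v) (word_mem_freeGrading w)
    · simp

/-- The graded core of the ideal of identities belongs to the family whose intersection is that
ideal, so it contains it. -/
theorem degProj_mem_varietyIdeal (h2 : (2 : Φ) ≠ 0) {X Y : Type*} [IsEmpty X]
    {a : FreeNonUnitalNonAssocAlgebra Φ (X ⊕ Y)}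
    (ha : a ∈ (varietyIdeal (varietyMinusOneOne Φ) X Y).toSubmodule) (n : ℕ) :
    degProj Φ n a ∈ (varietyIdeal (varietyMinusOneOne Φ) X Y).toSubmodule :=
  AlgIdeal.mem_gradedCore.1 (varietyIdeal_le (AlgIdeal.gradedCore_isHomogeneous _)
    (isSuperalgebraOf_minusOneOne h2 (superMinusOneOne_gradedCore
      (superMinusOneOne_freeSuper subset_rfl))) ha) n

end Degree

/-! ### The evaluation `x ↦ 1̄` and the identities in one odd generator. -/

section OneGenerator

open MvPolynomial

variable {Φ : Type*} [Field Φ]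

/-- Supercommutators with an even factor vanish, and that of two odd elements is even, hence
central. -/
theorem superCommCentral_of_evenCenter {A : Type*} [NonUnitalNonAssocRing A] [Module Φ A]
    [IsScalarTower Φ A A] [SMulCommClass Φ A A] {𝒜 : ZMod 2 → Submodule Φ A} (hg : SuperGraded 𝒜)
    (h : ∀ k ∈ 𝒜 0, k ∈ evenCenter 𝒜) : SuperCommCentral 𝒜 := by
  intro i j k a b c ha hb hc
  rcases zmod_two_cases i with rfl | rfl
  · simp [superComm, (h a ha).2 b]
  rcases zmod_two_cases j with rfl | rfl
  · simp [superComm, (h b hb).2 a]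
  · have hab : a * b + b * a ∈ 𝒜 0 := by
      rw [← one_add_one_zmod_two]
      exact add_mem (hg.mul_mem ha hb) (hg.mul_mem hb ha)
    simp [superComm, one_add_one_zmod_two, (h _ hab).2 c]

/-- The evaluation of the free nonassociative algebra on one odd generator `x` in
`B(Φ[t_0, t_1, …], D, t_0)`, with `x ↦ 1̄`. -/
def evalBar (Φ : Type*) [Field Φ] : FreeNonUnitalNonAssocAlgebra Φ (Empty ⊕ Unit) →ₙₐ[Φ]
    VectorType (shiftD Φ Empty) (X (Sum.inl 0)) :=
  FreeNonUnitalNonAssocAlgebra.lift Φ fun _ => .bar _ _ 1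

theorem evalBar_of (s : Empty ⊕ Unit) :
    evalBar Φ (FreeNonUnitalNonAssocAlgebra.of Φ s) = .bar _ _ 1 :=
  FreeNonUnitalNonAssocAlgebra.lift_of_apply Φ _ s

theorem evalBar_mem_grading (i : ZMod 2) (a : FreeNonUnitalNonAssocAlgebra Φ (Empty ⊕ Unit))
    (ha : a ∈ freeGrading Φ Empty Unit i) : evalBar Φ a ∈ VectorType.grading _ _ i :=
  lift_mem_grading VectorType.superGraded.mul_mem _ (fun x => x.elim)
    (fun _ => VectorType.bar_mem 1) i a ha

theorem varietyIdeal_le_ker (h2 : (2 : Φ) ≠ 0) :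
    (varietyIdeal (varietyMinusOneOne Φ) Empty Unit).toSubmodule ≤
      (AlgIdeal.ker (evalBar Φ)).toSubmodule :=
  varietyIdeal_le (isHomogeneous_ker _ evalBar_mem_grading superGraded_free VectorType.grading_inf)
    (isSuperalgebraOf_minusOneOne h2
      (superMinusOneOne_ker _ evalBar_mem_grading VectorType.superMinusOneOne))

/-- The set of all products with a factor in the ideal `K`. -/
def AlgIdeal.products {A : Type*} [NonUnitalNonAssocRing A] [Module Φ A] (K : AlgIdeal Φ A) :
    Set A :=
  {a | ∃ k ∈ K.toSubmodule, ∃ b, a = k * b ∨ a = b * k}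

/-- The ideal `I + KA + AK`, for ideals `I ⊆ K` of `A`. -/
def AlgIdeal.supProducts {A : Type*} [NonUnitalNonAssocRing A] [Module Φ A] (I K : AlgIdeal Φ A)
    (h : I.toSubmodule ≤ K.toSubmodule) : AlgIdeal Φ A :=
  have hle : I.toSubmodule ⊔ Submodule.span Φ K.products ≤ K.toSubmodule :=
    sup_le h <| Submodule.span_le.2 <| by
      rintro _ ⟨k, hk, b, rfl | rfl⟩
      exacts [K.mul_right_mem b hk, K.mul_left_mem b hk]
  { toSubmodule := I.toSubmodule ⊔ Submodule.span Φ K.products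
    mul_left_mem := fun b _ ha =>
      Submodule.mem_sup_right (Submodule.subset_span ⟨_, hle ha, b, Or.inr rfl⟩)
    mul_right_mem := fun b _ ha =>
      Submodule.mem_sup_right (Submodule.subset_span ⟨_, hle ha, b, Or.inl rfl⟩) }

theorem AlgIdeal.supProducts_le {A : Type*} [NonUnitalNonAssocRing A] [Module Φ A]
    {I K : AlgIdeal Φ A} (h : I.toSubmodule ≤ K.toSubmodule) :
    (I.supProducts K h).toSubmodule ≤ K.toSubmodule :=
  sup_le h <| Submodule.span_le.2 <| by
    rintro _ ⟨k, hk, b, rfl | rfl⟩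
    exacts [K.mul_right_mem b hk, K.mul_left_mem b hk]

theorem evalBar_mem_range (p : VectorType (shiftD Φ Empty) (X (Sum.inl 0)))
    (h2 : (2 : Φ) ≠ 0) : constantCoeff (VectorType.fstₗ _ _ p) = 0 ↔ ∃ a, evalBar Φ a = p := by
  constructor
  · refine mem_range_of_hom (evalBar Φ) (Equiv.refl _) (genCoeff_ne_zero h2)
      (v := genFamily (FreeNonUnitalNonAssocAlgebra.of Φ (Sum.inr ())) fun e : Empty => e.elim)
      (fun i => ?_) (evalBar_of (Sum.inr ())) p
    rw [map_genFamily, evalBar_of, Equiv.refl_apply, ← genFamily_bar]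
    congr 1
    funext e
    exact e.elim
  · rintro ⟨a, rfl⟩
    let B := BZero (shiftD Φ Empty) (X (Sum.inl 0)) (constantCoeff_shiftD Φ Empty)
      (constantCoeff_X Φ _)
    have := free_eq_top (B.toSubmodule.comap
      (evalBar Φ : FreeNonUnitalNonAssocAlgebra Φ (Empty ⊕ Unit) →ₗ[Φ] _)) (fun s => ?_)
      fun a ha b hb => ?_
    · exact (this ▸ Submodule.mem_top : a ∈ Submodule.comap _ _)
    · change constantCoeff (VectorType.fstₗ _ _ (evalBar Φ _)) = 0
      rw [evalBar_of, VectorType.fst_bar, map_zero]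
    · change evalBar Φ (a * b) ∈ B
      rw [map_mul]
      exact B.mul_mem ha hb

/-- Let `I` be the ideal of identities and `K` the kernel of `evalBar`. If `I ⊆ L ⊆ K` and the
products with a factor in `K` belong to `L`, then `L = K`, and the quotient by `L` has a normal
basis. -/
theorem hasNormalBasis_quotient_of_products_subset (h2 : (2 : Φ) ≠ 0) (h3 : (3 : Φ) ≠ 0)
    (L : AlgIdeal Φ (FreeNonUnitalNonAssocAlgebra Φ (Empty ⊕ Unit)))
    (hIL : (varietyIdeal (varietyMinusOneOne Φ) Empty Unit).toSubmodule ≤ L.toSubmodule)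
    (hLK : L.toSubmodule ≤ (AlgIdeal.ker (evalBar Φ)).toSubmodule)
    (hKL : (AlgIdeal.ker (evalBar Φ)).products ⊆ L.toSubmodule) :
    HasNormalBasis Φ (genFamily (L.mkₗ (FreeNonUnitalNonAssocAlgebra.of Φ (Sum.inr ())))
      fun e : Empty => e.elim) (L.mkₗ (FreeNonUnitalNonAssocAlgebra.of Φ (Sum.inr ()))) ∧
    (AlgIdeal.ker (evalBar Φ)).toSubmodule ≤ L.toSubmodule := by
  let π := L.lift (evalBar Φ) hLK
  have hg : SuperGraded (L.grading (freeGrading Φ Empty Unit)) := superGraded_free.quotient L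
  have hπ : ∀ i, ∀ a ∈ L.grading (freeGrading Φ Empty Unit) i,
      π a ∈ VectorType.grading _ _ i := by
    rintro i _ ⟨a, ha, rfl⟩
    exact evalBar_mem_grading i a ha
  have h11 : SuperMinusOneOne (L.grading (freeGrading Φ Empty Unit)) := by
    have h := (superMinusOneOne_quotient_iff _).1
      (superMinusOneOne_freeSuper (X := Empty) (Y := Unit) (subset_refl (varietyMinusOneOne Φ)))
    exact (superMinusOneOne_quotient_iff _).2
      ⟨fun ha hb hc => hIL (h.1 ha hb hc), fun ha hb hc => hIL (h.2 ha hb hc)⟩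
  -- Products with a factor in the kernel lie in `L`, so the quotient by `L` is an annihilator
  -- extension of the image of `evalBar`.
  have heven : ∀ k ∈ L.grading (freeGrading Φ Empty Unit) 0,
      k ∈ evenCenter (L.grading (freeGrading Φ Empty Unit)) := fun k hk => by
    refine mem_evenCenter_of_extension h2 h3 hg h11 π hπ (fun p => ?_) (fun a ha b => ?_) hk
    · rw [evalBar_mem_range p h2]
      exact ⟨fun ⟨a, ha⟩ => ⟨L.mkₗ a, ha⟩, fun ⟨a, ha⟩ => by
        obtain ⟨a, rfl⟩ := L.mkₗ_surjective a
        exact ⟨a, ha⟩⟩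
    · obtain ⟨a, rfl⟩ := L.mkₗ_surjective a
      obtain ⟨b, rfl⟩ := L.mkₗ_surjective b
      rw [← L.mkₗ_mul, ← L.mkₗ_mul, L.mkₗ_eq_zero_iff, L.mkₗ_eq_zero_iff]
      exact ⟨hKL ⟨a, ha, b, Or.inl rfl⟩, hKL ⟨a, ha, b, Or.inr rfl⟩⟩
  set x := L.mkₗ (FreeNonUnitalNonAssocAlgebra.of Φ (Sum.inr ()))
  have hs : NormalSpanning Φ ∅ (genFamily x fun e : Empty => e.elim) x := by
    refine normalSpanning_genFamily hg h11 (superCommCentral_of_evenCenter hg heven) h2 h3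
      ⟨_, word_mem_freeGrading (FreeMagma.of (Sum.inr ())), rfl⟩ (fun e => e.elim)
      fun S hx _ hmul => ?_
    have hq : S.comap L.mkₗ = ⊤ := by
      refine free_eq_top _ ?_ fun a ha b hb => hmul _ ha _ hb
      rintro (e | ⟨⟩)
      · exact e.elim
      · exact hx
    refine eq_top_iff.2 fun a _ => ?_
    obtain ⟨a, rfl⟩ := L.mkₗ_surjective a
    exact (hq ▸ Submodule.mem_top : a ∈ S.comap L.mkₗ)
  have hx : π x = .bar _ _ 1 := evalBar_of _
  -- Injectivity of the induced map on the quotient is exactly the inclusion of the kernel in `L`.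
  obtain ⟨hb, hinj⟩ := hasNormalBasis_of_hom π hs (Equiv.refl _) (genCoeff_ne_zero h2) (fun i => by
    rw [map_genFamily, hx, Equiv.refl_apply, ← genFamily_bar]
    congr 1
    funext e
    exact e.elim) hx
  refine ⟨hb, fun a ha => ?_⟩
  rw [← L.mkₗ_eq_zero_iff]
  exact hinj ((AlgIdeal.mem_ker.1 ha).trans (map_zero π).symm)

/-- The ideal `I + KF + FK` is the smallest admissible choice of `L`. -/
theorem ker_le_supProducts (h2 : (2 : Φ) ≠ 0) (h3 : (3 : Φ) ≠ 0) :
    (AlgIdeal.ker (evalBar Φ)).toSubmodule ≤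
      (AlgIdeal.supProducts _ _ (varietyIdeal_le_ker h2)).toSubmodule :=
  (hasNormalBasis_quotient_of_products_subset h2 h3 _ (fun _ => Submodule.mem_sup_left)
    (AlgIdeal.supProducts_le (varietyIdeal_le_ker h2))
    fun _ ha => Submodule.mem_sup_right (Submodule.subset_span ha)).2

/-- A graded Nakayama argument: `K = I + KF + FK`, and in degree `n` the products involve only
components of `K` of degree less than `n`. -/
theorem ker_le_varietyIdeal (h2 : (2 : Φ) ≠ 0) (h3 : (3 : Φ) ≠ 0) :
    (AlgIdeal.ker (evalBar Φ)).toSubmodule ≤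
      (varietyIdeal (varietyMinusOneOne Φ) Empty Unit).toSubmodule := by
  set I := varietyIdeal (varietyMinusOneOne Φ) Empty Unit with hI
  have key : ∀ n, ∀ a ∈ (AlgIdeal.ker (evalBar Φ)).toSubmodule,
      degProj Φ n a ∈ I.toSubmodule := by
    intro n
    induction n using Nat.strong_induction_on with
    | _ n ih =>
      intro a ha
      refine (sup_le (fun a ha => degProj_mem_varietyIdeal h2 ha n) ?_ :
        (AlgIdeal.supProducts _ _ (varietyIdeal_le_ker h2)).toSubmodule ≤
          I.toSubmodule.comap (degProj Φ n)) (ker_le_supProducts h2 h3 ha)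
      refine Submodule.span_le.2 ?_
      rintro _ ⟨k, hk, b, hb⟩
      have hprod : ∀ b, degProj Φ n (k * b) ∈ I.toSubmodule ∧
          degProj Φ n (b * k) ∈ I.toSubmodule := by
        intro b
        induction b using free_induction with
        | hw w =>
          -- Words have positive length, so the other factor enters in degree strictly below `n`.
          have := w.length_pos
          rw [degProj_mul_word, degProj_word_mul]
          split_ifs
          · exact ⟨I.mul_right_mem _ (ih _ (by omega) k hk),
              I.mul_left_mem _ (ih _ (by omega) k hk)⟩
          · exact ⟨zero_mem _, zero_mem _⟩
        | h0 => simp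
        | hadd b c hb hc =>
          rw [mul_add, add_mul, map_add, map_add]
          exact ⟨add_mem hb.1 hc.1, add_mem hb.2 hc.2⟩
        | hsmul r b hb =>
          rw [mul_smul_comm, smul_mul_assoc, map_smul, map_smul]
          exact ⟨Submodule.smul_mem _ r hb.1, Submodule.smul_mem _ r hb.2⟩
      rcases hb with rfl | rfl
      exacts [(hprod b).1, (hprod b).2]
  exact fun a ha => mem_of_degProj_mem fun n => key n a ha

/-- The family `x² R_{x,x}^i` and `x` give a normal basis of the free `(-1,1)`-superalgebra. -/
theorem Fx.hasNormalBasis (h2 : (2 : Φ) ≠ 0) (h3 : (3 : Φ) ≠ 0) :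
    HasNormalBasis Φ (fun i => (opR (Fx.x Φ) (Fx.x Φ))^[i] (Fx.x Φ * Fx.x Φ)) (Fx.x Φ) :=
  have hle := ker_le_varietyIdeal (Φ := Φ) h2 h3
  (hasNormalBasis_quotient_of_products_subset h2 h3 _ le_rfl (varietyIdeal_le_ker h2) (by
    rintro _ ⟨k, hk, b, rfl | rfl⟩
    exacts [AlgIdeal.mul_right_mem _ b (hle hk), AlgIdeal.mul_left_mem _ b (hle hk)])).1.reindex
      (Equiv.sumEmpty ℕ (Empty × ℕ)).symm

/-! ### The grading by degree -/

/-- The component of degree `n` of the free `(-1,1)`-superalgebra on one odd generator. -/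
def Fx.component (Φ : Type*) [Field Φ] (n : ℕ) : Submodule Φ (Fx Φ) :=
  Submodule.span Φ {a | ∃ w : FreeMagma (Empty ⊕ Unit), w.length = n ∧
    a = (varietyIdeal (varietyMinusOneOne Φ) Empty Unit).mkₗ (word Φ w)}

theorem Fx.x_mem_component : Fx.x Φ ∈ Fx.component Φ 1 :=
  Submodule.subset_span ⟨.of (Sum.inr ()), rfl, rfl⟩

theorem Fx.mul_mem_component {m n : ℕ} {a b : Fx Φ} (ha : a ∈ Fx.component Φ m)
    (hb : b ∈ Fx.component Φ n) : a * b ∈ Fx.component Φ (m + n) := by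
  induction ha, hb using Submodule.span_induction₂ with
  | mem_mem a b ha hb =>
    obtain ⟨u, rfl, rfl⟩ := ha
    obtain ⟨v, rfl, rfl⟩ := hb
    rw [← AlgIdeal.mkₗ_mul, ← word_mul]
    exact Submodule.subset_span ⟨u * v, rfl, rfl⟩
  | zero_left => simp
  | zero_right => simp
  | add_left _ _ _ _ _ _ h₁ h₂ => rw [add_mul]; exact add_mem h₁ h₂
  | add_right _ _ _ _ _ _ h₁ h₂ => rw [mul_add]; exact add_mem h₁ h₂
  | smul_left r _ _ _ _ h => rw [smul_mul_assoc]; exact Submodule.smul_mem _ r h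
  | smul_right r _ _ _ _ h => rw [mul_smul_comm]; exact Submodule.smul_mem _ r h

theorem Fx.opR_iterate_mem_component (i : ℕ) :
    (opR (Fx.x Φ) (Fx.x Φ))^[i] (Fx.x Φ * Fx.x Φ) ∈ Fx.component Φ (2 * i + 2) := by
  have hx := Fx.x_mem_component (Φ := Φ)
  have hxx := Fx.mul_mem_component hx hx
  induction i with
  | zero => exact hxx
  | succ i ih =>
    rw [Function.iterate_succ_apply', show 2 * (i + 1) + 2 = 2 * i + 2 + 1 + 1 by ring]
    have hi := Fx.mul_mem_component ih hxx
    exact sub_mem (Fx.mul_mem_component (Fx.mul_mem_component ih hx) hx) hi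

theorem Fx.mem_component_of_isNormalWord {p : (ℕ →₀ ℕ) × Fin 2} {a : Fx Φ}
    (h : IsNormalWord (fun i => (opR (Fx.x Φ) (Fx.x Φ))^[i] (Fx.x Φ * Fx.x Φ)) (Fx.x Φ) p a) :
    a ∈ Fx.component Φ (wordDegree p) := by
  have hmon : ∀ {m a}, IsMonomial (fun i => (opR (Fx.x Φ) (Fx.x Φ))^[i] (Fx.x Φ * Fx.x Φ)) m a →
      a ∈ Fx.component Φ (m.sum fun k n => n * (2 * k + 2)) := by
    intro m a h
    induction h with
    | var i =>
      rw [Finsupp.sum_single_index (by simp), one_mul]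
      exact Fx.opR_iterate_mem_component i
    | mul _ _ h₁ h₂ =>
      rw [Finsupp.sum_add_index' (by simp) (by intros; ring)]
      exact Fx.mul_mem_component h₁ h₂
  cases h with
  | even h => exact hmon h
  | gen => simpa [wordDegree] using Fx.x_mem_component
  | odd h => exact Fx.mul_mem_component (hmon h) Fx.x_mem_component

/-- The projections to the components. -/
theorem Fx.exists_degProj (h2 : (2 : Φ) ≠ 0) (n : ℕ) : ∃ P : Fx Φ →ₗ[Φ] Fx Φ,
    ∀ m, ∀ a ∈ Fx.component Φ m, P a = if m = n then a else 0 := by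
  let I := varietyIdeal (varietyMinusOneOne Φ) Empty Unit
  let P : I.Quotient →ₗ[Φ] I.Quotient := I.toSubmodule.mapQ I.toSubmodule (degProj Φ n)
    fun _ ha => degProj_mem_varietyIdeal h2 ha n
  have hP : ∀ a, P (I.mkₗ a) = I.mkₗ (degProj Φ n a) := fun a => rfl
  refine ⟨P, fun m a ha => ?_⟩
  induction ha using Submodule.span_induction with
  | mem a ha =>
    obtain ⟨w, rfl, rfl⟩ := ha
    rw [hP, wordProj_word]
    split_ifs
    · rfl
    · exact map_zero _
  | zero => simp
  | add a b _ _ ha hb => rw [map_add, ha, hb]; split_ifs <;> simp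
  | smul r a _ ha => rw [map_smul, ha]; split_ifs <;> simp

/-- The degree projection fixes `a` and deletes from its expansion all basis elements of other
degrees. -/
theorem Fx.mem_span_of_mem_component (h2 : (2 : Φ) ≠ 0) {κ : Type*} (b : Module.Basis κ Φ (Fx Φ))
    (d : κ → ℕ) (hb : ∀ p, b p ∈ Fx.component Φ (d p)) {n : ℕ} {a : Fx Φ}
    (ha : a ∈ Fx.component Φ n) : a ∈ Submodule.span Φ (b '' {p | d p = n}) := by
  obtain ⟨P, hP⟩ := Fx.exists_degProj h2 n
  have h₁ : a = P a := by rw [hP n a ha, if_pos rfl]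
  rw [h₁, ← b.linearCombination_repr a, Finsupp.linearCombination_apply, Finsupp.sum, map_sum]
  refine sum_mem fun p _ => ?_
  rw [map_smul, hP _ _ (hb p)]
  split_ifs with h
  · exact Submodule.smul_mem _ _ (Submodule.subset_span ⟨p, h, rfl⟩)
  · rw [smul_zero]
    exact zero_mem _

/-! ### The Grassmann `(-1,1)`-algebra -/

/-- A word `uv` tensored with `e_S` is, up to sign, the product of `u ⊗ e_{S₁}` and `v ⊗ e_{S∖S₁}`
for any subset `S₁` of size the length of `u`. -/
theorem tmul_genProd_mem_grassmannMinusOneOne {n : ℕ} {a : Fx Φ} (ha : a ∈ Fx.component Φ n)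
    {S : Finset ℕ} (hS : S.card = n) : a ⊗ₜ[Φ] genProd Φ S ∈ grassmannMinusOneOne Φ := by
  have key : ∀ (w : FreeMagma (Empty ⊕ Unit)) (S : Finset ℕ), S.card = w.length →
      (varietyIdeal (varietyMinusOneOne Φ) Empty Unit).mkₗ (word Φ w) ⊗ₜ[Φ] genProd Φ S ∈
        grassmannMinusOneOne Φ := by
    intro w
    induction w with
    | ih1 s =>
      intro S hS
      obtain ⟨i, rfl⟩ := Finset.card_eq_one.1 hS
      rcases s with s | ⟨⟩
      · exact s.elim
      · have : genProd Φ {i} = gen Φ i := by simp [genProd]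
        rw [this]
        exact NonUnitalAlgebra.subset_adjoin Φ ⟨i, rfl⟩
    | ih2 u v hu hv =>
      intro S hS
      rw [length_mul] at hS
      obtain ⟨S₁, hS₁, hc⟩ := Finset.exists_subset_card_eq (s := S) (n := u.length) (by omega)
      have hc₂ : (S \ S₁).card = v.length := by
        rw [Finset.card_sdiff_of_subset hS₁]
        omega
      obtain ⟨r, hr⟩ := genProd_mul_of_disjoint (Φ := Φ) (Finset.disjoint_sdiff (s := S₁) (t := S))
      rw [Finset.union_sdiff_of_subset hS₁] at hr
      have h₁ : genProd Φ S = r⁻¹ • (genProd Φ S₁ * genProd Φ (S \ S₁)) := by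
        rw [hr, inv_smul_smul]
      have h₂ := mul_mem (hu S₁ hc) (hv _ hc₂)
      rw [Algebra.TensorProduct.tmul_mul_tmul, ← AlgIdeal.mkₗ_mul, ← word_mul] at h₂
      rw [h₁]
      rcases Int.units_eq_one_or r⁻¹ with hr' | hr' <;> rw [hr']
      · rwa [one_smul]
      · rw [Units.neg_smul, one_smul, TensorProduct.tmul_neg]
        exact neg_mem h₂
  induction ha using Submodule.span_induction with
  | mem a ha =>
    obtain ⟨w, hw, rfl⟩ := ha
    exact key w S (hS.trans hw.symm)
  | zero => rw [TensorProduct.zero_tmul]; exact zero_mem _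
  | add a b _ _ ha hb => rw [TensorProduct.add_tmul]; exact add_mem ha hb
  | smul r a _ ha => rw [← TensorProduct.smul_tmul']; exact SMulMemClass.smul_mem r ha

/-- The span of the elements `a ⊗ e_S` with `a` homogeneous of degree `|S|`. -/
def componentSpan (Φ : Type*) [Field Φ] : NonUnitalSubalgebra Φ (Fx Φ ⊗[Φ] Grassmann Φ) :=
  let T : Set (Fx Φ ⊗[Φ] Grassmann Φ) :=
    {w | ∃ S : Finset ℕ, ∃ a ∈ Fx.component Φ S.card, w = a ⊗ₜ[Φ] genProd Φ S}
  { Submodule.span Φ T with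
    mul_mem' := by
      suffices h : ∀ w w', w ∈ Submodule.span Φ T → w' ∈ Submodule.span Φ T →
        w * w' ∈ Submodule.span Φ T from fun {w w'} => h w w'
      intro w w' hw hw'
      induction hw, hw' using Submodule.span_induction₂ with
      | mem_mem w w' hw hw' =>
        obtain ⟨S, a, ha, rfl⟩ := hw
        obtain ⟨S', a', ha', rfl⟩ := hw'
        rw [Algebra.TensorProduct.tmul_mul_tmul]
        by_cases hd : Disjoint S S'
        · obtain ⟨r, hr⟩ := genProd_mul_of_disjoint (Φ := Φ) hd
          have hmem : (a * a') ⊗ₜ[Φ] genProd Φ (S ∪ S') ∈ Submodule.span Φ T :=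
            Submodule.subset_span ⟨_, _, by
              rw [Finset.card_union_of_disjoint hd]; exact Fx.mul_mem_component ha ha', rfl⟩
          rw [hr]
          rcases Int.units_eq_one_or r with hr' | hr' <;> rw [hr']
          · rwa [one_smul]
          · rw [Units.neg_smul, one_smul, TensorProduct.tmul_neg]
            exact neg_mem hmem
        · rw [genProd_mul_of_not_disjoint Φ hd, TensorProduct.tmul_zero]
          exact zero_mem _
      | zero_left => simp
      | zero_right => simp
      | add_left _ _ _ _ _ _ h₁ h₂ => rw [add_mul]; exact add_mem h₁ h₂
      | add_right _ _ _ _ _ _ h₁ h₂ => rw [mul_add]; exact add_mem h₁ h₂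
      | smul_left r _ _ _ _ h => rw [smul_mul_assoc]; exact Submodule.smul_mem _ r h
      | smul_right r _ _ _ _ h => rw [mul_smul_comm]; exact Submodule.smul_mem _ r h }

theorem linearIndependent_tmul_genProd {ι κ M : Type*} [AddCommGroup M] [Module Φ M]
    (b : Module.Basis ι Φ M) (i : κ → ι) (S : κ → Finset ℕ)
    (h : Function.Injective fun k => (i k, S k)) :
    LinearIndependent Φ fun k => b (i k) ⊗ₜ[Φ] genProd Φ (S k) := by
  have h := (b.tensorProduct (grassmannBasis Φ)).linearIndependent.comp _ h
  simpa only [Function.comp_def, Module.Basis.tensorProduct_apply, grassmannBasis_apply] using h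

/-- The algebra is exactly the span of `a ⊗ e_S` with `a` homogeneous of degree `|S|`. The proposed
elements form part of the tensor product basis of the ambient space. -/
theorem exists_basis_grassmannMinusOneOne (h2 : (2 : Φ) ≠ 0) (h3 : (3 : Φ) ≠ 0) :
    ∃ b : Module.Basis {q : ((ℕ →₀ ℕ) × Fin 2) × Finset ℕ //
        q.1 ≠ 0 ∧ q.2.card = wordDegree q.1} Φ (grassmannMinusOneOne Φ),
      ∀ q, ∃ a,
        (∀ a', IsNormalWord (fun i => (opR (Fx.x Φ) (Fx.x Φ))^[i] (Fx.x Φ * Fx.x Φ))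
          (Fx.x Φ) q.1.1 a' ↔ a' = a) ∧
        (b q : Fx Φ ⊗[Φ] Grassmann Φ) = a ⊗ₜ[Φ] genProd Φ q.1.2 := by
  obtain ⟨b₀, hb₀⟩ := Fx.hasNormalBasis (Φ := Φ) h2 h3
  have hcomp : ∀ p, b₀ p ∈ Fx.component Φ (wordDegree p.1) := fun p =>
    Fx.mem_component_of_isNormalWord ((hb₀ p _).2 rfl)
  let κ := {q : ((ℕ →₀ ℕ) × Fin 2) × Finset ℕ // q.1 ≠ 0 ∧ q.2.card = wordDegree q.1}
  let w : κ → grassmannMinusOneOne Φ := fun q =>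
    ⟨b₀ ⟨q.1.1, q.2.1⟩ ⊗ₜ[Φ] genProd Φ q.1.2, tmul_genProd_mem_grassmannMinusOneOne (hcomp _) q.2.2⟩
  let f : grassmannMinusOneOne Φ →ₗ[Φ] Fx Φ ⊗[Φ] Grassmann Φ :=
    { toFun := Subtype.val, map_add' := fun _ _ => rfl, map_smul' := fun _ _ => rfl }
  have hli : LinearIndependent Φ (f ∘ w) :=
    linearIndependent_tmul_genProd b₀ (fun q : κ => ⟨q.1.1, q.2.1⟩) (fun q => q.1.2) (by
      rintro ⟨⟨p, S⟩, h⟩ ⟨⟨p', S'⟩, h'⟩ heq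
      simp only [Prod.mk.injEq, Subtype.mk.injEq] at heq
      exact Subtype.ext (Prod.ext heq.1 heq.2))
  have hle : grassmannMinusOneOne Φ ≤ componentSpan Φ := by
    refine NonUnitalAlgebra.adjoin_le ?_
    rintro _ ⟨i, rfl⟩
    refine Submodule.subset_span ⟨{i}, Fx.x Φ, Fx.x_mem_component, ?_⟩
    simp [genProd]
  have hspan : (componentSpan Φ).toSubmodule ≤ Submodule.span Φ (Set.range (f ∘ w)) := by
    refine Submodule.span_le.2 ?_
    rintro _ ⟨S, a, ha, rfl⟩
    have ha' := Fx.mem_span_of_mem_component h2 b₀ _ hcomp ha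
    refine (Submodule.span_le (p := (Submodule.span Φ (Set.range (f ∘ w))).comap
      ((TensorProduct.mk Φ (Fx Φ) (Grassmann Φ)).flip (genProd Φ S)))).2 ?_ ha'
    rintro _ ⟨p, hp, rfl⟩
    exact Submodule.subset_span ⟨⟨(p.1, S), p.2, hp.symm⟩, rfl⟩
  have htop : Submodule.span Φ (Set.range w) = ⊤ := by
    refine eq_top_iff.2 fun g _ => ?_
    have hg := hspan (hle g.2)
    rw [Set.range_comp, ← Submodule.map_span] at hg
    obtain ⟨g', hg', h⟩ := hg
    have hgg : g' = g := Subtype.ext h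
    exact hgg ▸ hg'
  refine ⟨Module.Basis.mk (LinearIndependent.of_comp f hli) htop.ge,
    fun q => ⟨b₀ ⟨q.1.1, q.2.1⟩, fun a' => ?_, ?_⟩⟩
  · rw [hb₀ ⟨q.1.1, q.2.1⟩, eq_comm]
  · rw [Module.Basis.mk_apply]

end OneGenerator

end MinusOneOne

end

theorem proposition3p6 (Φ : Type*) [Field Φ] (h2 : ringChar Φ ≠ 2) (h3 : ringChar Φ ≠ 3)
    (Z : Type*) :
    -- `F[Z;x] ≅ B_0(Φ[T_Z], D, t_0)`
    (∃ f : FZx Φ Z →ₙₐ[Φ] BZero (shiftD Φ Z) (MvPolynomial.X (Sum.inl 0))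
          (constantCoeff_shiftD Φ Z) (MvPolynomial.constantCoeff_X Φ _),
        IsSuperIso (FZx.grading Φ Z) (BZero.grading _ _ _ _) f ∧
        (f (FZx.x Φ Z)).1 = VectorType.bar _ _ 1 ∧
        ∀ z : Z, (f (FZx.z Φ z)).1 =
          VectorType.ev _ _ (MvPolynomial.X (Sum.inr (z, 0)))) ∧
    -- the basis of `F[Z;x]`
    HasNormalBasis Φ
      (Sum.elim (fun i => (opR (FZx.x Φ Z) (FZx.x Φ Z))^[i] (FZx.x Φ Z * FZx.x Φ Z))
        (fun p : Z × ℕ => (opR (FZx.x Φ Z) (FZx.x Φ Z))^[p.2] (FZx.z Φ p.1)))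
      (FZx.x Φ Z) ∧
    -- `F_t ≅ B_0(Φ[t,z,s], s d/dz, t)`, `F_1 ≅ B(Φ[z,s], s d/dz, 1)`, `F_0 ≅ B_0(Φ[z,s], s d/dz, 0)`
    (∃ f : FT Φ →ₙₐ[Φ] BZero (sddz₃ Φ) (MvPolynomial.X 0)
          (constantCoeff_sddz₃ Φ) (MvPolynomial.constantCoeff_X Φ _),
        IsSuperIso (FT.grading Φ) (BZero.grading _ _ _ _) f ∧
        (f (FT.x Φ)).1 = VectorType.bar _ _ 1 ∧
        (f (FT.z Φ)).1 = VectorType.ev _ _ (MvPolynomial.X 1)) ∧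
    (∃ f : FOne Φ →ₙₐ[Φ] VectorType (sddz₂ Φ) 1,
        IsSuperIso (FOne.grading Φ) (VectorType.grading _ _) f ∧
        f (FOne.x Φ) = VectorType.bar _ _ 1 ∧
        f (FOne.z Φ) = VectorType.ev _ _ (MvPolynomial.X 0)) ∧
    (∃ f : FZero Φ →ₙₐ[Φ] BZero (sddz₂ Φ) 0
          (constantCoeff_sddz₂ Φ) (map_zero MvPolynomial.constantCoeff),
        IsSuperIso (FZero.grading Φ) (BZero.grading _ _ _ _) f ∧
        (f (FZero.x Φ)).1 = VectorType.bar _ _ 1 ∧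
        (f (FZero.z Φ)).1 = VectorType.ev _ _ (MvPolynomial.X 0)) ∧
    -- the bases of `F[z;x]`, `F_t`, `F_1`, `F_0`
    HasNormalBasis Φ
      (Sum.elim (fun i : ℕ => (opR (x₁ Φ) (x₁ Φ))^[i] (x₁ Φ * x₁ Φ))
        (fun j : ℕ => (opR (x₁ Φ) (x₁ Φ))^[j] (z₁ Φ)))
      (x₁ Φ) ∧
    HasNormalBasis Φ
      ![FT.x Φ * FT.x Φ, FT.z Φ, opR (FT.x Φ) (FT.x Φ) (FT.z Φ)] (FT.x Φ) ∧
    HasUnitalNormalBasis Φ (FOne.one Φ)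
      ![FOne.z Φ, opR (FOne.x Φ) (FOne.x Φ) (FOne.z Φ)] (FOne.x Φ) ∧
    HasNormalBasis Φ
      ![FZero.z Φ, opR (FZero.x Φ) (FZero.x Φ) (FZero.z Φ)] (FZero.x Φ) ∧
    -- the basis of the Grassmann `(-1,1)`-algebra
    ∃ b : Module.Basis {q : ((ℕ →₀ ℕ) × Fin 2) × Finset ℕ //
          q.1 ≠ 0 ∧ q.2.card = wordDegree q.1} Φ (grassmannMinusOneOne Φ),
      ∀ q, ∃ a,
        (∀ a', IsNormalWord (fun i => (opR (Fx.x Φ) (Fx.x Φ))^[i] (Fx.x Φ * Fx.x Φ))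
          (Fx.x Φ) q.1.1 a' ↔ a' = a) ∧
        (b q : Fx Φ ⊗[Φ] Grassmann Φ) = a ⊗ₜ[Φ] genProd Φ q.1.2 := by
  have h2' : (2 : Φ) ≠ 0 := Ring.two_ne_zero h2
  have h3' : (3 : Φ) ≠ 0 := by
    intro h
    have := (ringChar.spec Φ 3).1 (by exact_mod_cast h)
    -- If `3 = 0`, the characteristic divides `3`; the value `1` would give `1 = 0`.
    rcases (Nat.dvd_prime Nat.prime_three).1 this with h | h
    · exact one_ne_zero (α := Φ) (by simpa [h] using ringChar.Nat.cast_ringChar (R := Φ))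
    · exact h3 h
  obtain ⟨i, bi⟩ := FZx.isSuperIso_hasNormalBasis (Φ := Φ) h2' h3' Z
  obtain ⟨it, bt⟩ := FT.isSuperIso_hasNormalBasis (Φ := Φ) h2' h3'
  obtain ⟨i₁, b₁⟩ := FOne.isSuperIso_hasNormalBasis (Φ := Φ) h2' h3'
  obtain ⟨i₀, b₀⟩ := FZero.isSuperIso_hasNormalBasis (Φ := Φ) h2' h3'
  exact ⟨i, bi, it, i₁, i₀, FZx.hasNormalBasis_unit h2' h3', bt, b₁, b₀,
    exists_basis_grassmannMinusOneOne h2' h3'⟩
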